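/- Let $n\ge 2$ and let $\Omega\subset\mathbb{R}^n$ be a regular domain, i.e. a nonempty connected open set, bounded or unbounded, whose boundary is locally a $C^2$ hypersurface with $\Omega$ on one side of it; let $\nu$ be the outward unit normal on $\partial\Omega$, and let $H=\frac1{n-1}\operatorname{div}\nu$ be the mean curvature of $\partial\Omega$ with respect to $\nu$ (normalized so that the boundary of a ball of radius $R$ has $H=1/R$). Let $f:\mathbb{R}\to\mathbb{R}$ be locally Lipschitz continuous (for instance Lipschitz, or $C^1$), let $F$ be a primitive of $f$, and let $\kappa\in\mathbb{R}$ with $\kappa\neq 0$. Let $u\in C^3(\Omega)\cap C^1(\overline\Omega)$ be a bounded solution of the overdetermined problem $$\Delta u+f(u)=0\ \text{ in }\Omega,\qquad u>0\ \text{ in }\Omega,\qquad u=0\ \text{ on }\partial\Omega,\qquad \partial_\nu u=-\kappa\ \text{ on }\partial\Omega,$$ and put $P(x)=|\nabla u(x)|^2+2F(u(x))$. Assume that $$P(x)\le \kappa^2+2F(0)\qquad\text{for all }x\in\Omega .$$ Then $H(p)\le 0$ for every $p\in\partial\Omega$. Moreover, if $H(p)=0$ for some $p\in\partial\Omega$,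 then $P$ is constant in $\Omega$, and there are a unit vector $a\in\mathbb{R}^n$, a point $x_0\in\mathbb{R}^n$ and a function $g:\mathbb{R}\to\mathbb{R}$ such that $u(x)=g(a\cdot(x-x_0))$ for all $x\in\Omega$ (that is, $u$ is one-dimensional), and $\Omega$ is either the half-space $\{x: a\cdot(x-x_0)>0\}$ or a slab $\{x: 0<a\cdot(x-x_0)<L\}$ for some $L>0$. -/

import Mathlib

open scoped Gradient RealInnerProductSpace

/-- Euclidean space of dimension `n`. -/
abbrev Euc (n : ℕ) : Type := EuclideanSpace ℝ (Fin n)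

/-- `φ` is a `C²` defining function of `Ω` near the boundary point `p`: near `p` the set `Ω` is
`{φ < 0}`, and `φ` vanishes at `p` with nonzero gradient. -/
structure IsDefiningFunctionAt {n : ℕ} (Ω : Set (Euc n)) (p : Euc n) (φ : Euc n → ℝ) : Prop where
  contDiffAt : ContDiffAt ℝ 2 φ p
  map_eq_zero : φ p = 0
  gradient_ne_zero : ∇ φ p ≠ 0
  eventually_mem_iff : ∀ᶠ x in nhds p, (x ∈ Ω ↔ φ x < 0)

/-- A regular domain: a nonempty connected open set whose boundary is locally a `C²` hypersurface
with the set lying on one side of it. It may be bounded or unbounded. -/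
structure IsRegularDomain {n : ℕ} (Ω : Set (Euc n)) : Prop where
  isOpen : IsOpen Ω
  isConnected : IsConnected Ω
  exists_definingFunction : ∀ p ∈ frontier Ω, ∃ φ, IsDefiningFunctionAt Ω p φ

/-- The unit field `∇φ / |∇φ|` normal to the level sets of `φ`. -/
noncomputable def unitNormalField {n : ℕ} (φ : Euc n → ℝ) (x : Euc n) : Euc n :=
  ‖∇ φ x‖⁻¹ • ∇ φ x

/-- The divergence of a vector field at a point: the trace of its derivative. -/
noncomputable def divergence {n : ℕ} (X : Euc n → Euc n) (x : Euc n) : ℝ :=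
  LinearMap.trace ℝ (Euc n) (fderiv ℝ X x).toLinearMap

open Classical in
/-- Some `C²` defining function of `Ω` near `p` (the zero function if there is none). The normal
and the mean curvature below do not depend on this choice: see `outwardNormal_eq` and
`meanCurvature_eq`. -/
noncomputable def definingFunction {n : ℕ} (Ω : Set (Euc n)) (p : Euc n) : Euc n → ℝ :=
  if h : ∃ φ, IsDefiningFunctionAt Ω p φ then h.choose else 0

/-- The outward unit normal of `∂Ω` at `p`. -/
noncomputable def outwardNormal {n : ℕ} (Ω : Set (Euc n)) (p : Euc n) : Euc n :=
  unitNormalField (definingFunction Ω p) p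

/-- The mean curvature of `∂Ω` at `p`, namely `(n - 1)⁻¹ div ν` where `ν` is a unit normal field
near `p` which is the outward normal on `∂Ω`. As `ν` has unit length, `div ν` is the trace of the
differential of `ν` on the tangent space, the sum of the principal curvatures. With this sign the
sphere bounding a ball of radius `R` has mean curvature `1 / R`. -/
noncomputable def meanCurvature {n : ℕ} (Ω : Set (Euc n)) (p : Euc n) : ℝ :=
  ((n : ℝ) - 1)⁻¹ * divergence (unitNormalField (definingFunction Ω p)) p

theorem IsDefiningFunctionAt.hasFDerivAt_gradient {n : ℕ} {Ω : Set (Euc n)} {p : Euc n}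
    {φ : Euc n → ℝ} (h : IsDefiningFunctionAt Ω p φ) :
    HasFDerivAt (∇ φ) (fderiv ℝ (∇ φ) p) p := by
  have h1 : ContDiffAt ℝ 1 (fderiv ℝ φ) p :=
    h.contDiffAt.fderiv_right (m := 1) (by norm_num)
  have h2 : DifferentiableAt ℝ (fderiv ℝ φ) p := h1.differentiableAt (by norm_num)
  have h3 : DifferentiableAt ℝ (∇ φ) p :=
    ((InnerProductSpace.toDual ℝ (Euc n)).symm.toContinuousLinearEquiv.differentiableAt).comp p h2
  exact h3.hasFDerivAt

/-- First and second derivative of a defining function along a parabola. -/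
theorem IsDefiningFunctionAt.deriv_parabola {n : ℕ} {Ω : Set (Euc n)} {p : Euc n}
    {φ : Euc n → ℝ} (h : IsDefiningFunctionAt Ω p φ) (e w : Euc n) :
    HasDerivAt (fun t : ℝ => φ (p + t • e + t ^ 2 • w)) ⟪∇ φ p, e⟫ 0 ∧
    HasDerivAt (deriv (fun t : ℝ => φ (p + t • e + t ^ 2 • w)))
      (⟪fderiv ℝ (∇ φ) p e, e⟫ + 2 * ⟪∇ φ p, w⟫) 0 := by
  have hγ : ∀ t : ℝ, HasDerivAt (fun t : ℝ => p + t • e + t ^ 2 • w) (e + (2 * t) • w) t := by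
    intro t
    have h1 : HasDerivAt (fun t : ℝ => t • e) e t := by
      simpa using (hasDerivAt_id t).smul_const e
    have h2 : HasDerivAt (fun t : ℝ => t ^ 2 • w) ((2 * t) • w) t := by
      simpa using (hasDerivAt_pow 2 t).smul_const w
    exact (h1.const_add p).add h2
  have hcont : ContinuousAt (fun t : ℝ => p + t • e + t ^ 2 • w) 0 := (hγ 0).continuousAt
  have hev : ∀ᶠ x in nhds p, DifferentiableAt ℝ φ x := by
    filter_upwards [h.contDiffAt.eventually (by simp)] with x hx
    exact hx.differentiableAt (by norm_num)
  have hp0 : p + (0 : ℝ) • e + (0 : ℝ) ^ 2 • w = p := by simp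
  have hev' : ∀ᶠ t in nhds (0 : ℝ), HasDerivAt (fun t : ℝ => φ (p + t • e + t ^ 2 • w))
      ⟪∇ φ (p + t • e + t ^ 2 • w), e + (2 * t) • w⟫ t := by
    have hc' : Filter.Tendsto (fun t : ℝ => p + t • e + t ^ 2 • w) (nhds 0) (nhds p) := by
      have := hcont.tendsto
      simpa only [hp0] using this
    filter_upwards [hc'.eventually hev] with t ht
    have := ht.hasGradientAt.hasFDerivAt.comp_hasDerivAt t (hγ t)
    rw [InnerProductSpace.toDual_apply_apply] at this
    exact this
  constructor
  · simpa using hev'.self_of_nhds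
  · have hd : deriv (fun t : ℝ => φ (p + t • e + t ^ 2 • w)) =ᶠ[nhds 0]
        fun t => ⟪∇ φ (p + t • e + t ^ 2 • w), e + (2 * t) • w⟫ := by
      filter_upwards [hev'] with t ht using ht.deriv
    refine HasDerivAt.congr_of_eventuallyEq ?_ hd
    have h1 : HasDerivAt (fun t : ℝ => ∇ φ (p + t • e + t ^ 2 • w))
        (fderiv ℝ (∇ φ) p e) 0 := by
      have := (hp0.symm ▸ h.hasFDerivAt_gradient :
        HasFDerivAt (∇ φ) (fderiv ℝ (∇ φ) p) (p + (0 : ℝ) • e + (0 : ℝ) ^ 2 • w))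
      have h0 := this.comp_hasDerivAt (0 : ℝ) (hγ 0)
      rw [mul_zero, zero_smul, add_zero] at h0
      exact h0
    have h2 : HasDerivAt (fun t : ℝ => e + (2 * t) • w) ((2 : ℝ) • w) 0 := by
      have : HasDerivAt (fun t : ℝ => (2 * t)) (2 : ℝ) 0 := by
        simpa using (hasDerivAt_id (0 : ℝ)).const_mul 2
      simpa using (this.smul_const w).const_add e
    have h3 := h1.inner ℝ h2
    simp only [hp0] at h3
    rw [mul_zero, zero_smul, add_zero, inner_smul_right, add_comm] at h3
    exact h3

/-- If one defining function is convex to second order along a parabola, so is any other. -/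
theorem IsDefiningFunctionAt.second_order {n : ℕ} {Ω : Set (Euc n)} {p : Euc n}
    {φ ψ : Euc n → ℝ} (h : IsDefiningFunctionAt Ω p φ) (k : IsDefiningFunctionAt Ω p ψ)
    {e w : Euc n} (he : ⟪∇ φ p, e⟫ = 0) (he' : ⟪∇ ψ p, e⟫ = 0)
    (hpos : 0 < ⟪fderiv ℝ (∇ φ) p e, e⟫ + 2 * ⟪∇ φ p, w⟫) :
    0 ≤ ⟪fderiv ℝ (∇ ψ) p e, e⟫ + 2 * ⟪∇ ψ p, w⟫ := by
  by_contra! hneg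
  obtain ⟨a1, a2⟩ := h.deriv_parabola e w
  obtain ⟨b1, b2⟩ := k.deriv_parabola e w
  have m1 := isLocalMin_of_deriv_deriv_pos (by rw [a2.deriv]; exact hpos)
    (by rw [a1.deriv, he]) a1.continuousAt
  have m2 := isLocalMax_of_deriv_deriv_neg (by rw [b2.deriv]; exact hneg)
    (by rw [b1.deriv, he']) b1.continuousAt
  have hcont : Filter.Tendsto (fun t : ℝ => p + t • e + t ^ 2 • w) (nhds 0) (nhds p) := by
    have : Continuous (fun t : ℝ => p + t • e + t ^ 2 • w) := by fun_prop
    simpa using this.tendsto 0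
  have hz : (fun t : ℝ => ψ (p + t • e + t ^ 2 • w)) =ᶠ[nhds 0] fun _ => 0 := by
    filter_upwards [m1, m2, hcont.eventually h.eventually_mem_iff,
      hcont.eventually k.eventually_mem_iff] with t t1 t2 t3 t4
    simp only [zero_smul, add_zero, ne_eq, OfNat.ofNat_ne_zero, not_false_eq_true, zero_pow,
      h.map_eq_zero, k.map_eq_zero] at t1 t2
    refine le_antisymm t2 ?_
    by_contra! hlt
    exact absurd (t3.1 (t4.2 hlt)) (not_lt.2 t1)
  have : deriv (deriv fun t : ℝ => ψ (p + t • e + t ^ 2 • w)) 0 = 0 := by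
    rw [hz.deriv.deriv_eq]; simp
  rw [b2.deriv] at this
  exact hneg.ne this

theorem IsDefiningFunctionAt.first_order {n : ℕ} {Ω : Set (Euc n)} {p : Euc n}
    {φ ψ : Euc n → ℝ} (h : IsDefiningFunctionAt Ω p φ) (k : IsDefiningFunctionAt Ω p ψ)
    {v : Euc n} (hv : 0 < ⟪∇ φ p, v⟫) : 0 ≤ ⟪∇ ψ p, v⟫ := by
  have := h.second_order k (e := 0) (w := v) (by simp) (by simp) (by simpa using hv)
  simpa using this

/-- The gradients of two defining functions are positively proportional. -/
theorem IsDefiningFunctionAt.gradient_eq_smul {n : ℕ} {Ω : Set (Euc n)} {p : Euc n}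
    {φ ψ : Euc n → ℝ} (h : IsDefiningFunctionAt Ω p φ) (k : IsDefiningFunctionAt Ω p ψ) :
    ∃ c : ℝ, 0 < c ∧ ∇ ψ p = c • ∇ φ p := by
  have ha := h.gradient_ne_zero
  have hb := k.gradient_ne_zero
  have key := fun v => h.first_order k (v := v)
  generalize ∇ φ p = a at *
  generalize ∇ ψ p = b at *
  have haa : 0 < ⟪a, a⟫ := real_inner_self_pos.2 ha
  obtain ⟨z, hz⟩ : ∃ z, z = b - (⟪a, b⟫ / ⟪a, a⟫) • a := ⟨_, rfl⟩
  have haz : ⟪a, z⟫ = 0 := by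
    rw [hz, inner_sub_right, inner_smul_right]; field_simp; ring
  have hbz : ⟪b, z⟫ = ⟪z, z⟫ := by
    have : b = z + (⟪a, b⟫ / ⟪a, a⟫) • a := by rw [hz]; simp
    conv_lhs => rw [this]
    rw [inner_add_left, real_inner_smul_left, haz]; simp
  have hz0 : z = 0 := by
    by_contra hne
    have hzz : 0 < ⟪z, z⟫ := real_inner_self_pos.2 hne
    have hs : ∀ s : ℝ, 0 ≤ ⟪b, a⟫ - s * ⟪z, z⟫ := by
      intro s
      have := key (a - s • z) (by
        rw [inner_sub_right, inner_smul_right, haz]; simpa using haa)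
      rwa [inner_sub_right, inner_smul_right, hbz] at this
    have := hs ((⟪b, a⟫ + 1) / ⟪z, z⟫)
    rw [div_mul_cancel₀ _ hzz.ne'] at this
    linarith
  have hb' : b = (⟪a, b⟫ / ⟪a, a⟫) • a := by
    rw [hz0] at hz; exact (sub_eq_zero.1 hz.symm)
  refine ⟨_, ?_, hb'⟩
  have h0 : 0 ≤ ⟪b, a⟫ := key a haa
  rw [real_inner_comm] at h0
  refine lt_of_le_of_ne (by positivity) fun h0 => hb ?_
  rw [hb', ← h0, zero_smul]

theorem unitNormalField_eq {n : ℕ} {Ω : Set (Euc n)} {p : Euc n} {φ ψ : Euc n → ℝ}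
    (h : IsDefiningFunctionAt Ω p φ) (k : IsDefiningFunctionAt Ω p ψ) :
    unitNormalField ψ p = unitNormalField φ p := by
  obtain ⟨c, hc, hcb⟩ := h.gradient_eq_smul k
  simp only [unitNormalField, hcb, norm_smul, smul_smul, Real.norm_eq_abs, abs_of_pos hc]
  congr 1
  field_simp

theorem IsDefiningFunctionAt.hessian_le {n : ℕ} {Ω : Set (Euc n)} {p : Euc n}
    {φ ψ : Euc n → ℝ} (h : IsDefiningFunctionAt Ω p φ) (k : IsDefiningFunctionAt Ω p ψ)
    {c : ℝ} (hc : ∇ ψ p = c • ∇ φ p) {e : Euc n} (he : ⟪∇ φ p, e⟫ = 0) :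
    c * ⟪fderiv ℝ (∇ φ) p e, e⟫ ≤ ⟪fderiv ℝ (∇ ψ) p e, e⟫ := by
  have haa : 0 < ⟪∇ φ p, ∇ φ p⟫ := real_inner_self_pos.2 h.gradient_ne_zero
  have key : ∀ δ : ℝ, 0 < δ →
      0 ≤ ⟪fderiv ℝ (∇ ψ) p e, e⟫ + c * (δ - ⟪fderiv ℝ (∇ φ) p e, e⟫) := by
    intro δ hδ
    have := h.second_order k (e := e)
      (w := ((δ - ⟪fderiv ℝ (∇ φ) p e, e⟫) / (2 * ⟪∇ φ p, ∇ φ p⟫)) • ∇ φ p) he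
      (by rw [hc, real_inner_smul_left, he, mul_zero])
      (by rw [inner_smul_right]; field_simp; linarith)
    rw [hc, real_inner_smul_left, inner_smul_right] at this
    field_simp at this
    linarith
  refine le_of_forall_pos_le_add fun ε hε => ?_
  have hpos : 0 < |c| + 1 := by positivity
  have := key (ε / (|c| + 1)) (by positivity)
  have h2 : c * (ε / (|c| + 1)) ≤ ε := by
    rw [mul_div_assoc', div_le_iff₀ hpos]
    nlinarith [le_abs_self c]
  linarith

theorem IsDefiningFunctionAt.unitNormalField_deriv {n : ℕ} {Ω : Set (Euc n)} {p : Euc n}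
    {φ : Euc n → ℝ} (h : IsDefiningFunctionAt Ω p φ) :
    (∀ e : Euc n, ⟪∇ φ p, e⟫ = 0 → ⟪e, fderiv ℝ (unitNormalField φ) p e⟫ =
      ‖∇ φ p‖⁻¹ * ⟪fderiv ℝ (∇ φ) p e, e⟫) ∧
    ∀ v : Euc n, ⟪∇ φ p, fderiv ℝ (unitNormalField φ) p v⟫ = 0 := by
  have hA := h.hasFDerivAt_gradient
  have ha := h.gradient_ne_zero
  have hn : DifferentiableAt ℝ (fun y => ‖∇ φ y‖⁻¹) p :=
    ((hA.differentiableAt.norm ℝ ha).inv (norm_ne_zero_iff.2 ha))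
  have hN : HasFDerivAt (unitNormalField φ) _ p := hn.hasFDerivAt.smul hA
  constructor
  · intro e he
    rw [hN.fderiv]
    have : ⟪e, ∇ φ p⟫ = 0 := by rw [real_inner_comm]; exact he
    simp [inner_add_right, inner_smul_right, this, real_inner_comm]
  · intro v
    have hev : (fun y => ⟪unitNormalField φ y, unitNormalField φ y⟫) =ᶠ[nhds p]
        fun _ => (1 : ℝ) := by
      filter_upwards [hA.continuousAt.eventually_ne ha] with y hy
      rw [real_inner_self_eq_norm_sq, unitNormalField, norm_smul, norm_inv, norm_norm,
        inv_mul_cancel₀ (norm_ne_zero_iff.2 hy), one_pow]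
    have h1 := (hN.inner ℝ hN).congr_of_eventuallyEq hev.symm
    have h2 := h1.unique (hasFDerivAt_const (1 : ℝ) p)
    have h3 := congrArg (fun T => T v) h2
    rw [hN.fderiv]
    simp only [ContinuousLinearMap.comp_apply, fderivInnerCLM_apply,
      ContinuousLinearMap.prod_apply, zero_apply] at h3
    rw [real_inner_comm (unitNormalField φ p), ← two_mul] at h3
    have h4 : ∇ φ p = ‖∇ φ p‖ • unitNormalField φ p := by
      rw [unitNormalField, smul_smul, mul_inv_cancel₀ (norm_ne_zero_iff.2 ha), one_smul]
    have h5 : ∀ w : Euc n, ⟪unitNormalField φ p, w⟫ = 0 → ⟪∇ φ p, w⟫ = 0 := by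
      intro w hw
      rw [h4, real_inner_smul_left, hw, mul_zero]
    exact h5 _ (by linarith)

theorem divergence_unitNormalField_eq {n : ℕ} {Ω : Set (Euc n)} {p : Euc n} {φ ψ : Euc n → ℝ}
    (h : IsDefiningFunctionAt Ω p φ) (k : IsDefiningFunctionAt Ω p ψ) :
    divergence (unitNormalField ψ) p = divergence (unitNormalField φ) p := by
  obtain ⟨c, hc, hcb⟩ := h.gradient_eq_smul k
  have hcb' : ∇ φ p = c⁻¹ • ∇ ψ p := by rw [hcb, smul_smul, inv_mul_cancel₀ hc.ne', one_smul]
  obtain ⟨a1, a2⟩ := h.unitNormalField_deriv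
  obtain ⟨b1, b2⟩ := k.unitNormalField_deriv
  have ha := h.gradient_ne_zero
  obtain ⟨s, b, hs, hb⟩ := Orthonormal.exists_orthonormalBasis_extension (𝕜 := ℝ)
    (v := {unitNormalField φ p}) (E := Euc n) (by
      refine orthonormal_subtype_iff_ite.2 ?_
      intro v hv w hw
      simp only [Set.mem_singleton_iff] at hv hw
      subst hv; subst hw
      rw [real_inner_self_eq_norm_sq, unitNormalField, norm_smul, norm_inv, norm_norm,
        inv_mul_cancel₀ (norm_ne_zero_iff.2 ha)]
      simp)
  rw [divergence, divergence, LinearMap.trace_eq_sum_inner _ b, LinearMap.trace_eq_sum_inner _ b]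
  refine Finset.sum_congr rfl fun i _ => ?_
  have h4 : ∇ φ p = ‖∇ φ p‖ • unitNormalField φ p := by
    rw [unitNormalField, smul_smul, mul_inv_cancel₀ (norm_ne_zero_iff.2 ha), one_smul]
  obtain ⟨i0, hi0⟩ : ∃ i0, b i0 = unitNormalField φ p :=
    ⟨⟨_, hs rfl⟩, by rw [hb]⟩
  by_cases hi : i = i0
  · subst hi
    have hz : ∀ w : Euc n, ⟪∇ φ p, w⟫ = 0 → ⟪b i, w⟫ = 0 := by
      intro w hw
      rw [hi0, unitNormalField, real_inner_smul_left, hw, mul_zero]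
    simp only [ContinuousLinearMap.coe_coe]
    rw [hz _ (a2 _), hz]
    rw [hcb', real_inner_smul_left, b2, mul_zero]
  · have he : ⟪∇ φ p, b i⟫ = 0 := by
      rw [h4, real_inner_smul_left, ← hi0, b.inner_eq_zero (Ne.symm hi), mul_zero]
    have he' : ⟪∇ ψ p, b i⟫ = 0 := by rw [hcb, real_inner_smul_left, he, mul_zero]
    simp only [ContinuousLinearMap.coe_coe]
    rw [a1 _ he, b1 _ he']
    have l1 := h.hessian_le k hcb he
    have l2 := k.hessian_le h hcb' he'
    have l3 : ⟪fderiv ℝ (∇ ψ) p (b i), b i⟫ = c * ⟪fderiv ℝ (∇ φ) p (b i), b i⟫ := by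
      refine le_antisymm ?_ l1
      have := mul_le_mul_of_nonneg_left l2 hc.le
      rwa [mul_inv_cancel_left₀ hc.ne'] at this
    rw [l3, hcb, norm_smul, Real.norm_eq_abs, abs_of_pos hc, mul_inv]
    field_simp

theorem isDefiningFunctionAt_definingFunction {n : ℕ} {Ω : Set (Euc n)} {p : Euc n}
    {φ : Euc n → ℝ} (h : IsDefiningFunctionAt Ω p φ) :
    IsDefiningFunctionAt Ω p (definingFunction Ω p) := by
  have hex : ∃ φ, IsDefiningFunctionAt Ω p φ := ⟨φ, h⟩
  rw [definingFunction, dif_pos hex]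
  exact hex.choose_spec

/-- The outward normal can be computed with any defining function. -/
theorem outwardNormal_eq {n : ℕ} {Ω : Set (Euc n)} {p : Euc n} {φ : Euc n → ℝ}
    (h : IsDefiningFunctionAt Ω p φ) : outwardNormal Ω p = unitNormalField φ p :=
  unitNormalField_eq h (isDefiningFunctionAt_definingFunction h)

/-- The mean curvature can be computed with any defining function. -/
theorem meanCurvature_eq {n : ℕ} {Ω : Set (Euc n)} {p : Euc n} {φ : Euc n → ℝ}
    (h : IsDefiningFunctionAt Ω p φ) :
    meanCurvature Ω p = ((n : ℝ) - 1)⁻¹ * divergence (unitNormalField φ) p := by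
  rw [meanCurvature, divergence_unitNormalField_eq h (isDefiningFunctionAt_definingFunction h)]

/-- `u` is a bounded `C³` solution (`C³` inside, `C¹` up to the boundary) of
`Δu + f(u) = 0`, `u > 0` in `Ω`, with `u = 0` and `∂u/∂ν = -κ` on `∂Ω`. Only the values of `u` on
the closure of `Ω` matter. -/
structure IsBoundedSolution {n : ℕ} (Ω : Set (Euc n)) (f : ℝ → ℝ) (κ : ℝ) (u : Euc n → ℝ) :
    Prop where
  contDiffOn_interior : ContDiffOn ℝ 3 u Ω
  contDiffOn_closure : ContDiffOn ℝ 1 u (closure Ω)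
  bounded : ∃ M : ℝ, ∀ x ∈ Ω, |u x| ≤ M
  equation : ∀ x ∈ Ω, Laplacian.laplacian u x + f (u x) = 0
  positive : ∀ x ∈ Ω, 0 < u x
  dirichlet : ∀ p ∈ frontier Ω, u p = 0
  neumann : ∀ p ∈ frontier Ω,
    HasDerivWithinAt (fun t : ℝ => u (p + t • outwardNormal Ω p)) (-κ) (Set.Iic 0) 0

/-- The `P`-function `|∇u|² + 2 F(u)`. -/
noncomputable def PFunction {n : ℕ} (F : ℝ → ℝ) (u : Euc n → ℝ) (x : Euc n) : ℝ :=
  ‖∇ u x‖ ^ 2 + 2 * F (u x)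

/-- The open half-space `{x | a · (x - x₀) > 0}`. -/
def halfSpace {n : ℕ} (a x₀ : Euc n) : Set (Euc n) := {x | 0 < ⟪a, x - x₀⟫}

/-- The open slab `{x | 0 < a · (x - x₀) < L}`. -/
def slab {n : ℕ} (a x₀ : Euc n) (L : ℝ) : Set (Euc n) := {x | 0 < ⟪a, x - x₀⟫ ∧ ⟪a, x - x₀⟫ < L}

/-! Write `P₀ = κ² + 2F(0)`. For a solution smooth up to the boundary, the equation gives `∂_ν P =
-2(n-1)κ²H` on `∂Ω`, where `P` takes its largest possible value `P₀`. So `∂_ν P ≥ 0` and `H ≤ 0`,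
and Hopf's lemma decides the case of equality. Here `u` is only `C¹` up to the boundary and `P` has
no normal derivative there, so the comparison is made with `w = profileTime F P₀ ∘ u`, the time at
which the one-dimensional profile `g' = √(P₀ - 2F(g))` reaches the height `u`. As long as the gap
`P₀ - 2F` is positive, the bound on `P` says that `|∇w| ≤ 1`.

Integrating this from the boundary inwards bounds `w` to second order by the height above the
boundary graph (`IsBoundaryData.profileTime_le`). At the same time `Δw` tends to `0` at the
boundary, because `|∇u|` tends to `κ`. The second order bound has Laplacian `-(n-1)H`, so a
perturbed maximum argument yields `H ≤ 0` (`meanCurvature_add_le`).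

Suppose now that `H(p) = 0`. Where `∇u` is bounded away from zero, Cauchy–Schwarz turns `ΔP =
2|D²u|² - 2(Δu)²` into `Δ(P₀ - P) ≤ K|∇P|`. On an interior ball touching `∂Ω` at `p`,
`eq_zero_or_hopf` leaves two cases. Either `P₀ - P` grows linearly from the sphere; this improves
the bound on the slope of `w`, adds a positive constant to the curvature inequality and gives `H(p)
< 0` (`meanCurvature_neg_of_hopf`). Or `P = P₀` on the ball; then the Hessian of `u` is `Δu` times
the projection on `∇u`, the direction of `∇u` is constant, and `w` is the distance to the tangent
hyperplane at `p`.

The strong maximum principle carries this affine form through the whole strip on which the profile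
increases, and keeps the strip inside `Ω` (`strip_propagation`). If the profile needs infinite time
to reach its top height, `Ω` is a half-space. Otherwise `u` reaches that height with zero gradient
on a hyperplane. Beyond it the bound on `P` prevents `u` from descending faster than its mirror
image, and Hopf's lemma for the difference, which uses the Lipschitz bound on `f`, forces equality
(`exists_reflected_seed`). A second strip then completes a slab. -/

section

open Filter Topology Set

/-! ### Pointwise second derivatives along lines -/

/-- `y` is differentiable near `0` with `y' 0 = a`, and `y'' 0 = b`. -/
def HasDerivTwo (y : ℝ → ℝ) (a b : ℝ) : Prop :=
  ∃ d : ℝ → ℝ, (∀ᶠ t in 𝓝 0, HasDerivAt y (d t) t) ∧ d 0 = a ∧ HasDerivAt d b 0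

namespace HasDerivTwo

variable {y z : ℝ → ℝ} {a b a' b' : ℝ}

theorem hasDerivAt (h : HasDerivTwo y a b) : HasDerivAt y a 0 := by
  obtain ⟨d, h1, rfl, -⟩ := h
  exact h1.self_of_nhds

theorem congr (h : HasDerivTwo y a b) (hyz : z =ᶠ[𝓝 0] y) : HasDerivTwo z a b := by
  obtain ⟨d, h1, h2, h3⟩ := h
  refine ⟨d, ?_, h2, h3⟩
  filter_upwards [h1, hyz.eventuallyEq_nhds] with t ht1 ht2
  exact ht1.congr_of_eventuallyEq ht2

theorem add (h : HasDerivTwo y a b) (k : HasDerivTwo z a' b') :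
    HasDerivTwo (fun t => y t + z t) (a + a') (b + b') := by
  obtain ⟨d, h1, h2, h3⟩ := h
  obtain ⟨d', k1, k2, k3⟩ := k
  refine ⟨fun t => d t + d' t, ?_, by simp [h2, k2], h3.add k3⟩
  filter_upwards [h1, k1] with t ht1 ht2 using ht1.add ht2

theorem const_mul (c : ℝ) (h : HasDerivTwo y a b) :
    HasDerivTwo (fun t => c * y t) (c * a) (c * b) := by
  obtain ⟨d, h1, h2, h3⟩ := h
  refine ⟨fun t => c * d t, ?_, by simp [h2], h3.const_mul c⟩
  filter_upwards [h1] with t ht1 using ht1.const_mul c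

theorem sub (h : HasDerivTwo y a b) (k : HasDerivTwo z a' b') :
    HasDerivTwo (fun t => y t - z t) (a - a') (b - b') := by
  simpa [sub_eq_add_neg] using h.add (k.const_mul (-1))

theorem const (c : ℝ) : HasDerivTwo (fun _ => c) 0 0 :=
  ⟨fun _ => 0, Eventually.of_forall fun t => hasDerivAt_const t c, rfl, hasDerivAt_const _ _⟩

theorem comp {g g' : ℝ → ℝ} {g'' : ℝ} (hg : ∀ᶠ r in 𝓝 (y 0), HasDerivAt g (g' r) r)
    (hg' : HasDerivAt g' g'' (y 0)) (h : HasDerivTwo y a b) :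
    HasDerivTwo (fun t => g (y t)) (g' (y 0) * a) (g'' * a ^ 2 + g' (y 0) * b) := by
  have hc := h.hasDerivAt
  obtain ⟨d, h1, h2, h3⟩ := h
  refine ⟨fun t => g' (y t) * d t, ?_, by simp [h2], ?_⟩
  · filter_upwards [h1, hc.continuousAt.eventually hg] with t ht1 ht2
    exact ht2.comp t ht1
  · have := (hg'.comp (0 : ℝ) hc).mul h3
    refine this.congr_deriv ?_
    simp only [Function.comp_apply, h2]
    ring

theorem quadratic (c a b : ℝ) : HasDerivTwo (fun t => c + t * a + t ^ 2 * b) a (2 * b) := by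
  refine ⟨fun t => a + 2 * t * b, Eventually.of_forall fun t => ?_, by simp, ?_⟩
  · have := ((hasDerivAt_id t).mul_const a |>.const_add c).add ((hasDerivAt_pow 2 t).mul_const b)
    refine this.congr_deriv ?_
    simp
  · have := (((hasDerivAt_id (0 : ℝ)).const_mul 2).mul_const b).const_add a
    exact this.congr_deriv (by simp)

theorem unique (h : HasDerivTwo y a b) (k : HasDerivTwo y a' b') : b = b' := by
  obtain ⟨d, h1, h2, h3⟩ := h
  obtain ⟨d', k1, k2, k3⟩ := k
  have : d =ᶠ[𝓝 0] d' := by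
    filter_upwards [h1, k1] with t ht1 ht2 using ht1.unique ht2
  exact (h3.congr_of_eventuallyEq this.symm).unique k3

/-- Second derivative test at a local maximum. -/
theorem nonpos_of_isLocalMax (h : HasDerivTwo y a b) (hm : IsLocalMax y 0) : b ≤ 0 := by
  have ha : a = 0 := hm.hasDerivAt_eq_zero h.hasDerivAt
  by_contra! hb
  have h0 := h
  obtain ⟨d, h1, h2, h3⟩ := h
  have hd : deriv y =ᶠ[𝓝 0] d := by
    filter_upwards [h1] with t ht using ht.deriv
  have hdd : deriv (deriv y) 0 = b := by rw [hd.deriv_eq, h3.deriv]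
  have hmin : IsLocalMin y 0 := isLocalMin_of_deriv_deriv_pos (by rw [hdd]; exact hb)
    (by rw [hd.eq_of_nhds, h2, ha]) h0.hasDerivAt.continuousAt
  -- With `b > 0` the point is a local minimum as well, so `y` is constant near `0` and its second
  -- derivative is `0`.
  have hz : y =ᶠ[𝓝 0] fun _ => y 0 := by
    filter_upwards [hm, hmin] with t t1 t2 using le_antisymm t1 t2
  have := h0.unique ((HasDerivTwo.const (y 0)).congr hz)
  exact hb.ne' this

end HasDerivTwo

/-- First and second derivatives at `x` along the line through `x` with direction `e`. -/
def HasLineDerivTwo {n : ℕ} (v : Euc n → ℝ) (x e : Euc n) (a b : ℝ) : Prop :=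
  HasDerivTwo (fun t : ℝ => v (x + t • e)) a b

theorem hasDerivAt_line {n : ℕ} {v : Euc n → ℝ} {x e : Euc n} {t : ℝ}
    (h : DifferentiableAt ℝ v (x + t • e)) :
    HasDerivAt (fun t : ℝ => v (x + t • e)) (fderiv ℝ v (x + t • e) e) t := by
  have h1 : HasDerivAt (fun t : ℝ => x + t • e) e t := by
    simpa using ((hasDerivAt_id t).smul_const e).const_add x
  exact h.hasFDerivAt.comp_hasDerivAt t h1

theorem tendsto_line {n : ℕ} (x e : Euc n) :
    Tendsto (fun t : ℝ => x + t • e) (𝓝 0) (𝓝 x) := by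
  have : Continuous (fun t : ℝ => x + t • e) := by fun_prop
  simpa using this.tendsto 0

/-- The line derivatives of a function whose partial derivative is itself differentiable. -/
theorem hasLineDerivTwo_of_fderiv {n : ℕ} {v d : Euc n → ℝ} {x e : Euc n}
    (hv : ∀ᶠ z in 𝓝 x, DifferentiableAt ℝ v z) (hvd : ∀ᶠ z in 𝓝 x, fderiv ℝ v z e = d z)
    (hd : DifferentiableAt ℝ d x) : HasLineDerivTwo v x e (d x) (fderiv ℝ d x e) := by
  refine ⟨fun t => d (x + t • e), ?_, by simp, ?_⟩
  · filter_upwards [(tendsto_line x e).eventually hv, (tendsto_line x e).eventually hvd]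
      with t ht1 ht2
    rw [← ht2]
    exact hasDerivAt_line ht1
  · have hx : x + (0 : ℝ) • e = x := by simp
    have := hasDerivAt_line (v := d) (x := x) (e := e) (t := 0) (by rw [hx]; exact hd)
    rwa [hx] at this

theorem ContDiffAt.hasLineDerivTwo {n : ℕ} {v : Euc n → ℝ} {x : Euc n} (h : ContDiffAt ℝ 2 v x)
    (e : Euc n) :
    HasLineDerivTwo v x e (fderiv ℝ v x e) (fderiv ℝ (fderiv ℝ v) x e e) := by
  have h1 : ContDiffAt ℝ 1 (fderiv ℝ v) x := h.fderiv_right (m := 1) (by norm_num)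
  have h2 : DifferentiableAt ℝ (fderiv ℝ v) x := h1.differentiableAt (by norm_num)
  have h3 := h2.hasFDerivAt.clm_apply (hasFDerivAt_const e x)
  have := hasLineDerivTwo_of_fderiv (v := v) (d := fun z => fderiv ℝ v z e) (x := x) (e := e) (by
    filter_upwards [h.eventually (by simp)] with z hz
    exact hz.differentiableAt (by norm_num)) (Eventually.of_forall fun _ => rfl)
    h3.differentiableAt
  rw [h3.fderiv] at this
  simpa using this

/-- The standard basis vectors. -/
noncomputable abbrev stdVec {n : ℕ} (i : Fin n) : Euc n := EuclideanSpace.basisFun (Fin n) ℝ i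

theorem laplacian_eq_sum {n : ℕ} {ι : Type*} [Fintype ι] (v : Euc n → ℝ) (x : Euc n)
    (b : OrthonormalBasis ι ℝ (Euc n)) :
    Laplacian.laplacian v x = ∑ i, fderiv ℝ (fderiv ℝ v) x (b i) (b i) := by
  rw [InnerProductSpace.laplacian_eq_iteratedFDeriv_orthonormalBasis v b]
  simp [iteratedFDeriv_two_apply]

theorem HasLineDerivTwo.nonpos_of_isLocalMax {n : ℕ} {v : Euc n → ℝ} {x e : Euc n} {a b : ℝ}
    (h : HasLineDerivTwo v x e a b) (hm : IsLocalMax v x) : b ≤ 0 := by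
  refine HasDerivTwo.nonpos_of_isLocalMax h ?_
  have := (tendsto_line x e).eventually hm
  simpa [IsLocalMax, IsMaxFilter] using this

/-- The squared distance to a point, along a line. -/
theorem hasLineDerivTwo_normSq {n : ℕ} (x q e : Euc n) :
    HasLineDerivTwo (fun z => ‖z - q‖ ^ 2) x e (2 * ⟪x - q, e⟫) (2 * ‖e‖ ^ 2) := by
  refine (HasDerivTwo.quadratic (‖x - q‖ ^ 2) (2 * ⟪x - q, e⟫) (‖e‖ ^ 2)).congr ?_
  refine Eventually.of_forall fun t => ?_
  have : x + t • e - q = (x - q) + t • e := by abel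
  simp only [this, norm_add_sq_real, inner_smul_right, norm_smul, mul_pow, Real.norm_eq_abs, sq_abs]
  ring

theorem sum_inner_stdVec_sq {n : ℕ} (a : Euc n) : ∑ i, ⟪a, stdVec i⟫ ^ 2 = ‖a‖ ^ 2 := by
  have := (EuclideanSpace.basisFun (Fin n) ℝ).sum_sq_norm_inner_left a
  simpa using this

theorem norm_stdVec {n : ℕ} (i : Fin n) : ‖stdVec i‖ = 1 :=
  (EuclideanSpace.basisFun (Fin n) ℝ).orthonormal.1 i

theorem sum_fderiv_stdVec_sq {n : ℕ} (v : Euc n → ℝ) (x : Euc n) :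
    ∑ i, fderiv ℝ v x (stdVec i) ^ 2 = ‖fderiv ℝ v x‖ ^ 2 := by
  have : ‖fderiv ℝ v x‖ = ‖∇ v x‖ := by
    rw [← toDual_gradient, LinearIsometryEquiv.norm_map]
  rw [this, ← sum_inner_stdVec_sq]
  simp only [inner_gradient_left]

/-! ### Hopf's lemma and the strong maximum principle -/

/-- A nonnegative function with `Δv ≤ K (|∇v| + v)` on `U`. -/
structure IsSupersolution {n : ℕ} (U : Set (Euc n)) (K : ℝ) (v : Euc n → ℝ) : Prop where
  nonneg : ∀ x ∈ U, 0 ≤ v x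
  differentiableAt : ∀ x ∈ U, DifferentiableAt ℝ v x
  laplacian_le : ∀ x ∈ U, ∃ D : Fin n → ℝ,
    (∀ i, HasLineDerivTwo v x (stdVec i) (fderiv ℝ v x (stdVec i)) (D i)) ∧
      ∑ i, D i ≤ K * (‖fderiv ℝ v x‖ + v x)

theorem IsSupersolution.mono {n : ℕ} {U V : Set (Euc n)} {K : ℝ} {v : Euc n → ℝ}
    (h : IsSupersolution U K v) (hVU : V ⊆ U) : IsSupersolution V K v :=
  ⟨fun x hx => h.nonneg x (hVU hx), fun x hx => h.differentiableAt x (hVU hx),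
    fun x hx => h.laplacian_le x (hVU hx)⟩

theorem hasLineDerivTwo_exp {n : ℕ} (x q e : Euc n) (α m c : ℝ) (he : ‖e‖ = 1) :
    HasLineDerivTwo (fun z => m * (Real.exp (-α * ‖z - q‖ ^ 2) - c)) x e
      (m * Real.exp (-α * ‖x - q‖ ^ 2) * (-2 * α * ⟪x - q, e⟫))
      (m * Real.exp (-α * ‖x - q‖ ^ 2) * (4 * α ^ 2 * ⟪x - q, e⟫ ^ 2 - 2 * α)) := by
  have h1 := HasDerivTwo.const_mul (-α) (hasLineDerivTwo_normSq x q e)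
  have h2 := (HasDerivTwo.comp (g := Real.exp) (g' := Real.exp)
    (Eventually.of_forall fun r => Real.hasDerivAt_exp r) (Real.hasDerivAt_exp _) h1)
  have h3 := (h2.sub (HasDerivTwo.const c)).const_mul m
  have hx : x + (0 : ℝ) • e = x := by simp
  unfold HasLineDerivTwo
  simp only [hx, he] at h3
  convert h3 using 1 <;> ring

/-- A positive maximum of barrier minus `v` on the annulus lies in its interior: on the outer sphere
the barrier vanishes, and on the inner one it is below `m ≤ v`. At such a point the gradients agree
and `Δv` is at least the Laplacian of the barrier, which by `hαK` is more than `laplacian_le`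
allows. -/
theorem IsSupersolution.barrier_le {n : ℕ} {U : Set (Euc n)} {K : ℝ} {v : Euc n → ℝ}
    (h : IsSupersolution U K v) (hK : 0 ≤ K) {q : Euc n} {ρ R α m : ℝ} (hρ : 0 < ρ) (hm : 0 < m)
    (hα : 0 < α) (hαK : K * (2 * α * R + 1) < 4 * α ^ 2 * ρ ^ 2 - 2 * n * α)
    (hU : Metric.closedBall q R ⊆ U) (hv : ∀ x ∈ Metric.closedBall q ρ, m ≤ v x)
    {x : Euc n} (hx : ρ ≤ ‖x - q‖) (hxR : ‖x - q‖ ≤ R) :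
    m * (Real.exp (-α * ‖x - q‖ ^ 2) - Real.exp (-α * R ^ 2)) ≤ v x := by
  by_contra! hlt
  set c := Real.exp (-α * R ^ 2) with hc
  set A : Set (Euc n) := {z | ρ ≤ ‖z - q‖} ∩ Metric.closedBall q R with hA
  have hAc : IsCompact A := by
    refine (isCompact_closedBall q R).inter_left (isClosed_le continuous_const ?_)
    fun_prop
  have hbar : Continuous fun z : Euc n => m * (Real.exp (-α * ‖z - q‖ ^ 2) - c) := by fun_prop
  have hcont : ContinuousOn (fun z => m * (Real.exp (-α * ‖z - q‖ ^ 2) - c) - v z) A := by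
    refine hbar.continuousOn.sub fun z hz => ?_
    exact (h.differentiableAt z (hU hz.2)).continuousAt.continuousWithinAt
  have hxA : x ∈ A := ⟨hx, by simpa [dist_eq_norm] using hxR⟩
  obtain ⟨z, hzA, hz⟩ := hAc.exists_isMaxOn ⟨x, hxA⟩ hcont
  have hzpos : v z < m * (Real.exp (-α * ‖z - q‖ ^ 2) - c) := by
    have := hz hxA
    simp only [mem_ofPred_eq] at this
    linarith
  have hzU : z ∈ U := hU hzA.2
  have hzR : ‖z - q‖ ≤ R := by simpa [dist_eq_norm] using hzA.2
  have h1 : ‖z - q‖ < R := by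
    refine lt_of_le_of_ne hzR fun h0 => ?_
    rw [h0, ← hc, sub_self, mul_zero] at hzpos
    exact absurd (h.nonneg z hzU) (not_le.2 hzpos)
  have h2 : ρ < ‖z - q‖ := by
    refine lt_of_le_of_ne hzA.1 fun h0 => ?_
    have h3 := hv z (by simp [dist_eq_norm, h0])
    have h4 : Real.exp (-α * ‖z - q‖ ^ 2) ≤ 1 := Real.exp_le_one_iff.2 (by
      have : 0 ≤ α * ‖z - q‖ ^ 2 := by positivity
      linarith)
    have h5 : 0 < c := Real.exp_pos _
    nlinarith
  have hmax : IsLocalMax (fun z => m * (Real.exp (-α * ‖z - q‖ ^ 2) - c) - v z) z := by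
    have hn : Continuous fun z : Euc n => ‖z - q‖ := by fun_prop
    refine hz.isLocalMax ?_
    filter_upwards [hn.continuousAt.eventually_lt continuousAt_const h1,
      continuousAt_const.eventually_lt hn.continuousAt h2] with y hy1 hy2
    exact ⟨hy2.le, by simpa [dist_eq_norm] using hy1.le⟩
  obtain ⟨D, hD, hDs⟩ := h.laplacian_le z hzU
  set E := Real.exp (-α * ‖z - q‖ ^ 2) with hE
  have hEpos : 0 < E := Real.exp_pos _
  have key : ∀ i, fderiv ℝ v z (stdVec i) = m * E * (-2 * α * ⟪z - q, stdVec i⟫) ∧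
      m * E * (4 * α ^ 2 * ⟪z - q, stdVec i⟫ ^ 2 - 2 * α) ≤ D i := by
    intro i
    have h3 := HasDerivTwo.sub (hasLineDerivTwo_exp z q (stdVec i) α m c (norm_stdVec i)) (hD i)
    have h5 : IsLocalMax (fun t : ℝ => m * (Real.exp (-α * ‖z + t • stdVec i - q‖ ^ 2) - c) -
        v (z + t • stdVec i)) 0 := by
      have := (tendsto_line z (stdVec i)).eventually hmax
      simpa [IsLocalMax, IsMaxFilter] using this
    have h4 := HasDerivTwo.nonpos_of_isLocalMax h3 h5
    have h6 := h5.hasDerivAt_eq_zero h3.hasDerivAt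
    constructor <;> linarith
  have hgrad : ‖fderiv ℝ v z‖ = 2 * α * m * E * ‖z - q‖ := by
    have h3 := sum_fderiv_stdVec_sq v z
    simp only [(key _).1, mul_pow] at h3
    rw [← Finset.mul_sum, ← Finset.mul_sum, sum_inner_stdVec_sq] at h3
    have h4 : (2 * α * m * E * ‖z - q‖) ^ 2 = ‖fderiv ℝ v z‖ ^ 2 := by
      rw [← h3]; ring
    exact ((pow_left_inj₀ (by positivity) (norm_nonneg _) two_ne_zero).1 h4).symm
  have hsum : m * E * (4 * α ^ 2 * ‖z - q‖ ^ 2 - 2 * n * α) ≤ ∑ i, D i := by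
    have := Finset.sum_le_sum fun i (_ : i ∈ Finset.univ) => (key i).2
    refine le_trans (le_of_eq ?_) this
    rw [← Finset.mul_sum, Finset.sum_sub_distrib, ← Finset.mul_sum, sum_inner_stdVec_sq]
    simp only [Finset.sum_const, Finset.card_univ, Fintype.card_fin, nsmul_eq_mul]
    ring
  have hvE : v z ≤ m * E := by
    have : 0 < c := Real.exp_pos _
    nlinarith
  have hfin : K * (‖fderiv ℝ v z‖ + v z) ≤ m * E * (K * (2 * α * R + 1)) := by
    rw [hgrad]
    have : 2 * α * m * E * ‖z - q‖ ≤ 2 * α * m * E * R := by gcongr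
    calc K * (2 * α * m * E * ‖z - q‖ + v z) ≤ K * (2 * α * m * E * R + m * E) := by gcongr
      _ = _ := by ring
  have h7 : 4 * α ^ 2 * ρ ^ 2 ≤ 4 * α ^ 2 * ‖z - q‖ ^ 2 := by gcongr
  have h8 : m * E * (K * (2 * α * R + 1)) < m * E * (4 * α ^ 2 * ‖z - q‖ ^ 2 - 2 * n * α) := by
    gcongr
    linarith
  linarith

/-- Hopf's lemma on a ball: linear growth from the boundary. -/
theorem IsSupersolution.hopf {n : ℕ} {K : ℝ} {v : Euc n → ℝ} {q : Euc n} {R : ℝ}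
    (h : IsSupersolution (Metric.ball q R) K v) (hK : 0 ≤ K) (hR : 0 < R)
    (hpos : ∀ x ∈ Metric.ball q R, 0 < v x) :
    ∃ c > 0, ∀ x ∈ Metric.ball q R, c * (R ^ 2 - ‖x - q‖ ^ 2) ≤ v x := by
  have hsub : Metric.closedBall q (R / 2) ⊆ Metric.ball q R :=
    Metric.closedBall_subset_ball (by linarith)
  obtain ⟨z, hz, hzm⟩ := (isCompact_closedBall q (R / 2)).exists_isMinOn
    ⟨q, Metric.mem_closedBall_self (half_pos hR).le⟩ (fun x hx =>
      (h.differentiableAt x (hsub hx)).continuousAt.continuousWithinAt : ContinuousOn v _)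
  set m := v z
  have hm : 0 < m := hpos z (hsub hz)
  -- The quotient makes `4α²(R/2)² = α · αR²` dominate the terms of `hαK` that are linear in `α`;
  -- the extra `1` gives `α ≥ 1`, which absorbs the constant `K`.
  set α : ℝ := (2 * n + 2 * K * R + K + 1) / R ^ 2 + 1 with hαd
  have hα1 : 1 ≤ α := by
    have : 0 ≤ (2 * n + 2 * K * R + K + 1) / R ^ 2 := by positivity
    linarith
  have hαR : α * R ^ 2 = 2 * n + 2 * K * R + K + 1 + R ^ 2 := by
    rw [hαd]; field_simp
  have hαK : K * (2 * α * R + 1) < 4 * α ^ 2 * (R / 2) ^ 2 - 2 * n * α := by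
    have h1 : 4 * α ^ 2 * (R / 2) ^ 2 = α * (α * R ^ 2) := by ring
    rw [h1, hαR]
    nlinarith [mul_nonneg (sub_nonneg.2 hα1) hK, mul_nonneg (sub_nonneg.2 hα1) (sq_nonneg R),
      sq_nonneg R]
  have key : ∀ x, R / 2 ≤ ‖x - q‖ → ‖x - q‖ < R →
      m * (Real.exp (-α * ‖x - q‖ ^ 2) - Real.exp (-α * R ^ 2)) ≤ v x := by
    intro x hx hxR
    -- Nothing is known on the sphere itself, so the barrier is used on balls of radius `r < R` and
    -- `r` tends to `R`.
    have hlim : Tendsto (fun r : ℝ => m * (Real.exp (-α * ‖x - q‖ ^ 2) - Real.exp (-α * r ^ 2)))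
        (𝓝[<] R) (𝓝 (m * (Real.exp (-α * ‖x - q‖ ^ 2) - Real.exp (-α * R ^ 2)))) := by
      have : Continuous fun r : ℝ =>
        m * (Real.exp (-α * ‖x - q‖ ^ 2) - Real.exp (-α * r ^ 2)) := by fun_prop
      exact (this.tendsto R).mono_left nhdsWithin_le_nhds
    refine le_of_tendsto hlim ?_
    filter_upwards [Ioo_mem_nhdsLT hxR] with r hr
    refine h.barrier_le hK (half_pos hR) hm (by linarith) ?_
      (Metric.closedBall_subset_ball hr.2) (fun y hy => hzm hy) hx hr.1.le
    refine lt_of_le_of_lt ?_ hαK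
    have := hr.2.le
    gcongr
  -- The first constant serves the inner half ball, where `v ≥ m`; the second serves the annulus,
  -- through `exp t ≥ 1 + t`.
  refine ⟨min (m / R ^ 2) (m * Real.exp (-α * R ^ 2) * α), by positivity, fun x hx => ?_⟩
  have hxR : ‖x - q‖ < R := by simpa [dist_eq_norm] using hx
  have h0 : 0 ≤ R ^ 2 - ‖x - q‖ ^ 2 := by nlinarith [norm_nonneg (x - q)]
  rcases le_total (R / 2) ‖x - q‖ with h1 | h1
  · refine le_trans ?_ (key x h1 hxR)
    refine le_trans (mul_le_mul_of_nonneg_right (min_le_right _ _) h0) ?_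
    have h2 : Real.exp (-α * ‖x - q‖ ^ 2) =
        Real.exp (-α * R ^ 2) * Real.exp (α * (R ^ 2 - ‖x - q‖ ^ 2)) := by
      rw [← Real.exp_add]; congr 1; ring
    have h3 := Real.add_one_le_exp (α * (R ^ 2 - ‖x - q‖ ^ 2))
    have h4 := mul_le_mul_of_nonneg_left h3
      (mul_nonneg hm.le (Real.exp_pos (-α * R ^ 2)).le)
    rw [h2]
    linarith
  · refine le_trans (mul_le_mul_of_nonneg_right (min_le_left _ _) h0) ?_
    have h2 : m ≤ v x := hzm (by simpa [dist_eq_norm] using h1)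
    refine le_trans ?_ h2
    rw [div_mul_eq_mul_div, div_le_iff₀ (by positivity)]
    have : 0 ≤ ‖x - q‖ ^ 2 := by positivity
    nlinarith

/-- A function with vanishing derivative cannot grow linearly. -/
theorem not_linear_growth {y : ℝ → ℝ} {k δ : ℝ} (hy : HasDerivAt y 0 0) (hy0 : y 0 = 0)
    (hk : 0 < k) (hδ : 0 < δ) : ¬ ∀ t ∈ Ioo 0 δ, k * t ≤ y t := by
  intro h
  have h1 := hy.isLittleO
  have h2 := h1.def (half_pos hk)
  have h3 : ∀ᶠ t in 𝓝[>] (0 : ℝ), False := by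
    filter_upwards [nhdsWithin_le_nhds h2, Ioo_mem_nhdsGT hδ] with t ht1 ht2
    have := h t ht2
    simp only [hy0, sub_zero, smul_zero, Real.norm_eq_abs, abs_of_pos ht2.1] at ht1
    have h4 := le_abs_self (y t)
    have h5 := mul_pos hk ht2.1
    linarith
  exact h3.exists.elim fun _ h => h

/-- Strong maximum principle near an interior zero. -/
theorem IsSupersolution.eq_zero_of_eq_zero {n : ℕ} {K : ℝ} {v : Euc n → ℝ} {x₀ : Euc n} {R : ℝ}
    (h : IsSupersolution (Metric.ball x₀ R) K v) (hK : 0 ≤ K) (h0 : v x₀ = 0) :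
    ∀ x ∈ Metric.ball x₀ (R / 2), v x = 0 := by
  intro x₁ hx₁
  have hx₁' : dist x₁ x₀ < R / 2 := hx₁
  have hR : 0 < R := by linarith [dist_nonneg (x := x₁) (y := x₀)]
  have hsub : Metric.closedBall x₁ (dist x₁ x₀) ⊆ Metric.ball x₀ R := by
    intro z hz
    have := dist_triangle z x₁ x₀
    have hz' : dist z x₁ ≤ dist x₁ x₀ := hz
    simp only [Metric.mem_ball]
    linarith
  by_contra hne
  have hcont : ContinuousOn v (Metric.closedBall x₁ (dist x₁ x₀)) := fun z hz =>
    (h.differentiableAt z (hsub hz)).continuousAt.continuousWithinAt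
  have hZ : IsCompact (Metric.closedBall x₁ (dist x₁ x₀) ∩ v ⁻¹' {0}) :=
    (isCompact_closedBall _ _).of_isClosed_subset
      (hcont.preimage_isClosed_of_isClosed Metric.isClosed_closedBall isClosed_singleton)
      inter_subset_left
  -- For a zero `z` nearest to `x₁`, the ball about `x₁` through `z` contains no zero. Hopf's lemma
  -- makes `v` grow linearly from `z` towards `x₁`, while `z` is an interior minimum with vanishing
  -- gradient.
  obtain ⟨z, hz, hzm⟩ := hZ.exists_isMinOn ⟨x₀, by simp [dist_comm], h0⟩
    (f := fun z => dist z x₁) (by fun_prop)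
  have hz1 : dist z x₁ ≤ dist x₁ x₀ := hz.1
  have hz0 : v z = 0 := hz.2
  set ρ := dist z x₁ with hρ
  have hρpos : 0 < ρ := dist_pos.2 (by rintro rfl; exact hne hz0)
  have hball : Metric.ball x₁ ρ ⊆ Metric.ball x₀ R := fun w hw =>
    hsub (le_trans (le_of_lt hw) hz1)
  have hpos : ∀ w ∈ Metric.ball x₁ ρ, 0 < v w := by
    intro w hw
    refine lt_of_le_of_ne (h.nonneg w (hball hw)) fun hw0 => ?_
    have : ρ ≤ dist w x₁ := hzm ⟨le_trans (le_of_lt hw) hz1, hw0.symm⟩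
    exact absurd hw (not_lt.2 this)
  obtain ⟨c, hc, hcv⟩ := (h.mono hball).hopf hK hρpos hpos
  have hzU : z ∈ Metric.ball x₀ R := hsub hz.1
  have hd := h.differentiableAt z hzU
  have hmin : IsLocalMin v z := by
    filter_upwards [Metric.isOpen_ball.mem_nhds hzU] with w hw
    rw [hz0]; exact h.nonneg w hw
  have hline : HasDerivAt (fun t : ℝ => v (z + t • (x₁ - z))) 0 0 := by
    have hx : z + (0 : ℝ) • (x₁ - z) = z := by simp
    have := hasDerivAt_line (v := v) (x := z) (e := x₁ - z) (t := 0) (by rw [hx]; exact hd)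
    rwa [hx, hmin.fderiv_eq_zero, zero_apply] at this
  refine not_linear_growth hline (by simpa using hz0) (k := c * ρ ^ 2) (δ := 1) (by positivity)
    one_pos fun t ht => ?_
  have hnorm : ‖z + t • (x₁ - z) - x₁‖ = (1 - t) * ρ := by
    have h1 : z + t • (x₁ - z) - x₁ = (1 - t) • (z - x₁) := by
      rw [sub_smul, one_smul, smul_sub, smul_sub]; abel
    rw [h1, norm_smul, hρ, dist_eq_norm, Real.norm_eq_abs, abs_of_pos (by linarith [ht.2])]
  have h2 := hcv (z + t • (x₁ - z)) (by
    rw [Metric.mem_ball, dist_eq_norm, hnorm]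
    nlinarith [ht.1])
  rw [hnorm] at h2
  refine le_trans ?_ h2
  have h3 : 0 ≤ t * (1 - t) := mul_nonneg ht.1.le (by linarith [ht.2])
  have h4 : 0 ≤ c * ρ ^ 2 * (t * (1 - t)) := by positivity
  nlinarith

/-- The points near which `v` vanishes identically form an open set, relatively closed in the ball
by `eq_zero_of_eq_zero`. As the ball is connected, a single zero makes `v` vanish throughout;
without zeros Hopf's lemma applies. -/
theorem IsSupersolution.eq_zero_or_hopf {n : ℕ} {K : ℝ} {v : Euc n → ℝ} {q : Euc n} {R : ℝ}
    (h : IsSupersolution (Metric.ball q R) K v) (hK : 0 ≤ K) (hR : 0 < R) :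
    (∀ x ∈ Metric.ball q R, v x = 0) ∨
    ∃ c > 0, ∀ x ∈ Metric.ball q R, c * (R ^ 2 - ‖x - q‖ ^ 2) ≤ v x := by
  by_cases hpos : ∀ x ∈ Metric.ball q R, 0 < v x
  · exact Or.inr (h.hopf hK hR hpos)
  left
  push Not at hpos
  obtain ⟨x₀, hx₀, hv₀⟩ := hpos
  have near : ∀ x ∈ Metric.ball q R, v x = 0 → ∀ᶠ y in 𝓝 x, v y = 0 := by
    intro x hx hvx
    obtain ⟨r, hr, hrU⟩ := Metric.isOpen_ball.mem_nhds hx |> Metric.mem_nhds_iff.1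
    filter_upwards [Metric.ball_mem_nhds x (half_pos hr)] with y hy
    exact (h.mono hrU).eq_zero_of_eq_zero hK hvx y hy
  have hsub : Metric.ball q R ⊆ {x | ∀ᶠ y in 𝓝 x, v y = 0} := by
    refine ((convex_ball q R).isPreconnected).subset_of_closure_inter_subset
      isOpen_setOfPred_eventually_nhds
      ⟨x₀, hx₀, near x₀ hx₀ (le_antisymm hv₀ (h.nonneg x₀ hx₀))⟩ ?_
    rintro x ⟨hxc, hx⟩
    refine near x hx ?_
    have hcl : closure {x | ∀ᶠ y in 𝓝 x, v y = 0} ⊆ closure (v ⁻¹' {0}) :=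
      closure_mono fun y hy => hy.self_of_nhds
    have h1 := mem_closure_iff_nhdsWithin_neBot.1 (hcl hxc)
    have h2 : Tendsto v (𝓝[v ⁻¹' {0}] x) (𝓝 (v x)) :=
      (h.differentiableAt x hx).continuousAt.continuousWithinAt
    have h3 : Tendsto v (𝓝[v ⁻¹' {0}] x) (𝓝 0) :=
      tendsto_const_nhds.congr' (by
        filter_upwards [self_mem_nhdsWithin] with y hy using hy.symm)
    exact tendsto_nhds_unique h2 h3
  exact fun x hx => (hsub hx).self_of_nhds

/-! ### Derivatives of the `P`-function -/

section PFunctionCalculus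

variable {n : ℕ} {u : Euc n → ℝ} {x : Euc n}

theorem ContDiffAt.fderiv_fderiv_three (hu : ContDiffAt ℝ 3 u x) :
    ContDiffAt ℝ 1 (fderiv ℝ (fderiv ℝ u)) x :=
  (hu.fderiv_right (m := 2) (by norm_num)).fderiv_right (m := 1) (by norm_num)

theorem fderiv_fderiv_symm (hu : ContDiffAt ℝ 2 u x) (a b : Euc n) :
    fderiv ℝ (fderiv ℝ u) x a b = fderiv ℝ (fderiv ℝ u) x b a :=
  (hu.isSymmSndFDerivAt (by simp)) a b

theorem hasFDerivAt_fderiv_apply (hu : ContDiffAt ℝ 2 u x) (e : Euc n) :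
    HasFDerivAt (fun z => fderiv ℝ u z e) ((fderiv ℝ (fderiv ℝ u) x).flip e) x := by
  have h1 : DifferentiableAt ℝ (fderiv ℝ u) x :=
    (hu.fderiv_right (m := 1) (by norm_num)).differentiableAt (by norm_num)
  have h3 := h1.hasFDerivAt.clm_apply (hasFDerivAt_const e x)
  refine h3.congr_fderiv ?_
  ext w
  simp

theorem hasFDerivAt_fderiv_fderiv_apply (hu : ContDiffAt ℝ 3 u x) (a b : Euc n) :
    HasFDerivAt (fun z => fderiv ℝ (fderiv ℝ u) z a b)
      (((fderiv ℝ (fderiv ℝ (fderiv ℝ u)) x).flip a).flip b) x := by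
  have h1 : DifferentiableAt ℝ (fderiv ℝ (fderiv ℝ u)) x :=
    hu.fderiv_fderiv_three.differentiableAt (by norm_num)
  have h3 := (h1.hasFDerivAt.clm_apply (hasFDerivAt_const a x)).clm_apply (hasFDerivAt_const b x)
  refine h3.congr_fderiv ?_
  ext w
  simp

/-- Exchanging the first two slots is the symmetry of the second derivative of `fderiv ℝ u`;
exchanging the last two follows by differentiating the symmetry of the Hessian. Three such exchanges
give the permutation. -/
theorem third_deriv_symm (hu : ContDiffAt ℝ 3 u x) (a b c : Euc n) :
    fderiv ℝ (fderiv ℝ (fderiv ℝ u)) x a b c = fderiv ℝ (fderiv ℝ (fderiv ℝ u)) x c b a := by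
  have h1 : ∀ a b c, fderiv ℝ (fderiv ℝ (fderiv ℝ u)) x a b c =
      fderiv ℝ (fderiv ℝ (fderiv ℝ u)) x b a c := by
    intro a b c
    have h2 : ContDiffAt ℝ 2 (fderiv ℝ u) x := hu.fderiv_right (m := 2) (by norm_num)
    exact congrArg (fun T => T c) ((h2.isSymmSndFDerivAt (by simp)) a b)
  have h2 : ∀ a b c, fderiv ℝ (fderiv ℝ (fderiv ℝ u)) x a b c =
      fderiv ℝ (fderiv ℝ (fderiv ℝ u)) x a c b := by
    intro a b c
    have hev : (fun z => fderiv ℝ (fderiv ℝ u) z b c) =ᶠ[𝓝 x]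
        fun z => fderiv ℝ (fderiv ℝ u) z c b := by
      filter_upwards [hu.eventually (by simp)] with z hz
      exact fderiv_fderiv_symm (hz.of_le (by norm_num)) b c
    have h3 := ((hasFDerivAt_fderiv_fderiv_apply hu b c).congr_of_eventuallyEq hev.symm).unique
      (hasFDerivAt_fderiv_fderiv_apply hu c b)
    exact congrArg (fun T => T a) h3
  rw [h1 a b c, h2 b a c, h1 b c a]

theorem norm_gradient_sq (v : Euc n → ℝ) (x : Euc n) :
    ‖∇ v x‖ ^ 2 = ∑ i, fderiv ℝ v x (stdVec i) ^ 2 := by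
  rw [sum_fderiv_stdVec_sq, ← toDual_gradient, LinearIsometryEquiv.norm_map]

theorem hasFDerivAt_laplacian (hu : ContDiffAt ℝ 3 u x) :
    HasFDerivAt (Laplacian.laplacian u)
      (∑ i, ((fderiv ℝ (fderiv ℝ (fderiv ℝ u)) x).flip (stdVec i)).flip (stdVec i)) x := by
  have h : Laplacian.laplacian u =
      fun z => ∑ i, fderiv ℝ (fderiv ℝ u) z (stdVec i) (stdVec i) :=
    funext fun z => laplacian_eq_sum u z (EuclideanSpace.basisFun (Fin n) ℝ)
  rw [h]
  exact HasFDerivAt.fun_sum fun i _ => hasFDerivAt_fderiv_fderiv_apply hu _ _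

variable {f F : ℝ → ℝ}

theorem hasFDerivAt_PFunction (hu : ContDiffAt ℝ 2 u x) (hF : ∀ t, HasDerivAt F (f t) t) :
    HasFDerivAt (PFunction F u)
      (∑ j, (2 * fderiv ℝ u x (stdVec j)) • (fderiv ℝ (fderiv ℝ u) x).flip (stdVec j) +
        (2 * f (u x)) • fderiv ℝ u x) x := by
  have h1 : HasFDerivAt (fun z => ∑ j, fderiv ℝ u z (stdVec j) ^ 2)
      (∑ j, (2 * fderiv ℝ u x (stdVec j)) • (fderiv ℝ (fderiv ℝ u) x).flip (stdVec j)) x := by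
    refine HasFDerivAt.fun_sum fun j _ => ?_
    have := (hasFDerivAt_fderiv_apply hu (stdVec j)).pow 2
    refine this.congr_fderiv ?_
    simp
  have h2 : HasFDerivAt (fun z => 2 * F (u z)) ((2 * f (u x)) • fderiv ℝ u x) x := by
    have hd : HasFDerivAt u (fderiv ℝ u x) x := (hu.differentiableAt (by norm_num)).hasFDerivAt
    have := ((hF (u x)).comp_hasFDerivAt x hd).const_mul 2
    refine this.congr_fderiv ?_
    rw [smul_smul]
  refine (h1.add h2).congr_of_eventuallyEq (Eventually.of_forall fun z => ?_)
  simp only [PFunction, norm_gradient_sq, Pi.add_apply]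

/-- Writing `-Δu` for `f (u x)` leaves only derivatives of `u`, an expression that can be
differentiated once more. -/
theorem fderiv_PFunction_apply (hu : ContDiffAt ℝ 2 u x) (hF : ∀ t, HasDerivAt F (f t) t)
    (heq : Laplacian.laplacian u x + f (u x) = 0) (e : Euc n) :
    fderiv ℝ (PFunction F u) x e =
      ∑ j, 2 * fderiv ℝ u x (stdVec j) * fderiv ℝ (fderiv ℝ u) x e (stdVec j) -
        2 * (Laplacian.laplacian u x * fderiv ℝ u x e) := by
  rw [(hasFDerivAt_PFunction hu hF).fderiv]
  have : f (u x) = -Laplacian.laplacian u x := by linarith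
  simp [this]
  ring

/-- Second derivatives of the `P`-function in the coordinate directions. No derivative of `f`
appears, as `f ∘ u = -Δu` is continuously differentiable. -/
theorem hasLineDerivTwo_PFunction (hu : ContDiffAt ℝ 3 u x) (hF : ∀ t, HasDerivAt F (f t) t)
    (heq : ∀ᶠ z in 𝓝 x, Laplacian.laplacian u z + f (u z) = 0) (e : Euc n) :
    HasLineDerivTwo (PFunction F u) x e (fderiv ℝ (PFunction F u) x e)
      (∑ j, 2 * (fderiv ℝ (fderiv ℝ u) x e (stdVec j) ^ 2 +
          fderiv ℝ u x (stdVec j) * fderiv ℝ (fderiv ℝ (fderiv ℝ u)) x e e (stdVec j)) -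
        2 * (fderiv ℝ (Laplacian.laplacian u) x e * fderiv ℝ u x e +
          Laplacian.laplacian u x * fderiv ℝ (fderiv ℝ u) x e e)) := by
  have hu2 : ContDiffAt ℝ 2 u x := hu.of_le (by norm_num)
  have h1 : HasFDerivAt (fun z =>
      ∑ j, 2 * fderiv ℝ u z (stdVec j) * fderiv ℝ (fderiv ℝ u) z e (stdVec j) -
        2 * (Laplacian.laplacian u z * fderiv ℝ u z e)) _ x :=
    (HasFDerivAt.fun_sum (u := Finset.univ) fun j _ =>
      ((hasFDerivAt_fderiv_apply hu2 (stdVec j)).const_mul 2).mul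
        (hasFDerivAt_fderiv_fderiv_apply hu e (stdVec j))).sub
      (((hasFDerivAt_laplacian hu).mul (hasFDerivAt_fderiv_apply hu2 e)).const_mul 2)
  have hev := hu.eventually (by simp)
  have h2 := hasLineDerivTwo_of_fderiv (v := PFunction F u) (x := x) (e := e) (by
    filter_upwards [hev] with z hz
    exact (hasFDerivAt_PFunction (hz.of_le (by norm_num)) hF).differentiableAt) (by
    filter_upwards [hev, heq] with z hz hz'
    exact fderiv_PFunction_apply (hz.of_le (by norm_num)) hF hz' e) h1.differentiableAt
  rw [h1.fderiv] at h2
  rw [fderiv_PFunction_apply hu2 hF heq.self_of_nhds, (hasFDerivAt_laplacian hu).fderiv]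
  convert h2 using 1
  simp only [sub_apply, sum_apply, add_apply, smul_apply, smul_eq_mul,
    ContinuousLinearMap.flip_apply]
  congr 1
  · exact Finset.sum_congr rfl fun j _ => by ring
  · ring

/-- The Laplacian commutes with partial derivatives. In `ΔP` this makes the third order terms cancel
against those coming from the derivative of `f ∘ u = -Δu`. -/
theorem sum_third_deriv (hu : ContDiffAt ℝ 3 u x) (j : Fin n) :
    ∑ i, fderiv ℝ (fderiv ℝ (fderiv ℝ u)) x (stdVec i) (stdVec i) (stdVec j) =
      fderiv ℝ (Laplacian.laplacian u) x (stdVec j) := by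
  rw [(hasFDerivAt_laplacian hu).fderiv]
  simp only [sum_apply, ContinuousLinearMap.flip_apply]
  exact Finset.sum_congr rfl fun i _ => third_deriv_symm hu _ _ _

/-- `ΔP = 2 |D²u|² - 2 (Δu)²`. -/
theorem exists_laplacian_PFunction (hu : ContDiffAt ℝ 3 u x) (hF : ∀ t, HasDerivAt F (f t) t)
    (heq : ∀ᶠ z in 𝓝 x, Laplacian.laplacian u z + f (u z) = 0) :
    ∃ D : Fin n → ℝ, (∀ i, HasLineDerivTwo (PFunction F u) x (stdVec i)
        (fderiv ℝ (PFunction F u) x (stdVec i)) (D i)) ∧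
      ∑ i, D i = 2 * ∑ i, ∑ j, fderiv ℝ (fderiv ℝ u) x (stdVec i) (stdVec j) ^ 2 -
        2 * Laplacian.laplacian u x ^ 2 := by
  refine ⟨_, fun i => hasLineDerivTwo_PFunction hu hF heq (stdVec i), ?_⟩
  have h1 : ∑ i, ∑ j, 2 * (fderiv ℝ u x (stdVec j) *
      fderiv ℝ (fderiv ℝ (fderiv ℝ u)) x (stdVec i) (stdVec i) (stdVec j)) =
      ∑ j, 2 * (fderiv ℝ (Laplacian.laplacian u) x (stdVec j) * fderiv ℝ u x (stdVec j)) := by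
    rw [Finset.sum_comm]
    refine Finset.sum_congr rfl fun j _ => ?_
    rw [← Finset.mul_sum, ← Finset.mul_sum, sum_third_deriv hu]
    ring
  have h2 : ∑ i, 2 * (Laplacian.laplacian u x *
      fderiv ℝ (fderiv ℝ u) x (stdVec i) (stdVec i)) = 2 * Laplacian.laplacian u x ^ 2 := by
    rw [← Finset.mul_sum, ← Finset.mul_sum,
      ← laplacian_eq_sum u x (EuclideanSpace.basisFun (Fin n) ℝ)]
    ring
  simp only [mul_add, Finset.sum_add_distrib, Finset.sum_sub_distrib]
  rw [h1, h2]
  simp only [Finset.mul_sum]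
  ring

/-- `P₀ - P` is a supersolution where the gradient is bounded below. -/
theorem isSupersolution_PFunction {U : Set (Euc n)} (hU : IsOpen U) (hu : ContDiffOn ℝ 3 u U)
    (hF : ∀ t, HasDerivAt F (f t) t) (heq : ∀ z ∈ U, Laplacian.laplacian u z + f (u z) = 0)
    {P₀ A δ : ℝ} (hP : ∀ z ∈ U, PFunction F u z ≤ P₀) (hA : 0 ≤ A) (hδ : 0 < δ)
    (hf : ∀ z ∈ U, |f (u z)| ≤ A) (hgrad : ∀ z ∈ U, δ ≤ ‖∇ u z‖) :
    IsSupersolution U (2 * A / δ) (fun z => P₀ - PFunction F u z) := by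
  have hat : ∀ z ∈ U, ContDiffAt ℝ 3 u z := fun z hz => hu.contDiffAt (hU.mem_nhds hz)
  have hP' : ∀ z ∈ U, DifferentiableAt ℝ (PFunction F u) z := fun z hz =>
    (hasFDerivAt_PFunction ((hat z hz).of_le (by norm_num)) hF).differentiableAt
  refine ⟨fun z hz => sub_nonneg.2 (hP z hz), fun z hz => (hP' z hz).const_sub P₀, ?_⟩
  intro z hz
  have heq' : ∀ᶠ w in 𝓝 z, Laplacian.laplacian u w + f (u w) = 0 := by
    filter_upwards [hU.mem_nhds hz] with w hw using heq w hw
  obtain ⟨D, hD, hDs⟩ := exists_laplacian_PFunction (hat z hz) hF heq'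
  have hu2 : ContDiffAt ℝ 2 u z := (hat z hz).of_le (by norm_num)
  have hfd : fderiv ℝ (fun z => P₀ - PFunction F u z) z = -fderiv ℝ (PFunction F u) z := by
    rw [fderiv_const_sub]
  refine ⟨fun i => -D i, fun i => ?_, ?_⟩
  · have := (HasDerivTwo.const P₀).sub (hD i)
    rw [hfd]
    simpa only [HasLineDerivTwo, zero_sub, neg_apply] using this
  rw [Finset.sum_neg_distrib, hDs, hfd, norm_neg]
  set S := Laplacian.laplacian u z
  set H : Fin n → Fin n → ℝ := fun i j => fderiv ℝ (fderiv ℝ u) z (stdVec i) (stdVec j)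
  set X : Fin n → ℝ := fun i => fderiv ℝ u z (stdVec i)
  set p : Fin n → ℝ := fun i => fderiv ℝ (PFunction F u) z (stdVec i)
  set G := ‖∇ u z‖
  have hG : ∑ i, X i ^ 2 = G ^ 2 := (norm_gradient_sq u z).symm
  have hpn : ∑ i, p i ^ 2 = ‖fderiv ℝ (PFunction F u) z‖ ^ 2 := sum_fderiv_stdVec_sq _ _
  have hGpos : 0 < G := hδ.trans_le (hgrad z hz)
  have hpi : ∀ i, ∑ j, X j * H i j = p i / 2 + S * X i := by
    intro i
    have h1 : p i = ∑ j, 2 * X j * H i j - 2 * (S * X i) :=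
      fderiv_PFunction_apply hu2 hF (heq z hz) (stdVec i)
    rw [h1]
    simp only [mul_assoc, ← Finset.mul_sum]
    ring
  -- Cauchy–Schwarz in each row gives `|D²u ∇u|² ≤ |∇u|² |D²u|²`, and by `hpi` the vector `D²u ∇u`
  -- is `∇P/2 + Δu ∇u`.
  have hcs : ∑ i, (p i / 2 + S * X i) ^ 2 ≤ G ^ 2 * ∑ i, ∑ j, H i j ^ 2 := by
    rw [Finset.mul_sum]
    refine Finset.sum_le_sum fun i _ => ?_
    rw [← hpi i, ← hG]
    exact Finset.sum_mul_sq_le_sq_mul_sq _ _ _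
  have hexp : ∑ i, (p i / 2 + S * X i) ^ 2 =
      ‖fderiv ℝ (PFunction F u) z‖ ^ 2 / 4 + S * ∑ i, p i * X i + S ^ 2 * G ^ 2 := by
    rw [← hpn, ← hG, Finset.sum_div, Finset.mul_sum, Finset.mul_sum, ← Finset.sum_add_distrib,
      ← Finset.sum_add_distrib]
    exact Finset.sum_congr rfl fun i _ => by ring
  have hpX : |∑ i, p i * X i| ≤ ‖fderiv ℝ (PFunction F u) z‖ * G := by
    refine abs_le_of_sq_le_sq ?_ (by positivity)
    rw [mul_pow, ← hpn, ← hG]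
    exact Finset.sum_mul_sq_le_sq_mul_sq _ _ _
  have hS : |S| ≤ A := by
    have : S = -f (u z) := by linarith [heq z hz]
    rw [this, abs_neg]
    exact hf z hz
  have hSp : -(A * (‖fderiv ℝ (PFunction F u) z‖ * G)) ≤ S * ∑ i, p i * X i := by
    refine (abs_le.1 ?_).1
    rw [abs_mul]
    gcongr
  -- The terms `S² G²` cancel and the nonnegative `|∇P|²/4` is dropped; what remains is linear in
  -- `|∇P|`.
  have hmain : G ^ 2 * -(2 * ∑ i, ∑ j, H i j ^ 2 - 2 * S ^ 2) ≤
      2 * (A * (‖fderiv ℝ (PFunction F u) z‖ * G)) := by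
    nlinarith [sq_nonneg ‖fderiv ℝ (PFunction F u) z‖]
  have hv : 0 ≤ P₀ - PFunction F u z := sub_nonneg.2 (hP z hz)
  have h5 : -(2 * ∑ i, ∑ j, H i j ^ 2 - 2 * S ^ 2) ≤
      2 * A / G * ‖fderiv ℝ (PFunction F u) z‖ := by
    rw [div_mul_eq_mul_div, le_div_iff₀ hGpos]
    have : (-(2 * ∑ i, ∑ j, H i j ^ 2 - 2 * S ^ 2) * G) * G ≤
        (2 * A * ‖fderiv ℝ (PFunction F u) z‖) * G := by linarith
    exact le_of_mul_le_mul_right this hGpos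
  refine h5.trans ?_
  have h6 : 2 * A / G ≤ 2 * A / δ := by
    have := hgrad z hz
    gcongr
  have h7 : 0 ≤ 2 * A / δ := by positivity
  calc 2 * A / G * ‖fderiv ℝ (PFunction F u) z‖
      ≤ 2 * A / δ * ‖fderiv ℝ (PFunction F u) z‖ := by gcongr
    _ ≤ _ := by gcongr; linarith

/-- If `P` is constant, the Hessian of `u` is `Δu` times the projection on the gradient. -/
theorem hessian_of_PFunction_eq (hu : ContDiffAt ℝ 3 u x) (hF : ∀ t, HasDerivAt F (f t) t)
    (heq : ∀ᶠ z in 𝓝 x, Laplacian.laplacian u z + f (u z) = 0) {P₀ : ℝ}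
    (hP : ∀ᶠ z in 𝓝 x, PFunction F u z = P₀) (hne : ∇ u x ≠ 0) (i j : Fin n) :
    fderiv ℝ (fderiv ℝ u) x (stdVec i) (stdVec j) * ‖∇ u x‖ ^ 2 =
      Laplacian.laplacian u x * fderiv ℝ u x (stdVec i) * fderiv ℝ u x (stdVec j) := by
  have hu2 : ContDiffAt ℝ 2 u x := hu.of_le (by norm_num)
  have hfd : fderiv ℝ (PFunction F u) x = 0 := by
    rw [Filter.EventuallyEq.fderiv_eq (f := fun _ => P₀) hP]
    simp
  obtain ⟨D, hD, hDs⟩ := exists_laplacian_PFunction hu hF heq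
  have hD0 : ∀ i, D i = 0 := fun i =>
    HasDerivTwo.unique (hD i) ((HasDerivTwo.const P₀).congr ((tendsto_line x _).eventually hP))
  set S := Laplacian.laplacian u x
  set H : Fin n → Fin n → ℝ := fun i j => fderiv ℝ (fderiv ℝ u) x (stdVec i) (stdVec j)
  set X : Fin n → ℝ := fun i => fderiv ℝ u x (stdVec i)
  set G := ‖∇ u x‖
  have hG : ∑ i, X i ^ 2 = G ^ 2 := (norm_gradient_sq u x).symm
  have hGpos : 0 < G := norm_pos_iff.2 hne
  have hHH : ∑ i, ∑ j, H i j ^ 2 = S ^ 2 := by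
    simp only [hD0, Finset.sum_const_zero] at hDs
    linarith
  have hHX : ∀ i, ∑ j, X j * H i j = S * X i := by
    intro i
    have h1 := fderiv_PFunction_apply hu2 hF heq.self_of_nhds (stdVec i)
    rw [hfd] at h1
    have h2 : (0 : ℝ) = ∑ j, 2 * X j * H i j - 2 * (S * X i) := h1
    simp only [mul_assoc, ← Finset.mul_sum] at h2
    linarith
  -- This is the equality case of the Cauchy–Schwarz estimate: with `|H|² = S²` and `HX = SX` the
  -- square expands to `G⁴S² - 2G⁴S² + G⁴S²`.
  have hz : ∑ i, ∑ j, (H i j * G ^ 2 - S * X i * X j) ^ 2 = 0 := by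
    have h1 : ∀ i, ∑ j, (H i j * G ^ 2 - S * X i * X j) ^ 2 =
        G ^ 4 * (∑ j, H i j ^ 2) - S ^ 2 * G ^ 2 * X i ^ 2 := by
      intro i
      have h2 : ∀ j, (H i j * G ^ 2 - S * X i * X j) ^ 2 = G ^ 4 * H i j ^ 2 -
          (2 * G ^ 2 * S * X i) * (X j * H i j) + S ^ 2 * X i ^ 2 * X j ^ 2 := fun j => by ring
      simp only [h2, Finset.sum_add_distrib, Finset.sum_sub_distrib, ← Finset.mul_sum]
      rw [hHX, hG]
      ring
    simp only [h1, Finset.sum_sub_distrib, ← Finset.mul_sum]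
    rw [hHH, hG]
    ring
  rw [Finset.sum_eq_zero_iff_of_nonneg fun i _ => Finset.sum_nonneg fun j _ => sq_nonneg _] at hz
  have h3 := hz i (Finset.mem_univ i)
  rw [Finset.sum_eq_zero_iff_of_nonneg fun j _ => sq_nonneg _] at h3
  have h4 := h3 j (Finset.mem_univ j)
  exact sub_eq_zero.1 (pow_eq_zero_iff two_ne_zero |>.1 h4)

end PFunctionCalculus

/-! ### The one-dimensional profile -/

/-- The time the one-dimensional profile with `g' = √(P₀ - 2 F(g))`, `g 0 = 0` needs to reach the
height `s`. -/
noncomputable def profileTime (F : ℝ → ℝ) (P₀ s : ℝ) : ℝ :=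
  ∫ r in (0 : ℝ)..s, (√(P₀ - 2 * F r))⁻¹

section Profile

variable {f F : ℝ → ℝ} {P₀ M : ℝ}

theorem profileTime_zero : profileTime F P₀ 0 = 0 := by simp [profileTime]

theorem hasDerivAt_gap (hF : ∀ t, HasDerivAt F (f t) t) (s : ℝ) :
    HasDerivAt (fun s => P₀ - 2 * F s) (-2 * f s) s := by
  refine (((hF s).const_mul 2).const_sub P₀).congr_deriv ?_
  ring

theorem continuous_gap (hF : ∀ t, HasDerivAt F (f t) t) : Continuous fun s => P₀ - 2 * F s :=
  continuous_iff_continuousAt.2 fun s => (hasDerivAt_gap hF s).continuousAt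

/-- The derivative is two-sided even at `s = 0`, because the integrand is continuous at `s`. The
boundary arguments use it at `s = 0`. -/
theorem hasDerivAt_profileTime (hF : ∀ t, HasDerivAt F (f t) t) {s : ℝ} (hs : 0 ≤ s)
    (hpos : ∀ r ∈ Icc 0 s, 0 < P₀ - 2 * F r) :
    HasDerivAt (profileTime F P₀) (√(P₀ - 2 * F s))⁻¹ s := by
  have hc : ∀ r ∈ Icc 0 s, ContinuousAt (fun r => (√(P₀ - 2 * F r))⁻¹) r := fun r hr =>
    ((continuous_gap hF).continuousAt.sqrt).inv₀ (Real.sqrt_pos.2 (hpos r hr)).ne'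
  refine intervalIntegral.integral_hasDerivAt_right ?_ ?_ (hc s ⟨hs, le_rfl⟩)
  · refine ContinuousOn.intervalIntegrable fun r hr => (hc r ?_).continuousWithinAt
    rwa [uIcc_of_le hs] at hr
  · exact ((continuous_gap hF).sqrt.measurable.inv).stronglyMeasurable.stronglyMeasurableAtFilter

theorem hasDerivAt_inv_sqrt_gap (hF : ∀ t, HasDerivAt F (f t) t) {s : ℝ}
    (hpos : 0 < P₀ - 2 * F s) :
    HasDerivAt (fun s => (√(P₀ - 2 * F s))⁻¹) (f s / √(P₀ - 2 * F s) ^ 3) s := by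
  have h0 : √(P₀ - 2 * F s) ≠ 0 := (Real.sqrt_pos.2 hpos).ne'
  refine (((hasDerivAt_gap hF s).sqrt hpos.ne').inv h0).congr_deriv ?_
  field_simp

/-- Below the height `M`, the values of `u` can thus be recovered from those of `profileTime F P₀ ∘
u`. -/
theorem strictMonoOn_profileTime (hF : ∀ t, HasDerivAt F (f t) t)
    (hpos : ∀ r ∈ Ico 0 M, 0 < P₀ - 2 * F r) : StrictMonoOn (profileTime F P₀) (Ico 0 M) := by
  have hd : ∀ s ∈ Ico 0 M, HasDerivAt (profileTime F P₀) (√(P₀ - 2 * F s))⁻¹ s := fun s hs =>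
    hasDerivAt_profileTime hF hs.1 fun r hr => hpos r ⟨hr.1, hr.2.trans_lt hs.2⟩
  refine strictMonoOn_of_deriv_pos (convex_Ico 0 M)
    (fun s hs => (hd s hs).continuousAt.continuousWithinAt) fun s hs => ?_
  rw [interior_Ico] at hs
  rw [(hd s ⟨hs.1.le, hs.2⟩).deriv]
  exact inv_pos.2 (Real.sqrt_pos.2 (hpos s ⟨hs.1.le, hs.2⟩))

end Profile

/-! ### Interior rigidity where `P` equals its bound -/

/-- A positive solution of `Δu + f(u) = 0` vanishing on the boundary, with `P`-function bounded by
`P₀`. -/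
structure IsPBoundedSolution {n : ℕ} (Ω : Set (Euc n)) (f F : ℝ → ℝ) (P₀ : ℝ) (u : Euc n → ℝ) :
    Prop where
  isOpen : IsOpen Ω
  contDiffOn : ContDiffOn ℝ 3 u Ω
  continuousOn : ContinuousOn u (closure Ω)
  equation : ∀ x ∈ Ω, Laplacian.laplacian u x + f (u x) = 0
  positive : ∀ x ∈ Ω, 0 < u x
  dirichlet : ∀ p ∈ frontier Ω, u p = 0
  continuous : Continuous f
  hasDerivAt : ∀ t, HasDerivAt F (f t) t
  PFunction_le : ∀ x ∈ Ω, PFunction F u x ≤ P₀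

namespace IsPBoundedSolution

variable {n : ℕ} {Ω U : Set (Euc n)} {f F : ℝ → ℝ} {P₀ M : ℝ} {u : Euc n → ℝ}

theorem contDiffAt (h : IsPBoundedSolution Ω f F P₀ u) {x : Euc n} (hx : x ∈ Ω) :
    ContDiffAt ℝ 3 u x :=
  h.contDiffOn.contDiffAt (h.isOpen.mem_nhds hx)

theorem differentiableAt (h : IsPBoundedSolution Ω f F P₀ u) {x : Euc n} (hx : x ∈ Ω) :
    DifferentiableAt ℝ u x :=
  (h.contDiffAt hx).differentiableAt (by norm_num)

theorem continuousAt_gradient (h : IsPBoundedSolution Ω f F P₀ u) {x : Euc n} (hx : x ∈ Ω) :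
    ContinuousAt (∇ u) x := by
  have h1 : ContDiffAt ℝ 2 (fderiv ℝ u) x := (h.contDiffAt hx).fderiv_right (m := 2) (by norm_num)
  exact ((InnerProductSpace.toDual ℝ (Euc n)).symm.continuous.continuousAt).comp h1.continuousAt

theorem continuousAt_PFunction (h : IsPBoundedSolution Ω f F P₀ u) {x : Euc n} (hx : x ∈ Ω) :
    ContinuousAt (PFunction F u) x :=
  (hasFDerivAt_PFunction ((h.contDiffAt hx).of_le (by norm_num)) h.hasDerivAt).continuousAt

/-- The Dirichlet condition keeps limits of points of `Ω` inside `Ω` once the limiting height is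
known to be nonzero; strips thereby stay in the domain. -/
theorem mem_of_closure (h : IsPBoundedSolution Ω f F P₀ u) {x : Euc n} (hx : x ∈ closure Ω)
    (hu : u x ≠ 0) : x ∈ Ω := by
  by_contra hn
  exact hu (h.dirichlet x (by rw [h.isOpen.frontier_eq]; exact ⟨hx, hn⟩))

theorem norm_gradient_sq_le (h : IsPBoundedSolution Ω f F P₀ u) {x : Euc n} (hx : x ∈ Ω) :
    ‖∇ u x‖ ^ 2 ≤ P₀ - 2 * F (u x) := by
  have := h.PFunction_le x hx
  rw [PFunction] at this
  linarith

theorem norm_gradient_le (h : IsPBoundedSolution Ω f F P₀ u) {x : Euc n} (hx : x ∈ Ω) :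
    ‖∇ u x‖ ≤ √(P₀ - 2 * F (u x)) :=
  Real.le_sqrt_of_sq_le (h.norm_gradient_sq_le hx)

theorem norm_gradient_eq {x : Euc n} (hx : PFunction F u x = P₀) :
    ‖∇ u x‖ = √(P₀ - 2 * F (u x)) := by
  rw [PFunction] at hx
  rw [show P₀ - 2 * F (u x) = ‖∇ u x‖ ^ 2 by linarith, Real.sqrt_sq (norm_nonneg _)]

theorem isSupersolution (h : IsPBoundedSolution Ω f F P₀ u) (hU : IsOpen U) (hUΩ : U ⊆ Ω)
    {A δ : ℝ} (hA : 0 ≤ A) (hδ : 0 < δ) (hf : ∀ z ∈ U, |f (u z)| ≤ A)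
    (hgrad : ∀ z ∈ U, δ ≤ ‖∇ u z‖) :
    IsSupersolution U (2 * A / δ) (fun z => P₀ - PFunction F u z) :=
  isSupersolution_PFunction hU (h.contDiffOn.mono hUΩ) h.hasDerivAt
    (fun z hz => h.equation z (hUΩ hz)) (fun z hz => h.PFunction_le z (hUΩ hz)) hA hδ hf hgrad

/-- Strong maximum principle for `P` at a noncritical point. -/
theorem PFunction_eventually_eq (h : IsPBoundedSolution Ω f F P₀ u) {x : Euc n} (hx : x ∈ Ω)
    (hP : PFunction F u x = P₀) (hne : ∇ u x ≠ 0) :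
    ∀ᶠ z in 𝓝 x, PFunction F u z = P₀ := by
  have h1 : ∀ᶠ z in 𝓝 x, ‖∇ u x‖ / 2 ≤ ‖∇ u z‖ :=
    ((h.continuousAt_gradient hx).norm.eventually_const_lt
      (half_lt_self (norm_pos_iff.2 hne))).mono fun z hz => hz.le
  have h2 : ∀ᶠ z in 𝓝 x, |f (u z)| ≤ |f (u x)| + 1 :=
    (((h.continuous.continuousAt.comp (h.differentiableAt hx).continuousAt).abs).eventually_lt_const
      (lt_add_one _)).mono fun z hz => hz.le
  obtain ⟨r, hr, hrU⟩ := Metric.eventually_nhds_iff_ball.1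
    ((h1.and h2).and (h.isOpen.mem_nhds hx))
  have hs := h.isSupersolution (U := Metric.ball x r) Metric.isOpen_ball
    (fun z hz => (hrU z hz).2) (A := |f (u x)| + 1) (δ := ‖∇ u x‖ / 2) (by positivity)
    (half_pos (norm_pos_iff.2 hne)) (fun z hz => (hrU z hz).1.2) fun z hz => (hrU z hz).1.1
  have h3 := hs.eq_zero_of_eq_zero (by positivity) (sub_eq_zero.2 hP.symm)
  filter_upwards [Metric.ball_mem_nhds x (half_pos hr)] with z hz
  have := h3 z hz
  linarith

/-- Where `P` is constant the direction of the gradient is locally constant. -/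
theorem normalized_gradient_eq (h : IsPBoundedSolution Ω f F P₀ u) (hU : IsOpen U)
    (hUc : IsPreconnected U) (hUΩ : U ⊆ Ω) (hP : ∀ z ∈ U, PFunction F u z = P₀)
    (hne : ∀ z ∈ U, ∇ u z ≠ 0) {x y : Euc n} (hx : x ∈ U) (hy : y ∈ U) :
    ‖∇ u x‖⁻¹ • ∇ u x = ‖∇ u y‖⁻¹ • ∇ u y := by
  have hnorm : ∀ z ∈ U, ‖∇ u z‖ = √(P₀ - 2 * F (u z)) := fun z hz => norm_gradient_eq (hP z hz)
  have hgap : ∀ z ∈ U, 0 < P₀ - 2 * F (u z) := fun z hz => by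
    rw [← Real.sqrt_pos, ← hnorm z hz]; exact norm_pos_iff.2 (hne z hz)
  -- The factor `(√(P₀ - 2F(u)))⁻¹` stands for `|∇u|⁻¹`. Its derivative cancels that of `∂_j u`,
  -- since the Hessian is `Δu` times the projection on the gradient.
  have hd : ∀ j, ∀ z ∈ U, HasFDerivAt
      (fun z => (√(P₀ - 2 * F (u z)))⁻¹ * fderiv ℝ u z (stdVec j)) (0 : Euc n →L[ℝ] ℝ) z := by
    intro j z hz
    have hu2 : ContDiffAt ℝ 2 u z := (h.contDiffAt (hUΩ hz)).of_le (by norm_num)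
    have h1 := (hasDerivAt_inv_sqrt_gap h.hasDerivAt (hgap z hz)).comp_hasFDerivAt z
      (h.differentiableAt (hUΩ hz)).hasFDerivAt
    have h2 := h1.mul (hasFDerivAt_fderiv_apply hu2 (stdVec j))
    refine h2.congr_fderiv ?_
    refine ContinuousLinearMap.coe_injective
      ((EuclideanSpace.basisFun (Fin n) ℝ).toBasis.ext fun i => ?_)
    have h3 := hessian_of_PFunction_eq (h.contDiffAt (hUΩ hz)) h.hasDerivAt (P₀ := P₀)
      (by filter_upwards [h.isOpen.mem_nhds (hUΩ hz)] with w hw using h.equation w hw)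
      (by filter_upwards [hU.mem_nhds hz] with w hw using hP w hw) (hne z hz) i j
    have h4 : Laplacian.laplacian u z = -f (u z) := by linarith [h.equation z (hUΩ hz)]
    have h5 : 0 < ‖∇ u z‖ := norm_pos_iff.2 (hne z hz)
    rw [h4] at h3
    simp only [OrthonormalBasis.coe_toBasis, ContinuousLinearMap.coe_coe, add_apply, smul_apply,
      smul_eq_mul, ContinuousLinearMap.flip_apply, Function.comp_apply, ← hnorm z hz, zero_apply]
    have h6 : fderiv ℝ (fderiv ℝ u) z (stdVec i) (stdVec j) =
      -f (u z) * fderiv ℝ u z (stdVec i) * fderiv ℝ u z (stdVec j) / ‖∇ u z‖ ^ 2 := by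
      rw [eq_div_iff (by positivity), h3]
    rw [h6]
    field_simp
    ring
  have hconst : ∀ j, (√(P₀ - 2 * F (u x)))⁻¹ * fderiv ℝ u x (stdVec j) =
      (√(P₀ - 2 * F (u y)))⁻¹ * fderiv ℝ u y (stdVec j) := fun j =>
    hU.is_const_of_fderiv_eq_zero hUc
      (fun z hz => (hd j z hz).differentiableAt.differentiableWithinAt)
      (fun z hz => (hd j z hz).fderiv) hx hy
  refine InnerProductSpace.ext_inner_right_basis (EuclideanSpace.basisFun (Fin n) ℝ).toBasis fun j => ?_
  simp only [OrthonormalBasis.coe_toBasis, real_inner_smul_left, inner_gradient_left]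
  rw [hnorm x hx, hnorm y hy]
  exact hconst j

theorem hasFDerivAt_profileTime (h : IsPBoundedSolution Ω f F P₀ u)
    (hM : ∀ r ∈ Ico 0 M, 0 < P₀ - 2 * F r) {x : Euc n} (hx : x ∈ Ω) (hxM : u x < M) :
    HasFDerivAt (fun z => profileTime F P₀ (u z)) ((√(P₀ - 2 * F (u x)))⁻¹ • fderiv ℝ u x) x :=
  (hasDerivAt_profileTime h.hasDerivAt (h.positive x hx).le fun r hr =>
    hM r ⟨hr.1, hr.2.trans_lt hxM⟩).comp_hasFDerivAt x (h.differentiableAt hx).hasFDerivAt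

/-- Where `P` is constant, `profileTime ∘ u` is affine. -/
theorem profileTime_sub_eq (h : IsPBoundedSolution Ω f F P₀ u)
    (hM : ∀ r ∈ Ico 0 M, 0 < P₀ - 2 * F r) (hU : IsOpen U)
    (hUc : IsPreconnected U) (hUΩ : U ⊆ Ω) (hP : ∀ z ∈ U, PFunction F u z = P₀)
    (hne : ∀ z ∈ U, ∇ u z ≠ 0) (huM : ∀ z ∈ U, u z < M) {x y : Euc n} (hx : x ∈ U) (hy : y ∈ U) :
    profileTime F P₀ (u y) - profileTime F P₀ (u x) = ⟪‖∇ u x‖⁻¹ • ∇ u x, y - x⟫ := by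
  set b := ‖∇ u x‖⁻¹ • ∇ u x with hb
  have hd : ∀ z ∈ U, HasFDerivAt (fun z => profileTime F P₀ (u z) - ⟪b, z - x⟫)
      (0 : Euc n →L[ℝ] ℝ) z := by
    intro z hz
    have h1 := h.hasFDerivAt_profileTime hM (hUΩ hz) (huM z hz)
    have h2 : HasFDerivAt (fun z => ⟪b, z - x⟫) (innerSL ℝ b) z :=
      ((innerSL ℝ b).hasFDerivAt.comp z ((hasFDerivAt_id z).sub_const x)).congr_fderiv (by
        ext; simp)
    refine (h1.sub h2).congr_fderiv (sub_eq_zero.2 ?_)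
    ext w
    rw [hb, h.normalized_gradient_eq hU hUc hUΩ hP hne hx hz, norm_gradient_eq (hP z hz)]
    simp [inner_gradient_left]
  have h1 := hU.is_const_of_fderiv_eq_zero hUc
    (fun z hz => (hd z hz).differentiableAt.differentiableWithinAt)
    (fun z hz => (hd z hz).fderiv) hx hy
  simp only [sub_self, inner_zero_right] at h1
  linarith

/-- If `profileTime ∘ u` is affine with slope one near a point, the same holds on the whole strip,
which is contained in the domain. -/
theorem strip_propagation (h : IsPBoundedSolution Ω f F P₀ u)
    (hM : ∀ r ∈ Ico 0 M, 0 < P₀ - 2 * F r) {L : ℝ}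
    (hL : ∀ t ∈ Ioo 0 L, ∃ σ ∈ Ioo 0 M, profileTime F P₀ σ = t) {b : Euc n} (hb : ‖b‖ = 1)
    {c : ℝ} {x₁ : Euc n} (hx₁ : x₁ ∈ Ω) (hx₁M : u x₁ < M) (hx₁L : ⟪b, x₁⟫ + c ∈ Ioo 0 L)
    (hseed : ∀ᶠ y in 𝓝 x₁, profileTime F P₀ (u y) = ⟪b, y⟫ + c) {x : Euc n}
    (hx : ⟪b, x⟫ + c ∈ Ioo 0 L) :
    x ∈ Ω ∧ u x < M ∧ profileTime F P₀ (u x) = ⟪b, x⟫ + c ∧ PFunction F u x = P₀ ∧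
      ∇ u x = √(P₀ - 2 * F (u x)) • b := by
  have hmono := strictMonoOn_profileTime h.hasDerivAt hM
  have hcl : Continuous fun y : Euc n => ⟪b, y⟫ + c := by fun_prop
  -- `V` is open and contains `x₁`; it remains to see that it is closed relative to the strip `S`,
  -- which is convex and hence connected.
  set V : Set (Euc n) :=
    {x | x ∈ Ω ∧ u x < M ∧ ∀ᶠ y in 𝓝 x, profileTime F P₀ (u y) = ⟪b, y⟫ + c} with hV
  set S : Set (Euc n) := {x | ⟪b, x⟫ + c ∈ Ioo 0 L} with hS
  have hgradV : ∀ x ∈ V, ∇ u x = √(P₀ - 2 * F (u x)) • b := by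
    rintro x ⟨hxΩ, hxM, hxe⟩
    have hg : 0 < P₀ - 2 * F (u x) := hM _ ⟨(h.positive x hxΩ).le, hxM⟩
    have h1 := h.hasFDerivAt_profileTime hM hxΩ hxM
    have h2 : HasFDerivAt (fun z => ⟪b, z⟫ + c) (innerSL ℝ b) x :=
      (innerSL ℝ b).hasFDerivAt.add_const c
    have h3 := h1.unique (h2.congr_of_eventuallyEq hxe)
    refine ext_inner_right ℝ fun w => ?_
    have h4 := congrArg (fun T => T w) h3
    simp only [smul_apply, smul_eq_mul, innerSL_apply_apply] at h4
    rw [inner_gradient_left, real_inner_smul_left, ← h4, mul_inv_cancel_left₀]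
    exact (Real.sqrt_pos.2 hg).ne'
  have hPV : ∀ x ∈ V, PFunction F u x = P₀ := by
    intro x hx
    have hg : 0 < P₀ - 2 * F (u x) := hM _ ⟨(h.positive x hx.1).le, hx.2.1⟩
    rw [PFunction, hgradV x hx, norm_smul, hb, mul_one, Real.norm_eq_abs, sq_abs,
      Real.sq_sqrt hg.le]
    ring
  have hVopen : IsOpen V := by
    rw [isOpen_iff_mem_nhds]
    rintro x ⟨hxΩ, hxM, hxe⟩
    filter_upwards [h.isOpen.mem_nhds hxΩ,
      (h.differentiableAt hxΩ).continuousAt.eventually_lt_const hxM,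
      hxe.eventually_nhds] with y h1 h2 h3
    exact ⟨h1, h2, h3⟩
  have hSc : IsPreconnected S := by
    have : S = (fun y : Euc n => ⟪b, y⟫) ⁻¹' Ioo (-c) (L - c) := by
      ext y
      simp only [hS, mem_ofPred_eq, mem_Ioo, mem_preimage]
      constructor <;> rintro ⟨h1, h2⟩ <;> constructor <;> linarith
    rw [this]
    exact ((convex_Ioo _ _).linear_preimage (innerSL ℝ b).toLinearMap).isPreconnected
  have hclosed : closure V ∩ S ⊆ V := by
    rintro x ⟨hxV, hxS⟩
    have hxΩ' : x ∈ closure Ω := closure_mono (fun y hy => hy.1) hxV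
    obtain ⟨σ, hσ, hσx⟩ := hL _ hxS
    have hne : (𝓝[V] x).NeBot := mem_closure_iff_nhdsWithin_neBot.1 hxV
    have hlimu : Tendsto u (𝓝[V] x) (𝓝 (u x)) :=
      (h.continuousOn x hxΩ').mono_left
        (nhdsWithin_mono x fun y hy => subset_closure hy.1)
    have hliml : Tendsto (fun y : Euc n => ⟪b, y⟫ + c) (𝓝[V] x) (𝓝 (profileTime F P₀ σ)) := by
      rw [hσx]; exact hcl.continuousAt.continuousWithinAt
    have hVmem : ∀ᶠ y in 𝓝[V] x, y ∈ V := self_mem_nhdsWithin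
    -- The limit `u x` might a priori equal `M`, beyond the range where `profileTime` is controlled,
    -- so it is compared with heights `τ` on either side of `σ`.
    have hux : u x = σ := by
      refine le_antisymm ?_ ?_
      · refine le_of_forall_gt_imp_ge_of_dense fun τ hτ => ?_
        rcases lt_or_ge τ M with hτM | hτM
        · have hτm : τ ∈ Ico 0 M := ⟨hσ.1.le.trans hτ.le, hτM⟩
          refine le_of_tendsto hlimu ?_
          filter_upwards [hVmem, hliml.eventually_lt_const
            (hmono ⟨hσ.1.le, hσ.2⟩ hτm hτ)] with y hy1 hy2
          rw [← hy1.2.2.self_of_nhds] at hy2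
          exact ((hmono.lt_iff_lt ⟨(h.positive y hy1.1).le, hy1.2.1⟩ hτm).1 hy2).le
        · refine le_of_tendsto hlimu ?_
          filter_upwards [hVmem] with y hy using hy.2.1.le.trans hτM
      · refine le_of_forall_lt_imp_le_of_dense fun τ hτ => ?_
        rcases le_or_gt 0 τ with hτ0 | hτ0
        · have hτm : τ ∈ Ico 0 M := ⟨hτ0, hτ.trans hσ.2⟩
          refine ge_of_tendsto hlimu ?_
          filter_upwards [hVmem, hliml.eventually_const_lt
            (hmono hτm ⟨hσ.1.le, hσ.2⟩ hτ)] with y hy1 hy2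
          rw [← hy1.2.2.self_of_nhds] at hy2
          exact ((hmono.lt_iff_lt hτm ⟨(h.positive y hy1.1).le, hy1.2.1⟩).1 hy2).le
        · refine ge_of_tendsto hlimu ?_
          filter_upwards [hVmem] with y hy using hτ0.le.trans (h.positive y hy.1).le
    have hxΩ : x ∈ Ω := h.mem_of_closure hxΩ' (by rw [hux]; exact hσ.1.ne')
    have hxM : u x < M := by rw [hux]; exact hσ.2
    have hg : 0 < P₀ - 2 * F (u x) := hM _ ⟨(h.positive x hxΩ).le, hxM⟩
    have hgap : ContinuousAt (fun y => √(P₀ - 2 * F (u y)) • b) x :=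
      (((continuous_gap h.hasDerivAt).continuousAt.comp
        (h.differentiableAt hxΩ).continuousAt).sqrt).smul continuousAt_const
    have hgx : ∇ u x = √(P₀ - 2 * F (u x)) • b := by
      refine tendsto_nhds_unique ((h.continuousAt_gradient hxΩ).continuousWithinAt (s := V)) ?_
      refine (hgap.continuousWithinAt (s := V)).congr' ?_
      filter_upwards [hVmem] with y hy using (hgradV y hy).symm
    have hPx : PFunction F u x = P₀ := by
      refine tendsto_nhds_unique ((h.continuousAt_PFunction hxΩ).continuousWithinAt (s := V)) ?_
      refine tendsto_const_nhds.congr' ?_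
      filter_upwards [hVmem] with y hy using (hPV y hy).symm
    have hgne : ∇ u x ≠ 0 := by
      rw [hgx, smul_ne_zero_iff]
      exact ⟨(Real.sqrt_pos.2 hg).ne', by rw [← norm_ne_zero_iff, hb]; exact one_ne_zero⟩
    -- The strong maximum principle extends `P = P₀` from `x` to a ball; on it `profileTime ∘ u` is
    -- affine with the slope `b` found at `x`.
    obtain ⟨r, hr, hrU⟩ := Metric.eventually_nhds_iff_ball.1
      (((h.PFunction_eventually_eq hxΩ hPx hgne).and
        ((h.continuousAt_gradient hxΩ).eventually_ne hgne)).and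
      ((h.isOpen.eventually_mem hxΩ).and
        ((h.differentiableAt hxΩ).continuousAt.eventually_lt_const hxM)))
    refine ⟨hxΩ, hxM, ?_⟩
    filter_upwards [Metric.ball_mem_nhds x hr] with y hy
    have h1 := h.profileTime_sub_eq hM Metric.isOpen_ball (convex_ball x r).isPreconnected
      (fun z hz => (hrU z hz).2.1) (fun z hz => (hrU z hz).1.1) (fun z hz => (hrU z hz).1.2)
      (fun z hz => (hrU z hz).2.2) (Metric.mem_ball_self hr) hy
    have h2 : ‖∇ u x‖⁻¹ • ∇ u x = b := by
      rw [norm_gradient_eq hPx, hgx, smul_smul, inv_mul_cancel₀ (Real.sqrt_pos.2 hg).ne', one_smul]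
    rw [h2, hux, hσx, inner_sub_right] at h1
    linarith
  have hsub := hSc.subset_of_closure_inter_subset hVopen ⟨x₁, hx₁L, hx₁, hx₁M, hseed⟩ hclosed
  have hxV := hsub hx
  exact ⟨hxV.1, hxV.2.1, hxV.2.2.self_of_nhds, hPV x hxV, hgradV x hxV⟩

end IsPBoundedSolution

/-! ### Second order Taylor expansion -/

section Taylor

variable {n : ℕ} {φ : Euc n → ℝ} {p : Euc n}

theorem hasFDerivAt_gradient (h : ContDiffAt ℝ 2 φ p) :
    HasFDerivAt (∇ φ) (fderiv ℝ (∇ φ) p) p := by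
  have h2 : DifferentiableAt ℝ (fderiv ℝ φ) p :=
    (h.fderiv_right (m := 1) (by norm_num)).differentiableAt (by norm_num)
  have h3 : DifferentiableAt ℝ (∇ φ) p :=
    ((InnerProductSpace.toDual ℝ (Euc n)).symm.toContinuousLinearEquiv.differentiableAt).comp p h2
  exact h3.hasFDerivAt

theorem inner_fderiv_gradient (h : ContDiffAt ℝ 2 φ p) (v w : Euc n) :
    ⟪fderiv ℝ (∇ φ) p v, w⟫ = fderiv ℝ (fderiv ℝ φ) p v w := by
  have h1 := (hasFDerivAt_gradient h).inner ℝ (hasFDerivAt_const w p)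
  have h2 := hasFDerivAt_fderiv_apply h w
  have h3 : (fun z => ⟪∇ φ z, w⟫) = fun z => fderiv ℝ φ z w := funext fun z => by
    rw [inner_gradient_left]
  rw [h3] at h1
  have h4 := congrArg (fun T => T v) (h1.unique h2)
  simpa using h4

theorem inner_fderiv_gradient_comm (h : ContDiffAt ℝ 2 φ p) (v w : Euc n) :
    ⟪fderiv ℝ (∇ φ) p v, w⟫ = ⟪fderiv ℝ (∇ φ) p w, v⟫ := by
  rw [inner_fderiv_gradient h, inner_fderiv_gradient h, fderiv_fderiv_symm h]

/-- Second order Taylor expansion. -/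
theorem taylor_two (h : ContDiffAt ℝ 2 φ p) {ε : ℝ} (hε : 0 < ε) :
    ∀ᶠ x in 𝓝 p, |φ x - φ p - ⟪∇ φ p, x - p⟫ - ⟪fderiv ℝ (∇ φ) p (x - p), x - p⟫ / 2| ≤
      ε * ‖x - p‖ ^ 2 := by
  have hA := hasFDerivAt_gradient h
  set A := fderiv ℝ (∇ φ) p with hAdef
  have h1 := hA.isLittleO.def hε
  have h2 := h.eventually (by simp)
  obtain ⟨r, hr, hrU⟩ := Metric.eventually_nhds_iff_ball.1 (h1.and h2)
  filter_upwards [Metric.ball_mem_nhds p hr] with x hx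
  -- The mean value inequality is applied to the Taylor remainder. Since `A` is symmetric, its
  -- gradient is `∇φ z - ∇φ p - A (z - p)`, small because `∇φ` is differentiable at `p`.
  set R : Euc n → ℝ := fun z => φ z - φ p - ⟪∇ φ p, z - p⟫ - ⟪A (z - p), z - p⟫ / 2
  have hsub : Metric.closedBall p ‖x - p‖ ⊆ Metric.ball p r :=
    Metric.closedBall_subset_ball (by rwa [← dist_eq_norm])
  have hd : ∀ z ∈ Metric.closedBall p ‖x - p‖, HasFDerivWithinAt R
      (innerSL ℝ (∇ φ z - ∇ φ p - A (z - p))) (Metric.closedBall p ‖x - p‖) z := by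
    intro z hz
    have hz2 := (hrU z (hsub hz)).2
    have e0 : HasFDerivAt (fun z => z - p) (ContinuousLinearMap.id ℝ (Euc n)) z :=
      (hasFDerivAt_id z).sub_const p
    have e1 : HasFDerivAt φ (fderiv ℝ φ z) z :=
      (hz2.differentiableAt (by norm_num)).hasFDerivAt
    have e2 := (hasFDerivAt_const (∇ φ p) z).inner ℝ e0
    have e3 := ((A.hasFDerivAt.comp z e0).inner ℝ e0).mul_const (2⁻¹ : ℝ)
    refine (((e1.sub_const (φ p)).sub e2).sub e3).hasFDerivWithinAt.congr_fderiv ?_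
    ext w
    have hs : ⟪A w, z - p⟫ = ⟪A (z - p), w⟫ := inner_fderiv_gradient_comm h w (z - p)
    simp [inner_sub_left, inner_gradient_left, hs]
    ring
  have hbound : ∀ z ∈ Metric.closedBall p ‖x - p‖,
      ‖innerSL ℝ (∇ φ z - ∇ φ p - A (z - p))‖ ≤ ε * ‖x - p‖ := by
    intro z hz
    rw [innerSL_apply_norm]
    refine (hrU z (hsub hz)).1.trans ?_
    have : ‖z - p‖ ≤ ‖x - p‖ := by simpa [dist_eq_norm] using hz
    gcongr
  have h3 := (convex_closedBall p ‖x - p‖).norm_image_sub_le_of_norm_hasFDerivWithin_le hd hbound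
    (Metric.mem_closedBall_self (norm_nonneg _)) (y := x) (by simp [dist_eq_norm])
  have h4 : R p = 0 := by simp [R]
  rw [h4, sub_zero, Real.norm_eq_abs] at h3
  calc |R x| ≤ ε * ‖x - p‖ * ‖x - p‖ := h3
    _ = _ := by ring

end Taylor

/-! ### The boundary to second order -/

/-- Second order description of `∂Ω` at `p`: `e` is the inward normal and `B` the second fundamental
form, extended by zero in the normal direction. -/
structure IsSecondOrderModel {n : ℕ} (Ω : Set (Euc n)) (p e : Euc n) (B : Euc n →L[ℝ] Euc n) :
    Prop where
  norm_eq : ‖e‖ = 1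
  normal_eq : outwardNormal Ω p = -e
  form_add_smul : ∀ (y : Euc n) (t : ℝ), ⟪B (y + t • e), y + t • e⟫ = ⟪B y, y⟫
  sum_eq : ∑ i, ⟪B (stdVec i), stdVec i⟫ = ((n : ℝ) - 1) * meanCurvature Ω p
  frontier_approx : ∀ ε > 0, ∀ᶠ x in 𝓝 p, x ∈ frontier Ω →
    |⟪e, x - p⟫ - ⟪B (x - p), x - p⟫ / 2| ≤ ε * ‖x - p‖ ^ 2
  closure_bound : ∃ C > 0, ∀ᶠ x in 𝓝 p, x ∈ closure Ω → -(C * ‖x - p‖ ^ 2) ≤ ⟪e, x - p⟫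
  frontier_bound : ∃ C > 0, ∀ᶠ x in 𝓝 p, x ∈ frontier Ω → |⟪e, x - p⟫| ≤ C * ‖x - p‖ ^ 2
  interior_bound : ∃ C > 0, ∀ᶠ x in 𝓝 p, C * ‖x - p‖ ^ 2 < ⟪e, x - p⟫ → x ∈ Ω
  normal_approx : ∀ ε > 0, ∀ᶠ x in 𝓝 p, x ∈ frontier Ω →
    1 - ε * ‖x - p‖ ≤ ⟪-outwardNormal Ω x, e⟫
  inward : ∀ᶠ x in 𝓝 p, x ∈ frontier Ω → ∀ᶠ t in 𝓝[>] (0 : ℝ), x + t • e ∈ Ω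

section Geometry

variable {n : ℕ} {Ω : Set (Euc n)} {p : Euc n} {φ : Euc n → ℝ}

theorem norm_unitNormalField (h : ∇ φ p ≠ 0) : ‖unitNormalField φ p‖ = 1 := by
  rw [unitNormalField, norm_smul, norm_inv, norm_norm, inv_mul_cancel₀ (norm_ne_zero_iff.2 h)]

theorem gradient_eq_smul_unitNormalField (h : ∇ φ p ≠ 0) :
    ∇ φ p = ‖∇ φ p‖ • unitNormalField φ p := by
  rw [unitNormalField, smul_smul, mul_inv_cancel₀ (norm_ne_zero_iff.2 h), one_smul]

theorem norm_outwardNormal (h : IsDefiningFunctionAt Ω p φ) : ‖outwardNormal Ω p‖ = 1 := by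
  rw [outwardNormal_eq h, norm_unitNormalField h.gradient_ne_zero]

theorem IsDefiningFunctionAt.eventually_closure (h : IsDefiningFunctionAt Ω p φ) :
    ∀ᶠ x in 𝓝 p, x ∈ closure Ω → φ x ≤ 0 := by
  filter_upwards [h.eventually_mem_iff.eventually_nhds, h.contDiffAt.eventually (by simp)]
    with x hx hx2 hxc
  have hne : (𝓝[Ω] x).NeBot := mem_closure_iff_nhdsWithin_neBot.1 hxc
  have hc : Tendsto φ (𝓝[Ω] x) (𝓝 (φ x)) := hx2.continuousAt.continuousWithinAt
  refine le_of_tendsto hc ?_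
  filter_upwards [nhdsWithin_le_nhds hx, self_mem_nhdsWithin] with y hy hyΩ
  exact (hy.1 hyΩ).le

/-- One defining function serves all boundary points near `p`, so the normals there are values of a
single field that is differentiable at `p`. -/
theorem IsDefiningFunctionAt.eventually_frontier (h : IsDefiningFunctionAt Ω p φ)
    (hΩ : IsOpen Ω) : ∀ᶠ x in 𝓝 p, x ∈ frontier Ω → IsDefiningFunctionAt Ω x φ := by
  filter_upwards [h.eventually_mem_iff.eventually_nhds, h.contDiffAt.eventually (by simp),
    h.hasFDerivAt_gradient.continuousAt.eventually_ne h.gradient_ne_zero, h.eventually_closure]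
    with x h1 h2 h3 h4 hxf
  refine ⟨h2, le_antisymm (h4 (frontier_subset_closure hxf)) ?_, h3, h1⟩
  rw [hΩ.frontier_eq] at hxf
  by_contra! hlt
  exact hxf.2 (h1.self_of_nhds.2 hlt)

/-- Moving from a boundary point against a direction in which the defining function grows leads into
the domain. -/
theorem IsDefiningFunctionAt.eventually_add_smul_mem (h : IsDefiningFunctionAt Ω p φ) {e : Euc n}
    (he : ⟪∇ φ p, e⟫ < 0) : ∀ᶠ t in 𝓝[>] (0 : ℝ), p + t • e ∈ Ω := by
  have hd : DifferentiableAt ℝ φ p := h.contDiffAt.differentiableAt (by norm_num)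
  have hx : p + (0 : ℝ) • e = p := by simp
  have h1 := hasDerivAt_line (v := φ) (x := p) (e := e) (t := 0) (by rw [hx]; exact hd)
  rw [hx, ← inner_gradient_left] at h1
  have h2 := eventually_nhdsWithin_sign_eq_of_deriv_neg
    (f := fun t : ℝ => φ (p + t • e)) (x₀ := 0) (by rw [h1.deriv]; exact he)
    (by simpa using h.map_eq_zero)
  filter_upwards [nhdsWithin_le_nhds h2, nhdsWithin_le_nhds
    ((tendsto_line p e).eventually h.eventually_mem_iff), self_mem_nhdsWithin] with t h3 h4 h5
  refine h4.2 ?_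
  have h6 : SignType.sign (0 - t) = -1 := by
    rw [sign_eq_neg_one_iff]; simpa using h5
  rw [h6, sign_eq_neg_one_iff] at h3
  exact h3

/-- The second order model of the boundary given by a defining function. -/
theorem IsDefiningFunctionAt.exists_secondOrderModel (h : IsDefiningFunctionAt Ω p φ)
    (hΩ : IsOpen Ω) (hn : 2 ≤ n) : ∃ e B, IsSecondOrderModel Ω p e B := by
  set a := ‖∇ φ p‖ with ha
  have hapos : 0 < a := norm_pos_iff.2 h.gradient_ne_zero
  set N := unitNormalField φ p with hN
  have hN1 : ‖N‖ = 1 := norm_unitNormalField h.gradient_ne_zero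
  have hgN : ∇ φ p = a • N := gradient_eq_smul_unitNormalField h.gradient_ne_zero
  set A := fderiv ℝ (∇ φ) p with hA
  have hAs : ∀ v w, ⟪A v, w⟫ = ⟪A w, v⟫ := inner_fderiv_gradient_comm h.contDiffAt
  -- `T` is the projection on the tangent hyperplane. The form `a⁻¹ T A T` built from it ignores
  -- normal components, as `form_add_smul` requires.
  set T : Euc n →L[ℝ] Euc n := ContinuousLinearMap.id ℝ (Euc n) - (innerSL ℝ N).smulRight N with hT
  have hTa : ∀ y, T y = y - ⟪N, y⟫ • N := fun y => by simp [hT]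
  have hNN : ⟪N, N⟫ = 1 := by rw [real_inner_self_eq_norm_sq, hN1, one_pow]
  have hTN : T N = 0 := by rw [hTa, hNN, one_smul, sub_self]
  have hTs : ∀ v w, ⟪T v, w⟫ = ⟪v, T w⟫ := fun v w => by
    rw [hTa, hTa, inner_sub_left, inner_sub_right, real_inner_smul_left, inner_smul_right,
      real_inner_comm v N]
    ring
  set B : Euc n →L[ℝ] Euc n := a⁻¹ • (T.comp (A.comp T)) with hB
  have hBi : ∀ v w, ⟪B v, w⟫ = a⁻¹ * ⟪A (T v), T w⟫ := fun v w => by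
    simp [hB, real_inner_smul_left, hTs]
  have hTn : ∀ y, ‖T y‖ ≤ ‖y‖ := by
    intro y
    have h1 : ‖T y‖ ^ 2 = ‖y‖ ^ 2 - ⟪N, y⟫ ^ 2 := by
      rw [hTa, norm_sub_sq_real, inner_smul_right, norm_smul, hN1, mul_one, Real.norm_eq_abs,
        sq_abs, real_inner_comm]
      ring
    exact pow_le_pow_iff_left₀ (norm_nonneg _) (norm_nonneg _) two_ne_zero |>.1 (by
      rw [h1]; nlinarith [sq_nonneg ⟪N, y⟫])
  set C := (‖A‖ + 1) / a with hC
  have hCpos : 0 < C := by positivity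
  have hAq : ∀ y, |⟪A y, y⟫| ≤ ‖A‖ * ‖y‖ ^ 2 := fun y => by
    calc |⟪A y, y⟫| ≤ ‖A y‖ * ‖y‖ := abs_real_inner_le_norm _ _
      _ ≤ ‖A‖ * ‖y‖ * ‖y‖ := by gcongr; exact A.le_opNorm y
      _ = _ := by ring
  have htaylor : ∀ ε > 0, ∀ᶠ x in 𝓝 p,
      |φ x + a * ⟪-N, x - p⟫ - ⟪A (x - p), x - p⟫ / 2| ≤ ε * ‖x - p‖ ^ 2 := by
    intro ε hε
    filter_upwards [taylor_two h.contDiffAt hε] with x hx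
    rw [h.map_eq_zero, hgN, real_inner_smul_left] at hx
    rw [inner_neg_left]
    convert hx using 2
    ring
  have hfr : ∃ C > 0, ∀ᶠ x in 𝓝 p, x ∈ frontier Ω → |⟪-N, x - p⟫| ≤ C * ‖x - p‖ ^ 2 := by
    refine ⟨C, hCpos, ?_⟩
    filter_upwards [htaylor 1 one_pos, h.eventually_frontier hΩ] with x h1 h2 hx
    rw [(h2 hx).map_eq_zero, zero_add] at h1
    have h3 := hAq (x - p)
    have h4 : |a * ⟪-N, x - p⟫| ≤ (‖A‖ + 1) * ‖x - p‖ ^ 2 := by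
      rw [abs_le] at h1 h3 ⊢
      constructor <;> nlinarith [h1.1, h1.2, h3.1, h3.2, sq_nonneg ‖x - p‖, norm_nonneg A]
    rw [abs_mul, abs_of_pos hapos] at h4
    rw [hC, div_mul_eq_mul_div, le_div_iff₀ hapos]
    linarith
  refine ⟨-N, B, ⟨by rw [norm_neg, hN1], by rw [neg_neg, outwardNormal_eq h], ?_, ?_, ?_, ?_,
    hfr, ?_, ?_, ?_⟩⟩
  · intro y t
    rw [hBi, hBi]
    have : T (y + t • -N) = T y := by
      rw [map_add, map_smul, map_neg, hTN, neg_zero, smul_zero, add_zero]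
    rw [this]
  · have hn1 : ((n : ℝ) - 1) ≠ 0 := by
      have : (2 : ℝ) ≤ n := by exact_mod_cast hn
      linarith
    rw [meanCurvature_eq h, mul_inv_cancel_left₀ hn1]
    -- In an orthonormal basis containing `N` the two traces agree entry by entry: the normal
    -- entries vanish, as a unit field has derivative orthogonal to itself.
    obtain ⟨s, b, hs, hb⟩ := Orthonormal.exists_orthonormalBasis_extension (𝕜 := ℝ)
      (v := {N}) (E := Euc n) (by
        refine orthonormal_subtype_iff_ite.2 ?_
        intro v hv w hw
        simp only [Set.mem_singleton_iff] at hv hw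
        subst hv; subst hw
        simpa using hNN)
    have h1 : ∑ i, ⟪B (stdVec i), stdVec i⟫ = LinearMap.trace ℝ (Euc n) B.toLinearMap := by
      rw [LinearMap.trace_eq_sum_inner _ (EuclideanSpace.basisFun (Fin n) ℝ)]
      exact Finset.sum_congr rfl fun i _ => real_inner_comm _ _
    rw [h1, divergence, LinearMap.trace_eq_sum_inner _ b, LinearMap.trace_eq_sum_inner _ b]
    refine Finset.sum_congr rfl fun i _ => ?_
    obtain ⟨a1, a2⟩ := h.unitNormalField_deriv
    obtain ⟨i0, hi0⟩ : ∃ i0, b i0 = N := ⟨⟨_, hs rfl⟩, by rw [hb]⟩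
    simp only [ContinuousLinearMap.coe_coe]
    rw [real_inner_comm, hBi]
    by_cases hi : i = i0
    · subst hi
      rw [hi0, hTN, inner_zero_right, mul_zero, hN, unitNormalField, real_inner_smul_left, a2,
        mul_zero]
    · have he : ⟪N, b i⟫ = 0 := by rw [← hi0, b.inner_eq_zero (Ne.symm hi)]
      have hTb : T (b i) = b i := by rw [hTa, he, zero_smul, sub_zero]
      rw [hTb, a1 _ (by rw [hgN, real_inner_smul_left, he, mul_zero])]
  · intro ε hε
    obtain ⟨C, hC, hfr⟩ := hfr
    set K := 2 * ‖A‖ * C with hK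
    have hsmall : ∀ᶠ x in 𝓝 p, K * ‖x - p‖ ≤ a * ε := by
      have : Tendsto (fun x : Euc n => K * ‖x - p‖) (𝓝 p) (𝓝 0) := by
        have : Continuous fun x : Euc n => K * ‖x - p‖ := by fun_prop
        simpa using this.tendsto p
      exact (this.eventually_lt_const (by positivity)).mono fun x hx => hx.le
    filter_upwards [htaylor (a * ε / 2) (by positivity), h.eventually_frontier hΩ, hfr, hsmall]
      with x h1 h2 h3 h4 hx
    rw [(h2 hx).map_eq_zero, zero_add] at h1
    specialize h3 hx
    set y := x - p
    -- On the boundary the normal component of `y` is quadratic in `‖y‖`, so replacing `A` by its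
    -- tangential part costs only a cubic error.
    have h5 : |⟪A y, y⟫ - ⟪A (T y), T y⟫| ≤ K * ‖y‖ * ‖y‖ ^ 2 := by
      have e1 : y = T y + ⟪N, y⟫ • N := by rw [hTa]; abel
      have e2 : ⟪A y, y⟫ - ⟪A (T y), T y⟫ = ⟪N, y⟫ * (⟪A N, T y⟫ + ⟪A N, y⟫) := by
        have e3 : ∀ w, ⟪A y, w⟫ = ⟪A (T y), w⟫ + ⟪N, y⟫ * ⟪A N, w⟫ := fun w => by
          conv_lhs => rw [e1]
          rw [map_add, map_smul, inner_add_left, real_inner_smul_left]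
        have e4 := hAs (T y) y
        rw [e3 (T y)] at e4
        rw [e3 y, e4]; ring
      have e5 : |⟪A N, T y⟫ + ⟪A N, y⟫| ≤ 2 * ‖A‖ * ‖y‖ := by
        have hAN : ‖A N‖ ≤ ‖A‖ := by simpa [hN1] using A.le_opNorm N
        have f1 : |⟪A N, T y⟫| ≤ ‖A‖ * ‖y‖ :=
          (abs_real_inner_le_norm _ _).trans (mul_le_mul hAN (hTn y) (norm_nonneg _)
            (norm_nonneg _))
        have f2 : |⟪A N, y⟫| ≤ ‖A‖ * ‖y‖ :=
          (abs_real_inner_le_norm _ _).trans (mul_le_mul_of_nonneg_right hAN (norm_nonneg _))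
        linarith [abs_add_le ⟪A N, T y⟫ ⟪A N, y⟫]
      rw [inner_neg_left, abs_neg] at h3
      rw [e2, abs_mul]
      calc |⟪N, y⟫| * |⟪A N, T y⟫ + ⟪A N, y⟫| ≤ (C * ‖y‖ ^ 2) * (2 * ‖A‖ * ‖y‖) := by gcongr
        _ = _ := by rw [hK]; ring
    have h6 : |⟪A y, y⟫ - ⟪A (T y), T y⟫| ≤ a * ε * ‖y‖ ^ 2 := h5.trans (by gcongr)
    have h7 : |a * ⟪-N, y⟫ - ⟪A (T y), T y⟫ / 2| ≤ a * (ε * ‖y‖ ^ 2) := by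
      rw [abs_le] at h1 h6 ⊢
      constructor <;> linarith [h1.1, h1.2, h6.1, h6.2]
    have h8 : ⟪-N, y⟫ - ⟪B y, y⟫ / 2 = a⁻¹ * (a * ⟪-N, y⟫ - ⟪A (T y), T y⟫ / 2) := by
      rw [hBi]; field_simp
    rw [h8, abs_mul, abs_of_pos (inv_pos.2 hapos), inv_mul_le_iff₀ hapos]
    exact h7
  · refine ⟨C, hCpos, ?_⟩
    filter_upwards [htaylor 1 one_pos, h.eventually_closure] with x h1 h2 hx
    have h3 := hAq (x - p)
    have h4 := h2 hx
    rw [hC, div_mul_eq_mul_div, ← neg_div, div_le_iff₀ hapos]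
    rw [abs_le] at h1 h3
    nlinarith [h1.1, h1.2, h3.1, h3.2, sq_nonneg ‖x - p‖, norm_nonneg A]
  · refine ⟨C, hCpos, ?_⟩
    filter_upwards [htaylor 1 one_pos, h.eventually_mem_iff] with x h1 h2 hx
    refine h2.2 ?_
    have h3 := hAq (x - p)
    rw [hC, div_mul_eq_mul_div, div_lt_iff₀ hapos] at hx
    rw [abs_le] at h1 h3
    nlinarith [h1.1, h1.2, h3.1, h3.2, sq_nonneg ‖x - p‖, norm_nonneg A]
  · intro ε hε
    have hdN : HasFDerivAt (unitNormalField φ) (fderiv ℝ (unitNormalField φ) p) p := by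
      have hA' := h.hasFDerivAt_gradient
      have hn' : DifferentiableAt ℝ (fun y => ‖∇ φ y‖⁻¹) p :=
        ((hA'.differentiableAt.norm ℝ h.gradient_ne_zero).inv
          (norm_ne_zero_iff.2 h.gradient_ne_zero))
      exact (hn'.smul hA'.differentiableAt).hasFDerivAt
    filter_upwards [hdN.isLittleO.def hε, h.eventually_frontier hΩ] with x h1 h2 hx
    rw [outwardNormal_eq (h2 hx), inner_neg_neg]
    -- This removes the linear term from the expansion of `⟪ν(x), N⟫` at `p`, leaving `1 + o(‖x -
    -- p‖)`.
    have h3 : ⟪N, fderiv ℝ (unitNormalField φ) p (x - p)⟫ = 0 := by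
      rw [hN, unitNormalField, real_inner_smul_left, h.unitNormalField_deriv.2, mul_zero]
    have h4 : ⟪unitNormalField φ x, N⟫ = 1 +
        ⟪N, unitNormalField φ x - unitNormalField φ p -
          fderiv ℝ (unitNormalField φ) p (x - p)⟫ := by
      rw [inner_sub_right, inner_sub_right, h3, ← hN, hNN, real_inner_comm]
      ring
    have h5 := abs_real_inner_le_norm N (unitNormalField φ x - unitNormalField φ p -
          fderiv ℝ (unitNormalField φ) p (x - p))
    rw [hN1, one_mul] at h5
    rw [h4]
    have := (abs_le.1 (h5.trans h1)).1
    linarith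
  · have hc : ContinuousAt (fun x => ⟪∇ φ x, -N⟫) p :=
      h.hasFDerivAt_gradient.continuousAt.inner continuousAt_const
    have h0 : ⟪∇ φ p, -N⟫ < 0 := by
      rw [hgN, inner_neg_right, real_inner_smul_left, hNN]; linarith
    filter_upwards [hc.eventually_lt_const h0, h.eventually_frontier hΩ] with x h1 h2 hx
    exact (h2 hx).eventually_add_smul_mem h1

end Geometry

/-! ### The gradient of `u` at the boundary -/

section Boundary

variable {n : ℕ} {Ω : Set (Euc n)} {f F : ℝ → ℝ} {κ : ℝ} {u : Euc n → ℝ}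

theorem deriv_nonpos_of_eventually_le {g : ℝ → ℝ} {g' : ℝ} {δ : ℝ} (hδ : 0 < δ)
    (hg : HasDerivWithinAt g g' (Ico 0 δ) 0) (hle : ∀ t ∈ Ioo 0 δ, g t ≤ g 0) : g' ≤ 0 := by
  have h1 := hasDerivWithinAt_iff_tendsto_slope.1 hg
  have h2 : Ico 0 δ \ {0} = Ioo 0 δ := Ico_sdiff_left
  rw [h2, nhdsWithin_Ioo_eq_nhdsGT hδ] at h1
  refine le_of_tendsto h1 ?_
  filter_upwards [Ioo_mem_nhdsGT hδ] with t ht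
  rw [slope_def_field]
  exact div_nonpos_of_nonpos_of_nonneg (by linarith [hle t ht]) (by linarith [ht.1])

/-- The line derivative within the closure of the domain, in an inward direction. -/
theorem hasDerivWithinAt_line_of_inward {v : Euc n → ℝ} {v' : Euc n →L[ℝ] ℝ} {x e : Euc n}
    (hx : x ∈ closure Ω) (hv : HasFDerivWithinAt v v' (closure Ω) x)
    (he : ∀ᶠ t in 𝓝[>] (0 : ℝ), x + t • e ∈ Ω) :
    ∃ δ > 0, (∀ t ∈ Ioo 0 δ, x + t • e ∈ Ω) ∧
      HasDerivWithinAt (fun t : ℝ => v (x + t • e)) (v' e) (Ico 0 δ) 0 := by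
  obtain ⟨δ, hδ, hδ'⟩ := mem_nhdsGT_iff_exists_Ioo_subset.1 he
  refine ⟨δ, hδ, hδ', ?_⟩
  have h1 : HasDerivWithinAt (fun t : ℝ => x + t • e) e (Ico 0 δ) 0 := by
    simpa using (((hasDerivAt_id (0 : ℝ)).smul_const e).const_add x).hasDerivWithinAt
  have h2 : MapsTo (fun t : ℝ => x + t • e) (Ico 0 δ) (closure Ω) := by
    intro t ht
    rcases eq_or_lt_of_le ht.1 with h0 | h0
    · simpa [← h0] using hx
    · exact subset_closure (hδ' ⟨h0, ht.2⟩)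
  have hv' : HasFDerivWithinAt v v' (closure Ω) (x + (0 : ℝ) • e) := by simpa using hv
  exact hv'.comp_hasDerivWithinAt 0 h1 h2

theorem IsBoundedSolution.neumann_inward {x : Euc n}
    (hu : IsBoundedSolution Ω f κ u) (hx : x ∈ frontier Ω) (δ : ℝ) :
    HasDerivWithinAt (fun t : ℝ => u (x + t • -outwardNormal Ω x)) κ (Ico 0 δ) 0 := by
  have h1 := hu.neumann x hx
  have h2 : HasDerivWithinAt (fun t : ℝ => -t) (-1) (Ico 0 δ) 0 :=
    (hasDerivAt_neg (0 : ℝ)).hasDerivWithinAt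
  have h3 : MapsTo (fun t : ℝ => -t) (Ico 0 δ) (Iic 0) := fun t ht => by
    simpa using ht.1
  have h1' : HasDerivWithinAt (fun t : ℝ => u (x + t • outwardNormal Ω x)) (-κ) (Iic 0) (-0) := by
    simpa using h1
  have h4 := h1'.comp (0 : ℝ) h2 h3
  simpa [Function.comp_def] using h4

theorem eventually_inward {x : Euc n} {φ : Euc n → ℝ} (hφ : IsDefiningFunctionAt Ω x φ) :
    ∀ᶠ t in 𝓝[>] (0 : ℝ), x + t • -outwardNormal Ω x ∈ Ω := by
  refine hφ.eventually_add_smul_mem ?_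
  have hne := hφ.gradient_ne_zero
  rw [outwardNormal_eq hφ]
  nth_rewrite 1 [gradient_eq_smul_unitNormalField hne]
  rw [inner_neg_right, real_inner_smul_left, real_inner_self_eq_norm_sq, norm_unitNormalField hne]
  have := norm_pos_iff.2 hne
  linarith

/-- The inward derivative at a zero of a function positive inside is nonnegative, which fixes the
sign of `κ`. -/
theorem IsBoundedSolution.kappa_pos {x : Euc n} {φ : Euc n → ℝ}
    (hu : IsBoundedSolution Ω f κ u) (hφ : IsDefiningFunctionAt Ω x φ) (hx : x ∈ frontier Ω)
    (hκ : κ ≠ 0) : 0 < κ := by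
  obtain ⟨δ, hδ, hδ'⟩ := mem_nhdsGT_iff_exists_Ioo_subset.1 (eventually_inward hφ)
  have h1 := (hu.neumann_inward hx δ).neg
  have h2 := deriv_nonpos_of_eventually_le hδ h1 fun t ht => by
    simpa [hu.dirichlet x hx] using (hu.positive _ (hδ' ht)).le
  exact lt_of_le_of_ne (by linarith) hκ.symm

/-- On the boundary the gradient of `u` is `-κν`: its length is at most `κ` by the bound on `P`. -/
theorem IsBoundedSolution.boundary_gradient {x : Euc n} {φ : Euc n → ℝ}
    (hu : IsBoundedSolution Ω f κ u) (h : IsPBoundedSolution Ω f F (κ ^ 2 + 2 * F 0) u)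
    (hφ : IsDefiningFunctionAt Ω x φ) (hx : x ∈ frontier Ω) (hκ : 0 < κ) :
    HasFDerivWithinAt u (innerSL ℝ (κ • -outwardNormal Ω x)) (closure Ω) x ∧
      Tendsto (∇ u) (𝓝[Ω] x) (𝓝 (κ • -outwardNormal Ω x)) := by
  have hxc : x ∈ closure Ω := frontier_subset_closure hx
  have hC : ContDiffWithinAt ℝ ((0 : WithTop ℕ∞) + 1) u (closure Ω) x := by
    simpa using hu.contDiffOn_closure x hxc
  obtain ⟨U, hU, hUs, -, f', hf', hf'c⟩ :=
    (contDiffWithinAt_succ_iff_hasFDerivWithinAt' (by simp)).1 hC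
  rw [insert_eq_of_mem hxc] at hU
  have hxU : x ∈ U := mem_of_mem_nhdsWithin hxc hU
  have hΩU : ∀ᶠ y in 𝓝[Ω] x, y ∈ U := nhdsWithin_mono x subset_closure hU
  have hfd : ∀ᶠ y in 𝓝[Ω] x, f' y = fderiv ℝ u y := by
    filter_upwards [hΩU, self_mem_nhdsWithin] with y hyU hyΩ
    have : HasFDerivAt u (f' y) y := (hf' y hyU).hasFDerivAt
      (mem_of_superset (h.isOpen.mem_nhds hyΩ) subset_closure)
    exact this.fderiv.symm
  have hlim : Tendsto (fun y => fderiv ℝ u y) (𝓝[Ω] x) (𝓝 (f' x)) :=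
    (hf'c.continuousWithinAt.mono_left (nhdsWithin_mono x subset_closure)).congr' hfd
  have hlimg : Tendsto (∇ u) (𝓝[Ω] x) (𝓝 ((InnerProductSpace.toDual ℝ (Euc n)).symm (f' x))) :=
    ((InnerProductSpace.toDual ℝ (Euc n)).symm.continuous.tendsto _).comp hlim
  set g := (InnerProductSpace.toDual ℝ (Euc n)).symm (f' x) with hg
  have hgf : ∀ w, ⟪g, w⟫ = f' x w := fun w => InnerProductSpace.toDual_symm_apply
  have hne : (𝓝[Ω] x).NeBot := mem_closure_iff_nhdsWithin_neBot.1 hxc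
  have hgn : ‖g‖ ≤ κ := by
    have hu0 : Tendsto u (𝓝[Ω] x) (𝓝 0) := by
      have := (h.continuousOn x hxc).mono_left (nhdsWithin_mono x subset_closure)
      rwa [h.dirichlet x hx] at this
    have h1 : Tendsto (fun y => √(κ ^ 2 + 2 * F 0 - 2 * F (u y))) (𝓝[Ω] x) (𝓝 κ) := by
      have := ((continuous_gap (P₀ := κ ^ 2 + 2 * F 0) h.hasDerivAt).sqrt.tendsto 0).comp hu0
      simpa [Function.comp_def, Real.sqrt_sq hκ.le] using this
    refine le_of_tendsto_of_tendsto hlimg.norm h1 ?_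
    filter_upwards [self_mem_nhdsWithin] with y hy using h.norm_gradient_le hy
  have hν := norm_outwardNormal hφ
  have hdir : ⟪g, -outwardNormal Ω x⟫ = κ := by
    obtain ⟨δ, hδ, -, h2⟩ := hasDerivWithinAt_line_of_inward hxc (hf' x hxU) (eventually_inward hφ)
    have h3 := hu.neumann_inward hx δ
    rw [hgf]
    exact ((uniqueDiffOn_Ico 0 δ).uniqueDiffWithinAt ⟨le_rfl, hδ⟩).eq_deriv _ h2 h3
  -- Equality in Cauchy–Schwarz: `‖g‖ ≤ κ`, while the component of `g` along the unit vector `-ν` is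
  -- already `κ`.
  have hgeq : g = κ • -outwardNormal Ω x := by
    rw [← sub_eq_zero, ← norm_eq_zero, ← sq_eq_zero_iff]
    refine le_antisymm ?_ (sq_nonneg _)
    rw [norm_sub_sq_real, inner_smul_right, hdir, norm_smul, norm_neg, hν, Real.norm_eq_abs,
      abs_of_pos hκ, mul_one]
    nlinarith [norm_nonneg g]
  rw [← hgeq]
  refine ⟨?_, hlimg⟩
  refine (hf' x hxU).congr_fderiv ?_
  ext w
  simpa using (hgf w).symm

end Boundary

/-! ### Curvature inequality by comparison at the boundary -/

/-- The data of the problem near a boundary point `p`. -/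
structure IsBoundaryData {n : ℕ} (Ω : Set (Euc n)) (f F : ℝ → ℝ) (κ : ℝ) (u : Euc n → ℝ)
    (p e : Euc n) (B : Euc n →L[ℝ] Euc n) (M : ℝ) : Prop where
  solution : IsPBoundedSolution Ω f F (κ ^ 2 + 2 * F 0) u
  model : IsSecondOrderModel Ω p e B
  kappa_pos : 0 < κ
  mem_frontier : p ∈ frontier Ω
  M_pos : 0 < M
  gap_pos : ∀ r ∈ Ico 0 M, 0 < κ ^ 2 + 2 * F 0 - 2 * F r
  hasFDerivWithinAt : ∀ᶠ x in 𝓝 p, x ∈ frontier Ω →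
    HasFDerivWithinAt u (innerSL ℝ (κ • -outwardNormal Ω x)) (closure Ω) x
  tendsto_gradient : Tendsto (∇ u) (𝓝[Ω] p) (𝓝 (κ • e))

namespace IsBoundaryData

variable {n : ℕ} {Ω : Set (Euc n)} {f F : ℝ → ℝ} {κ : ℝ} {u : Euc n → ℝ} {p e : Euc n}
  {B : Euc n →L[ℝ] Euc n} {M : ℝ}

theorem nonneg (h : IsBoundaryData Ω f F κ u p e B M) {x : Euc n} (hx : x ∈ closure Ω) :
    0 ≤ u x := by
  by_cases hxΩ : x ∈ Ω
  · exact (h.solution.positive x hxΩ).le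
  · rw [h.solution.dirichlet x (by rw [h.solution.isOpen.frontier_eq]; exact ⟨hx, hxΩ⟩)]

theorem tendsto_zero (h : IsBoundaryData Ω f F κ u p e B M) :
    Tendsto u (𝓝[closure Ω] p) (𝓝 0) := by
  have := h.solution.continuousOn p (frontier_subset_closure h.mem_frontier)
  rwa [ContinuousWithinAt, h.solution.dirichlet p h.mem_frontier] at this

theorem eventually_lt (h : IsBoundaryData Ω f F κ u p e B M) :
    ∀ᶠ x in 𝓝 p, x ∈ closure Ω → u x < M :=
  eventually_nhdsWithin_iff.1 (h.tendsto_zero.eventually_lt_const h.M_pos)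

theorem tendsto_sqrt_gap (h : IsBoundaryData Ω f F κ u p e B M) :
    Tendsto (fun x => √(κ ^ 2 + 2 * F 0 - 2 * F (u x))) (𝓝[Ω] p) (𝓝 κ) := by
  have h1 := h.tendsto_zero.mono_left (nhdsWithin_mono p subset_closure)
  have := ((continuous_gap (P₀ := κ ^ 2 + 2 * F 0) h.solution.hasDerivAt).sqrt.tendsto 0).comp h1
  simpa [Function.comp_def, Real.sqrt_sq h.kappa_pos.le] using this

theorem hasDerivAt_profileTime (h : IsBoundaryData Ω f F κ u p e B M) {s : ℝ}
    (hs : s ∈ Ico 0 M) : HasDerivAt (profileTime F (κ ^ 2 + 2 * F 0))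
      (√(κ ^ 2 + 2 * F 0 - 2 * F s))⁻¹ s :=
  _root_.hasDerivAt_profileTime h.solution.hasDerivAt hs.1 fun r hr =>
    h.gap_pos r ⟨hr.1, hr.2.trans_lt hs.2⟩

/-- Going down from a point of the domain near `p` one reaches the boundary. -/
theorem exists_exit (h : IsBoundaryData Ω f F κ u p e B M) :
    ∀ᶠ r in 𝓝[>] (0 : ℝ), ∀ x ∈ closure Ω, ‖x - p‖ ≤ r → ∃ τ ∈ Icc 0 (3 * r),
      x - τ • e ∈ frontier Ω ∧ ∀ t ∈ Ico 0 τ, x - t • e ∈ Ω := by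
  obtain ⟨C, hC, hCb⟩ := h.model.closure_bound
  obtain ⟨ρ, hρ, hρb⟩ := Metric.eventually_nhds_iff_ball.1 hCb
  have hr1 : ∀ᶠ r in 𝓝[>] (0 : ℝ), 0 < r ∧ r < min (ρ / 4) (1 / (8 * C)) :=
    Ioo_mem_nhdsGT (by positivity)
  filter_upwards [hr1] with r ⟨hr, hrm⟩ x hx hxr
  have hrρ : r < ρ / 4 := hrm.trans_le (min_le_left _ _)
  have hrC : r < 1 / (8 * C) := hrm.trans_le (min_le_right _ _)
  rw [lt_div_iff₀ (by positivity)] at hrC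
  have hcont : Continuous fun t : ℝ => x - t • e := by fun_prop
  set A : Set ℝ := Icc 0 (3 * r) ∩ (fun t : ℝ => x - t • e) ⁻¹' Ωᶜ with hA
  have hAc : IsCompact A := isCompact_Icc.inter_right (h.solution.isOpen.isClosed_compl.preimage hcont)
  -- After a descent of `3r` the height over the tangent hyperplane is at most `-2r`, at distance at
  -- most `4r` from `p`. `closure_bound` would need `-16Cr² ≤ -2r`, which `8Cr < 1` excludes.
  have hne : A.Nonempty := by
    refine ⟨3 * r, ⟨by positivity, le_rfl⟩, fun hmem => ?_⟩
    have hn : ‖x - (3 * r) • e - p‖ ≤ 4 * r := by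
      have : x - (3 * r) • e - p = (x - p) - (3 * r) • e := by abel
      rw [this]
      refine (norm_sub_le _ _).trans ?_
      rw [norm_smul, h.model.norm_eq, Real.norm_eq_abs, abs_of_pos (by positivity)]
      linarith
    have h1 := hρb (x - (3 * r) • e) (by
      rw [Metric.mem_ball, dist_eq_norm]; linarith) (subset_closure hmem)
    have h2 : ⟪e, x - (3 * r) • e - p⟫ = ⟪e, x - p⟫ - 3 * r := by
      have : x - (3 * r) • e - p = (x - p) - (3 * r) • e := by abel
      rw [this, inner_sub_right, inner_smul_right, real_inner_self_eq_norm_sq, h.model.norm_eq]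
      ring
    have h3 : ⟪e, x - p⟫ ≤ r := by
      refine (real_inner_le_norm _ _).trans ?_
      rw [h.model.norm_eq, one_mul]
      exact hxr
    have h4 : ‖x - (3 * r) • e - p‖ ^ 2 ≤ (4 * r) ^ 2 := by gcongr
    nlinarith
  obtain ⟨τ, hτA, hτ⟩ := hAc.exists_isLeast hne
  have hin : ∀ t ∈ Ico 0 τ, x - t • e ∈ Ω := by
    intro t ht
    by_contra hn
    exact absurd (hτ ⟨⟨ht.1, ht.2.le.trans hτA.1.2⟩, hn⟩) (not_le.2 ht.2)
  refine ⟨τ, hτA.1, ?_, hin⟩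
  rw [h.solution.isOpen.frontier_eq]
  refine ⟨?_, hτA.2⟩
  rcases eq_or_lt_of_le hτA.1.1 with h0 | h0
  · simpa [← h0] using hx
  · have h1 : Tendsto (fun t : ℝ => x - t • e) (𝓝[<] τ) (𝓝 (x - τ • e)) :=
      (hcont.tendsto τ).mono_left nhdsWithin_le_nhds
    refine mem_closure_of_tendsto h1 ?_
    filter_upwards [Ioo_mem_nhdsLT h0] with t ht using hin t ⟨ht.1.le, ht.2⟩

set_option maxHeartbeats 1000000 in
/-- Integrating a bound for the derivative in the direction `e` from the boundary. -/
theorem profileTime_le (h : IsBoundaryData Ω f F κ u p e B M) {c C : ℝ} (hc : 0 ≤ c) (hC : 0 ≤ C)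
    (hG : ∀ᶠ x in 𝓝[Ω] p, ⟪∇ u x, e⟫ ≤ √(κ ^ 2 + 2 * F 0 - 2 * F (u x)) *
      (1 - c * (⟪e, x - p⟫ - C * ‖x - p‖ ^ 2))) {ε : ℝ} (hε : 0 < ε) :
    ∀ᶠ r in 𝓝[>] (0 : ℝ), ∀ x ∈ closure Ω, ‖x - p‖ ≤ r →
      profileTime F (κ ^ 2 + 2 * F 0) (u x) ≤ ⟪e, x - p⟫ - ⟪B (x - p), x - p⟫ / 2 -
        c / 2 * ⟪e, x - p⟫ ^ 2 + ε * r ^ 2 := by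
  obtain ⟨C₂, hC₂, hfb⟩ := h.model.frontier_bound
  obtain ⟨ρ, hρ, hρb⟩ := Metric.eventually_nhds_iff_ball.1
    (((eventually_nhdsWithin_iff.1 hG).and h.eventually_lt).and
      (hfb.and (h.model.frontier_approx (ε / 32) (by positivity))))
  set E := 256 * C₂ ^ 2 + 512 * C * C₂ + 32 * C with hE
  have hE0 : 0 ≤ E := by positivity
  have hr1 : ∀ᶠ r in 𝓝[>] (0 : ℝ), 0 < r ∧ r < min (min (ρ / 4) 1) (ε / (c * E + 1)) :=
    Ioo_mem_nhdsGT (by positivity)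
  filter_upwards [hr1, h.exists_exit] with r ⟨hr, hrm⟩ hexit x hx hxr
  have hrρ : r < ρ / 4 := hrm.trans_le ((min_le_left _ _).trans (min_le_left _ _))
  have hr1 : r < 1 := hrm.trans_le ((min_le_left _ _).trans (min_le_right _ _))
  have hrE : r < ε / (c * E + 1) := hrm.trans_le (min_le_right _ _)
  rw [lt_div_iff₀ (by positivity)] at hrE
  obtain ⟨τ, hτ, hτf, hτΩ⟩ := hexit x hx hxr
  have hee : ⟪e, e⟫ = 1 := by rw [real_inner_self_eq_norm_sq, h.model.norm_eq, one_pow]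
  set z := x - τ • e with hz
  set s := ⟪e, x - p⟫ with hs
  set s' := ⟪e, z - p⟫ with hs'
  have hss : s' = s - τ := by
    have : z - p = (x - p) - τ • e := by rw [hz]; abel
    rw [hs', this, inner_sub_right, inner_smul_right, hee, mul_one]
  have hball : ∀ t ∈ Icc 0 τ, ‖z + t • e - p‖ ≤ 4 * r := by
    intro t ht
    have : z + t • e - p = (x - p) - (τ - t) • e := by rw [hz, sub_smul]; abel
    rw [this]
    refine (norm_sub_le _ _).trans ?_
    rw [norm_smul, h.model.norm_eq, Real.norm_eq_abs, abs_of_nonneg (by linarith [ht.2])]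
    linarith [ht.1, hτ.2]
  have hballρ : ∀ t ∈ Icc 0 τ, z + t • e ∈ Metric.ball p ρ := fun t ht => by
    rw [Metric.mem_ball, dist_eq_norm]; linarith [hball t ht]
  have hmem : ∀ t ∈ Ioc 0 τ, z + t • e ∈ Ω := by
    intro t ht
    have heq : z + t • e = x - (τ - t) • e := by rw [hz, sub_smul]; abel
    rw [heq]
    exact hτΩ (τ - t) ⟨by linarith [ht.2], by linarith [ht.1]⟩
  have hmemc : ∀ t ∈ Icc 0 τ, z + t • e ∈ closure Ω := by
    intro t ht
    rcases eq_or_lt_of_le ht.1 with h0 | h0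
    · simpa [← h0] using frontier_subset_closure hτf
    · exact subset_closure (hmem t ⟨h0, ht.2⟩)
  have huM : ∀ t ∈ Icc 0 τ, u (z + t • e) ∈ Ico 0 M := fun t ht =>
    ⟨h.nonneg (hmemc t ht), (hρb _ (hballρ t ht)).1.2 (hmemc t ht)⟩
  set D := C * (4 * r) ^ 2 with hD
  -- `D` bounds `C‖· - p‖²` along the segment, so `hG` makes `k` nonincreasing. Comparing its ends
  -- gives `w x ≤ τ + c/2 ((s' - D)² - (s - D)²)` with `τ = s - s'`, and `s'` is the boundary
  -- height.
  set k : ℝ → ℝ := fun t => profileTime F (κ ^ 2 + 2 * F 0) (u (z + t • e)) - t +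
    c / 2 * (s' + t - D) ^ 2 with hk
  have hline : Continuous fun t : ℝ => z + t • e := by fun_prop
  have hkc : ContinuousOn k (Icc 0 τ) := by
    refine ContinuousOn.add (ContinuousOn.sub ?_ continuousOn_id) (by fun_prop)
    have h1 : ContinuousOn (fun t : ℝ => u (z + t • e)) (Icc 0 τ) :=
      h.solution.continuousOn.comp hline.continuousOn fun t ht => hmemc t ht
    intro t ht
    exact ContinuousAt.comp_continuousWithinAt (f := fun t : ℝ => u (z + t • e)) (x := t)
      (h.hasDerivAt_profileTime (huM t ht)).continuousAt (h1 t ht)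
  have hkd : ∀ t ∈ Ioo 0 τ, ∃ k', HasDerivAt k k' t ∧ k' ≤ 0 := by
    intro t ht
    have ht' : t ∈ Icc 0 τ := ⟨ht.1.le, ht.2.le⟩
    have htΩ : z + t • e ∈ Ω := hmem t ⟨ht.1, ht.2.le⟩
    have h1 := (h.hasDerivAt_profileTime (huM t ht')).comp t
      (hasDerivAt_line (h.solution.differentiableAt htΩ))
    have h2 : HasDerivAt (fun t : ℝ => c / 2 * (s' + t - D) ^ 2) (c * (s' + t - D)) t := by
      have := ((((hasDerivAt_id t).const_add s').sub_const D).pow 2).const_mul (c / 2)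
      refine this.congr_deriv ?_
      simp
      ring
    refine ⟨_, (h1.sub (hasDerivAt_id t)).add h2, ?_⟩
    have h3 := (hρb _ (hballρ t ht')).1.1 htΩ
    have hg : 0 < √(κ ^ 2 + 2 * F 0 - 2 * F (u (z + t • e))) :=
      Real.sqrt_pos.2 (h.gap_pos _ (huM t ht'))
    rw [inner_gradient_left] at h3
    have h4 : (√(κ ^ 2 + 2 * F 0 - 2 * F (u (z + t • e))))⁻¹ * fderiv ℝ u (z + t • e) e ≤
        1 - c * (⟪e, z + t • e - p⟫ - C * ‖z + t • e - p‖ ^ 2) := by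
      rw [inv_mul_le_iff₀ hg]
      exact h3
    have h5 : ⟪e, z + t • e - p⟫ = s' + t := by
      have : z + t • e - p = (z - p) + t • e := by abel
      rw [this, inner_add_right, inner_smul_right, hee, mul_one]
    have h6 : C * ‖z + t • e - p‖ ^ 2 ≤ D := by
      have := hball t ht'
      rw [hD]; gcongr
    have h7 := mul_le_mul_of_nonneg_left h6 hc
    rw [h5] at h4
    linarith
  have hanti : AntitoneOn k (Icc 0 τ) := by
    refine antitoneOn_of_deriv_nonpos (convex_Icc 0 τ) hkc ?_ ?_ <;> rw [interior_Icc] <;>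
      intro t ht <;> obtain ⟨k', hk', hk0⟩ := hkd t ht
    · exact hk'.differentiableAt.differentiableWithinAt
    · rw [hk'.deriv]; exact hk0
  have hfin := hanti ⟨le_rfl, hτ.1⟩ ⟨hτ.1, le_rfl⟩ hτ.1
  have hx0 : z + τ • e = x := by rw [hz]; abel
  simp only [hk, hx0, zero_smul, add_zero, h.solution.dirichlet z hτf, profileTime_zero,
    sub_zero, zero_add] at hfin
  have hzb : ‖z - p‖ ≤ 4 * r := by simpa using hball 0 ⟨le_rfl, hτ.1⟩
  have hz2 : ‖z - p‖ ^ 2 ≤ 16 * r ^ 2 := by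
    calc ‖z - p‖ ^ 2 ≤ (4 * r) ^ 2 := by gcongr
      _ = _ := by ring
  have hzρ : z ∈ Metric.ball p ρ := by simpa using hballρ 0 ⟨le_rfl, hτ.1⟩
  have hfz := (hρb z hzρ).2.2 hτf
  have hbz := (hρb z hzρ).2.1 hτf
  have hB : ⟪B (z - p), z - p⟫ = ⟪B (x - p), x - p⟫ := by
    have : x - p = (z - p) + τ • e := by rw [hz]; abel
    rw [this, h.model.form_add_smul]
  rw [hB] at hfz
  have hs1 : |s| ≤ r := by
    refine (abs_real_inner_le_norm _ _).trans ?_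
    rw [h.model.norm_eq, one_mul]
    exact hxr
  have hs2 : |s'| ≤ 16 * C₂ * r ^ 2 := hbz.trans (by nlinarith)
  have hs3 : ⟪B (x - p), x - p⟫ / 2 - ε / 2 * r ^ 2 ≤ s' := by
    have := (abs_le.1 hfz).1
    nlinarith
  have hr4 : r ^ 4 ≤ r ^ 3 := pow_le_pow_of_le_one hr.le hr1.le (by norm_num)
  -- Both `s'` and `D` are of order `r²`, so every term except `-s²` is at most of order `r³`.
  have hmain : (s' - D) ^ 2 - (s - D) ^ 2 ≤ -s ^ 2 + E * r ^ 3 := by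
    have h1 : s' ^ 2 ≤ 256 * C₂ ^ 2 * r ^ 4 := by
      rw [← sq_abs]
      calc |s'| ^ 2 ≤ (16 * C₂ * r ^ 2) ^ 2 := by gcongr
        _ = _ := by ring
    have h2 : -(2 * D * s') ≤ 512 * C * C₂ * r ^ 4 := by
      have : -s' ≤ 16 * C₂ * r ^ 2 := (neg_le_abs s').trans hs2
      have h0 : 0 ≤ 2 * D := by positivity
      calc -(2 * D * s') = 2 * D * -s' := by ring
        _ ≤ 2 * D * (16 * C₂ * r ^ 2) := by gcongr
        _ = _ := by rw [hD]; ring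
    have h3 : 2 * D * s ≤ 32 * C * r ^ 3 := by
      have : s ≤ r := (le_abs_self s).trans hs1
      have h0 : 0 ≤ 2 * D := by positivity
      calc 2 * D * s ≤ 2 * D * r := by gcongr
        _ = _ := by rw [hD]; ring
    have h4 : (256 * C₂ ^ 2 + 512 * C * C₂) * r ^ 4 ≤ (256 * C₂ ^ 2 + 512 * C * C₂) * r ^ 3 := by
      gcongr
    have h5 : (s' - D) ^ 2 - (s - D) ^ 2 = s' ^ 2 + -(2 * D * s') - s ^ 2 + 2 * D * s := by ring
    rw [h5, hE]
    linarith
  have h8 := mul_le_mul_of_nonneg_left hmain (by positivity : 0 ≤ c / 2)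
  rw [show s' + τ = s by linarith] at hfin
  have h9 : c / 2 * (E * r ^ 3) ≤ ε / 2 * r ^ 2 := by
    have : c * E * r ≤ ε := by nlinarith
    calc c / 2 * (E * r ^ 3) = (c * E * r) / 2 * r ^ 2 := by ring
      _ ≤ _ := by gcongr
  linarith

end IsBoundaryData

namespace IsBoundaryData

variable {n : ℕ} {Ω : Set (Euc n)} {f F : ℝ → ℝ} {κ : ℝ} {u : Euc n → ℝ} {p e : Euc n}
  {B : Euc n →L[ℝ] Euc n} {M : ℝ}

/-- Second derivatives of `profileTime ∘ u`; its Laplacian tends to zero at the boundary. -/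
theorem exists_laplacian_profileTime (h : IsBoundaryData Ω f F κ u p e B M) {δ : ℝ} (hδ : 0 < δ) :
    ∀ᶠ x in 𝓝[Ω] p, ∃ W : Fin n → ℝ, -δ ≤ ∑ i, W i ∧ ∀ i, ∃ a,
      HasLineDerivTwo (fun z => profileTime F (κ ^ 2 + 2 * F 0) (u z)) x (stdVec i) a (W i) := by
  have h1 := h.tendsto_sqrt_gap
  have h2 := h.tendsto_gradient.norm
  rw [norm_smul, h.model.norm_eq, mul_one, Real.norm_eq_abs, abs_of_pos h.kappa_pos] at h2
  have h3 : Tendsto (fun x => f (u x)) (𝓝[Ω] p) (𝓝 (f 0)) :=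
    (h.solution.continuous.tendsto 0).comp
      (h.tendsto_zero.mono_left (nhdsWithin_mono p subset_closure))
  -- This is `Δ(profileTime ∘ u)` with `Δu` replaced by `-f(u)`. Both terms tend to `f 0 / κ`, since
  -- `|∇u|` and the root of the gap have the same limit `κ`.
  have h4 : Tendsto (fun x => f (u x) / √(κ ^ 2 + 2 * F 0 - 2 * F (u x)) ^ 3 * ‖∇ u x‖ ^ 2 -
      (√(κ ^ 2 + 2 * F 0 - 2 * F (u x)))⁻¹ * f (u x)) (𝓝[Ω] p) (𝓝 0) := by
    have hκ := h.kappa_pos.ne'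
    have := ((h3.div (h1.pow 3) (pow_ne_zero 3 hκ)).mul (h2.pow 2)).sub ((h1.inv₀ hκ).mul h3)
    have h0 : f 0 / κ ^ 3 * κ ^ 2 - κ⁻¹ * f 0 = 0 := by field_simp; ring
    rw [h0] at this
    exact this
  have h5 : ∀ᶠ x in 𝓝[Ω] p, u x < M :=
    (h.tendsto_zero.mono_left (nhdsWithin_mono p subset_closure)).eventually_lt_const h.M_pos
  filter_upwards [h4.eventually_const_le (neg_neg_of_pos hδ), h5, self_mem_nhdsWithin]
    with x hx hxM hxΩ
  have hsol := h.solution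
  have hux := hsol.positive x hxΩ
  have hu2 : ContDiffAt ℝ 2 u x := (hsol.contDiffAt hxΩ).of_le (by norm_num)
  have hev : ∀ᶠ s in 𝓝 (u x), HasDerivAt (profileTime F (κ ^ 2 + 2 * F 0))
      ((√(κ ^ 2 + 2 * F 0 - 2 * F s))⁻¹) s := by
    filter_upwards [Ioo_mem_nhds hux hxM] with s hs
    exact h.hasDerivAt_profileTime ⟨hs.1.le, hs.2⟩
  have hd2 := hasDerivAt_inv_sqrt_gap hsol.hasDerivAt (h.gap_pos _ ⟨hux.le, hxM⟩)
  have hx0 : ∀ i : Fin n, x + (0 : ℝ) • stdVec i = x := fun i => by simp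
  refine ⟨fun i => _, ?_, fun i => ⟨_, HasDerivTwo.comp (by rw [hx0]; exact hev)
    (by rw [hx0]; exact hd2) (hu2.hasLineDerivTwo (stdVec i))⟩⟩
  simp only [hx0]
  rw [Finset.sum_add_distrib, ← Finset.mul_sum, ← Finset.mul_sum, ← norm_gradient_sq,
    ← laplacian_eq_sum u x (EuclideanSpace.basisFun (Fin n) ℝ)]
  have : Laplacian.laplacian u x = -f (u x) := by linarith [hsol.equation x hxΩ]
  rw [this]
  linarith

/-- Comparison with a quadratic barrier: an upper bound for `profileTime ∘ u` to second order gives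
an upper bound for the mean curvature. -/
theorem meanCurvature_add_le (h : IsBoundaryData Ω f F κ u p e B M) {c : ℝ} (hc : 0 ≤ c)
    (hW : ∀ ε > 0, ∀ᶠ r in 𝓝[>] (0 : ℝ), ∀ x ∈ closure Ω, ‖x - p‖ ≤ r →
      profileTime F (κ ^ 2 + 2 * F 0) (u x) ≤ ⟪e, x - p⟫ - ⟪B (x - p), x - p⟫ / 2 -
        c / 2 * ⟪e, x - p⟫ ^ 2 + ε * r ^ 2) :
    ((n : ℝ) - 1) * meanCurvature Ω p + c ≤ 0 := by
  by_contra! hθ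
  set θ := ((n : ℝ) - 1) * meanCurvature Ω p + c with hθd
  set β := θ / (8 * (n + 1)) with hβ
  have hβpos : 0 < β := by positivity
  have hβn : 2 * n * β ≤ θ / 4 := by
    rw [hβ, mul_div_assoc', div_le_div_iff₀ (by positivity) (by norm_num)]
    nlinarith
  have hee : ⟪e, e⟫ = 1 := by rw [real_inner_self_eq_norm_sq, h.model.norm_eq, one_pow]
  obtain ⟨C, hC, hfb⟩ := h.model.frontier_bound
  obtain ⟨ρ, hρ, hρb⟩ := Metric.eventually_nhds_iff_ball.1
    (((hfb.and (h.model.normal_approx (β / 8) (by positivity))).and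
      (h.model.inward.and h.hasFDerivWithinAt)).and
      (h.eventually_lt.and (eventually_nhdsWithin_iff.1
        (h.exists_laplacian_profileTime (by positivity : 0 < θ / 4)))))
  have hr1 : ∀ᶠ r in 𝓝[>] (0 : ℝ), 0 < r ∧ r < min ρ (β / 8 / ((2 * β + c) * C)) :=
    Ioo_mem_nhdsGT (by positivity)
  obtain ⟨r, ⟨hr, hrm⟩, hWr⟩ := (hr1.and (hW (β / 4) (by positivity))).exists
  have hrρ : r < ρ := hrm.trans_le (min_le_left _ _)
  have hrC : r < β / 8 / ((2 * β + c) * C) := hrm.trans_le (min_le_right _ _)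
  rw [lt_div_iff₀ (by positivity)] at hrC
  set w : Euc n → ℝ := fun x => profileTime F (κ ^ 2 + 2 * F 0) (u x) with hw
  -- To the negative of the second order bound two terms are added: `-β‖x - p‖²` makes `w + q`
  -- negative on the sphere of radius `r`, and the tilt `(β/2) r ⟪e, x - p⟫` excludes boundary
  -- maxima. On the sphere the total is at most `(β/4 - β + β/2) r² < 0`.
  set q : Euc n → ℝ := fun x => -⟪e, x - p⟫ + ⟪B (x - p), x - p⟫ / 2 - β * ‖x - p‖ ^ 2 +
    c / 2 * ⟪e, x - p⟫ ^ 2 + β / 2 * r * ⟪e, x - p⟫ with hq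
  have hqc : Continuous q := by fun_prop
  set K := closure Ω ∩ Metric.closedBall p r with hK
  have hball : ∀ x ∈ K, x ∈ Metric.ball p ρ := fun x hx =>
    Metric.closedBall_subset_ball hrρ hx.2
  have hwc : ContinuousOn w K := by
    have h1 : ContinuousOn u K := h.solution.continuousOn.mono inter_subset_left
    intro x hx
    exact ContinuousAt.comp_continuousWithinAt (f := u) (x := x) (h.hasDerivAt_profileTime
      ⟨h.nonneg hx.1, (hρb x (hball x hx)).2.1 hx.1⟩).continuousAt (h1 x hx)
  have hKc : IsCompact K := (isCompact_closedBall p r).inter_left isClosed_closure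
  have hpK : p ∈ K := ⟨frontier_subset_closure h.mem_frontier, Metric.mem_closedBall_self hr.le⟩
  obtain ⟨z, hzK, hz⟩ := hKc.exists_isMaxOn ⟨p, hpK⟩ (hwc.add hqc.continuousOn)
  have hzle : ∀ x ∈ K, w x + q x ≤ w z + q z := fun x hx => hz hx
  have hwp : w p + q p = 0 := by
    simp [hw, hq, h.solution.dirichlet p h.mem_frontier, profileTime_zero]
  have hz0 : 0 ≤ w z + q z := hwp ▸ hzle p hpK
  have hzr' : ‖z - p‖ ≤ r := by simpa [dist_eq_norm] using hzK.2
  have hsz : ⟪e, z - p⟫ ≤ r := by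
    refine (real_inner_le_norm _ _).trans ?_
    rw [h.model.norm_eq, one_mul]
    exact hzr'
  have hzr : ‖z - p‖ < r := by
    refine lt_of_le_of_ne hzr' fun h0 => ?_
    have h1 := hWr z hzK.1 hzr'
    simp only [hw, hq, h0] at hz0
    have h2 : β / 2 * r * ⟪e, z - p⟫ ≤ β / 2 * r * r := by gcongr
    nlinarith [mul_pos hβpos (pow_pos hr 2)]
  have hzρ := hball z hzK
  have hzb : ∀ᶠ x in 𝓝 z, x ∈ Metric.closedBall p r :=
    mem_of_superset (Metric.isOpen_ball.mem_nhds (by simpa [dist_eq_norm] using hzr))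
      Metric.ball_subset_closedBall
  by_cases hzΩ : z ∈ Ω
  -- At an interior maximum the sum of the second derivatives is at least `θ - θ/4 - θ/4 > 0`.
  · obtain ⟨W, hWs, hWi⟩ := (hρb z hzρ).2.2 hzΩ
    have hloc : IsLocalMax (fun x => w x + q x) z := by
      filter_upwards [hzb, h.solution.isOpen.mem_nhds hzΩ] with x hx1 hx2
      exact hzle x ⟨subset_closure hx2, hx1⟩
    have hi : ∀ i, W i + (⟪B (stdVec i), stdVec i⟫ - 2 * β + c * ⟪e, stdVec i⟫ ^ 2) ≤ 0 := by
      intro i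
      obtain ⟨a, ha⟩ := hWi i
      have hq2 : HasLineDerivTwo q z (stdVec i) (-⟪e, stdVec i⟫ +
          (⟪B (z - p), stdVec i⟫ + ⟪B (stdVec i), z - p⟫) / 2 - 2 * β * ⟪z - p, stdVec i⟫ +
          c * (⟪e, z - p⟫ * ⟪e, stdVec i⟫) + β / 2 * r * ⟪e, stdVec i⟫)
          (2 * (⟪B (stdVec i), stdVec i⟫ / 2 - β + c / 2 * ⟪e, stdVec i⟫ ^ 2)) := by
        refine (HasDerivTwo.quadratic (q z) _ _).congr (Eventually.of_forall fun t => ?_)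
        have h1 : z + t • stdVec i - p = (z - p) + t • stdVec i := by abel
        simp only [hq, h1, inner_add_right, inner_add_left, inner_smul_right, map_add, map_smul,
          real_inner_smul_left, norm_add_sq_real, norm_smul, norm_stdVec, Real.norm_eq_abs,
          mul_one, sq_abs]
        ring
      have h2 := HasDerivTwo.add ha hq2
      have h3 := HasLineDerivTwo.nonpos_of_isLocalMax (v := fun x => w x + q x) h2 hloc
      linarith
    have hsum := Finset.sum_nonpos fun i (_ : i ∈ Finset.univ) => hi i
    rw [Finset.sum_add_distrib, Finset.sum_add_distrib, Finset.sum_sub_distrib, h.model.sum_eq,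
      ← Finset.mul_sum (f := fun i => ⟪e, stdVec i⟫ ^ 2), sum_inner_stdVec_sq,
      h.model.norm_eq] at hsum
    simp only [Finset.sum_const, Finset.card_univ, Fintype.card_fin, nsmul_eq_mul] at hsum
    nlinarith
  -- At a boundary maximum the derivative in the direction `e` would be nonpositive; the tilt
  -- contributes `βr/2`, and the errors in the normal and in the height cost at most `βr/8` each.
  · have hzf : z ∈ frontier Ω := by
      rw [h.solution.isOpen.frontier_eq]; exact ⟨hzK.1, hzΩ⟩
    have hux : u z = 0 := h.solution.dirichlet z hzf
    obtain ⟨⟨⟨hb1, hb2⟩, hb3, hb4⟩, -⟩ := hρb z hzρ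
    specialize hb1 hzf
    specialize hb2 hzf
    obtain ⟨δ, hδ, hδΩ, hδd⟩ := hasDerivWithinAt_line_of_inward hzK.1 (hb4 hzf) (hb3 hzf)
    obtain ⟨δ', hδ', hδb⟩ := mem_nhdsGE_iff_exists_Ico_subset.1
      (mem_nhdsWithin_of_mem_nhds ((tendsto_line z e).eventually hzb) :
        {t : ℝ | z + t • e ∈ Metric.closedBall p r} ∈ 𝓝[≥] (0 : ℝ))
    have hδ'0 : 0 < δ' := hδ'
    have hsub : Ico 0 (min δ δ') ⊆ Ico 0 δ := Ico_subset_Ico_right (min_le_left _ _)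
    set α := ⟪-outwardNormal Ω z, e⟫ with hα
    have hwd : HasDerivWithinAt (fun t : ℝ => w (z + t • e)) α (Ico 0 (min δ δ')) 0 := by
      have h1 : HasDerivAt (profileTime F (κ ^ 2 + 2 * F 0)) κ⁻¹ (u (z + (0 : ℝ) • e)) := by
        have := h.hasDerivAt_profileTime (s := 0) ⟨le_rfl, h.M_pos⟩
        simpa [hux, Real.sqrt_sq h.kappa_pos.le] using this
      have h2 := h1.comp_hasDerivWithinAt (0 : ℝ) (hδd.mono hsub)
      refine h2.congr_deriv ?_
      rw [innerSL_apply_apply, real_inner_smul_left, inv_mul_cancel_left₀ h.kappa_pos.ne']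
    have hqd : HasDerivAt (fun t : ℝ => q (z + t • e))
        (-1 - 2 * β * ⟪e, z - p⟫ + c * ⟪e, z - p⟫ + β / 2 * r) 0 := by
      refine ((HasDerivTwo.quadratic (q z) _ (-β + c / 2)).congr
        (Eventually.of_forall fun t => ?_)).hasDerivAt
      have h1 : z + t • e - p = (z - p) + t • e := by abel
      simp only [hq, h1, h.model.form_add_smul, inner_add_right, inner_smul_right, hee,
        norm_add_sq_real, norm_smul, h.model.norm_eq, Real.norm_eq_abs, mul_one, sq_abs,
        real_inner_comm e (z - p)]
      ring
    have hle := deriv_nonpos_of_eventually_le (lt_min hδ hδ'0) (hwd.add hqd.hasDerivWithinAt)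
      fun t ht => by
        have h1 := hzle (z + t • e) ⟨subset_closure (hδΩ t ⟨ht.1, ht.2.trans_le (min_le_left _ _)⟩),
          hδb ⟨ht.1.le, ht.2.trans_le (min_le_right _ _)⟩⟩
        simpa using h1
    have h5 : |⟪e, z - p⟫| ≤ C * r * r := by
      refine hb1.trans ?_
      have : ‖z - p‖ ^ 2 ≤ r ^ 2 := by gcongr
      nlinarith
    have h6 : |(2 * β - c) * ⟪e, z - p⟫| ≤ β / 8 * r := by
      rw [abs_mul]
      have : |2 * β - c| ≤ 2 * β + c := abs_le.2 ⟨by linarith, by linarith⟩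
      calc |2 * β - c| * |⟪e, z - p⟫| ≤ (2 * β + c) * (C * r * r) := by gcongr
        _ = (r * ((2 * β + c) * C)) * r := by ring
        _ ≤ β / 8 * r := by gcongr
    have h7 := (abs_le.1 h6).2
    have h8 : β / 8 * ‖z - p‖ ≤ β / 8 * r := by gcongr
    have h9 : 0 < β * r := by positivity
    linarith

end IsBoundaryData

/-! ### From a strip to a half-space or a slab -/

theorem HasLineDerivTwo.eq_fderiv {n : ℕ} {v : Euc n → ℝ} {x e : Euc n} {a b : ℝ}
    (h : HasLineDerivTwo v x e a b) (hv : DifferentiableAt ℝ v x) : a = fderiv ℝ v x e := by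
  have hx : x + (0 : ℝ) • e = x := by simp
  have h1 := hasDerivAt_line (v := v) (x := x) (e := e) (t := 0) (by rw [hx]; exact hv)
  rw [hx] at h1
  exact (HasDerivTwo.hasDerivAt h).unique h1

/-- The height at which the profile stops: either the gap vanishes there or it is not attained. -/
theorem exists_height {f F : ℝ → ℝ} {P₀ A : ℝ} (hF : ∀ t, HasDerivAt F (f t) t) (hA : 0 < A)
    (h0 : 0 < P₀ - 2 * F 0) :
    ∃ M > 0, (∀ r ∈ Ico 0 M, 0 < P₀ - 2 * F r) ∧ (P₀ - 2 * F M ≤ 0 ∨ M = A) := by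
  have hc := continuous_gap (P₀ := P₀) hF
  set S : Set ℝ := Icc 0 A ∩ ({r | P₀ - 2 * F r ≤ 0} ∪ {A}) with hS
  have hSc : IsCompact S := isCompact_Icc.inter_right
    ((isClosed_le hc continuous_const).union isClosed_singleton)
  obtain ⟨M, hMS, hM⟩ := hSc.exists_isLeast ⟨A, ⟨hA.le, le_rfl⟩, Or.inr rfl⟩
  refine ⟨M, ?_, fun r hr => ?_, hMS.2⟩
  · refine lt_of_le_of_ne hMS.1.1 fun hM0 => ?_
    rcases hMS.2 with h1 | h1
    · rw [← hM0] at h1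
      exact absurd h0 (not_lt.2 h1)
    · exact hA.ne (hM0.trans h1)
  · by_contra! hle
    exact absurd (hM ⟨⟨hr.1, hr.2.le.trans hMS.1.2⟩, Or.inl hle⟩) (not_le.2 hr.2)

theorem exists_profileTime_eq {f F : ℝ → ℝ} {P₀ M : ℝ} (hF : ∀ t, HasDerivAt F (f t) t)
    (hM : ∀ r ∈ Ico 0 M, 0 < P₀ - 2 * F r) {σ t : ℝ} (hσ : σ ∈ Ico 0 M) (ht : 0 < t)
    (htσ : t < profileTime F P₀ σ) : ∃ τ ∈ Ioo 0 M, profileTime F P₀ τ = t := by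
  have hc : ContinuousOn (profileTime F P₀) (Icc 0 σ) := fun s hs =>
    (hasDerivAt_profileTime hF hs.1 fun r hr =>
      hM r ⟨hr.1, (hr.2.trans hs.2).trans_lt hσ.2⟩).continuousAt.continuousWithinAt
  obtain ⟨τ, hτ, hτt⟩ := intermediate_value_Icc hσ.1 hc
    ⟨by rw [profileTime_zero]; exact ht.le, htσ.le⟩
  refine ⟨τ, ⟨lt_of_le_of_ne hτ.1 ?_, hτ.2.trans_lt hσ.2⟩, hτt⟩
  rintro rfl
  rw [profileTime_zero] at hτt
  exact ht.ne hτt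

namespace IsPBoundedSolution

variable {n : ℕ} {Ω : Set (Euc n)} {f F : ℝ → ℝ} {P₀ M T : ℝ} {u : Euc n → ℝ} {b : Euc n} {c : ℝ}

/-- Just inside the strip `profileTime ∘ u` equals the small distance to the hyperplane, so `u` is
small there; near a point of `Ω`, positivity and continuity bound `u` away from zero. -/
theorem notMem_of_strip (h : IsPBoundedSolution Ω f F P₀ u) (hM0 : 0 < M)
    (hM : ∀ r ∈ Ico 0 M, 0 < P₀ - 2 * F r) {L : ℝ} (hL : 0 < L) (hb : ‖b‖ = 1)
    (hstrip : ∀ x, ⟪b, x⟫ + c ∈ Ioo 0 L →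
      x ∈ Ω ∧ u x < M ∧ profileTime F P₀ (u x) = ⟪b, x⟫ + c)
    {x : Euc n} (hx : ⟪b, x⟫ + c = 0) : x ∉ Ω := by
  intro hxΩ
  have hmono := strictMonoOn_profileTime h.hasDerivAt hM
  have hux := h.positive x hxΩ
  obtain ⟨σ, hσ0, hσ⟩ := exists_between (lt_min hux hM0)
  have hσu := hσ.trans_le (min_le_left _ _)
  have hσM := hσ.trans_le (min_le_right _ _)
  have hσm : σ ∈ Ico 0 M := ⟨hσ0.le, hσM⟩
  have hpos : 0 < profileTime F P₀ σ := by
    have := hmono ⟨le_rfl, hM0⟩ hσm hσ0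
    rwa [profileTime_zero] at this
  have h1 : ∀ᶠ t in 𝓝 (0 : ℝ), σ < u (x + t • b) :=
    (tendsto_line x b).eventually
      ((h.differentiableAt hxΩ).continuousAt.eventually_const_lt hσu)
  have h2 : ∀ᶠ t in 𝓝[>] (0 : ℝ), 0 < t ∧ t < min L (profileTime F P₀ σ) :=
    Ioo_mem_nhdsGT (lt_min hL hpos)
  obtain ⟨t, ht1, ht0, ht2⟩ := ((h1.filter_mono nhdsWithin_le_nhds).and h2).exists
  have hl : ⟪b, x + t • b⟫ + c = t := by
    rw [inner_add_right, inner_smul_right, real_inner_self_eq_norm_sq, hb]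
    linarith
  have h3 := hstrip (x + t • b) (by rw [hl]; exact ⟨ht0, ht2.trans_le (min_le_left _ _)⟩)
  rw [hl] at h3
  have h4 := hmono hσm ⟨(h.positive _ h3.1).le, h3.2.1⟩ ht1
  rw [h3.2.2] at h4
  exact absurd h4 (not_lt.2 (ht2.le.trans (min_le_right _ _)))

theorem profileTime_lt_of_isLUB (h : IsPBoundedSolution Ω f F P₀ u)
    (hM : ∀ r ∈ Ico 0 M, 0 < P₀ - 2 * F r) (hT : IsLUB (profileTime F P₀ '' Ico 0 M) T)
    {σ : ℝ} (hσ : σ ∈ Ico 0 M) : profileTime F P₀ σ < T := by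
  obtain ⟨τ, h1, h2⟩ := exists_between hσ.2
  have hτ : τ ∈ Ico 0 M := ⟨hσ.1.trans h1.le, h2⟩
  exact (strictMonoOn_profileTime h.hasDerivAt hM hσ hτ h1).trans_le (hT.1 ⟨τ, hτ, rfl⟩)

/-- On the far side of a strip of maximal width, `u` takes the height at which the profile stops. -/
theorem eq_height_of_strip (h : IsPBoundedSolution Ω f F P₀ u) (hM0 : 0 < M)
    (hM : ∀ r ∈ Ico 0 M, 0 < P₀ - 2 * F r) (hT : IsLUB (profileTime F P₀ '' Ico 0 M) T)
    (hb : ‖b‖ = 1) (hstrip : ∀ x, ⟪b, x⟫ + c ∈ Ioo 0 T →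
      x ∈ Ω ∧ u x < M ∧ profileTime F P₀ (u x) = ⟪b, x⟫ + c)
    {x : Euc n} (hx : ⟪b, x⟫ + c = T) : x ∈ Ω ∧ u x = M := by
  have hmono := strictMonoOn_profileTime h.hasDerivAt hM
  have hT0 : 0 < T := by
    have := h.profileTime_lt_of_isLUB hM hT ⟨le_rfl, hM0⟩
    rwa [profileTime_zero] at this
  have hl : ∀ t : ℝ, ⟪b, x + t • -b⟫ + c = T - t := fun t => by
    rw [inner_add_right, inner_smul_right, inner_neg_right, real_inner_self_eq_norm_sq, hb]
    linarith
  have hmem : ∀ᶠ t in 𝓝[>] (0 : ℝ), x + t • -b ∈ Ω ∧ u (x + t • -b) < M ∧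
      profileTime F P₀ (u (x + t • -b)) = T - t := by
    filter_upwards [Ioo_mem_nhdsGT hT0] with t ht
    have := hstrip (x + t • -b) (by rw [hl]; exact ⟨by linarith [ht.2], by linarith [ht.1]⟩)
    rwa [hl] at this
  have hline : Tendsto (fun t : ℝ => x + t • -b) (𝓝[>] 0) (𝓝 x) :=
    (tendsto_line x (-b)).mono_left nhdsWithin_le_nhds
  have hxc : x ∈ closure Ω := mem_closure_of_tendsto hline (hmem.mono fun t ht => ht.1)
  have hlim : Tendsto (fun t : ℝ => u (x + t • -b)) (𝓝[>] 0) (𝓝 (u x)) :=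
    (h.continuousOn x hxc).tendsto.comp (tendsto_nhdsWithin_iff.2
      ⟨hline, hmem.mono fun t ht => subset_closure ht.1⟩)
  have huM : u x = M := by
    refine le_antisymm (le_of_tendsto hlim (hmem.mono fun t ht => ht.2.1.le)) ?_
    refine le_of_forall_lt_imp_le_of_dense fun τ hτ => ?_
    rcases lt_or_ge τ 0 with hτ0 | hτ0
    · exact ge_of_tendsto hlim (hmem.mono fun t ht => hτ0.le.trans (h.positive _ ht.1).le)
    · have hτm : τ ∈ Ico 0 M := ⟨hτ0, hτ⟩
      have h1 := sub_pos.2 (h.profileTime_lt_of_isLUB hM hT hτm)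
      refine ge_of_tendsto hlim ?_
      filter_upwards [hmem, Ioo_mem_nhdsGT h1] with t ht ht1
      have h2 : profileTime F P₀ τ < profileTime F P₀ (u (x + t • -b)) := by
        rw [ht.2.2]; linarith [ht1.2]
      exact ((hmono.lt_iff_lt hτm ⟨(h.positive _ ht.1).le, ht.2.1⟩).1 h2).le
  exact ⟨h.mem_of_closure hxc (by rw [huM]; exact hM0.ne'), huM⟩

/-- The bound on `P` limits how fast `u` can descend from the height `M`. -/
theorem profileTime_le_of_descent (h : IsPBoundedSolution Ω f F P₀ u)
    (hM : ∀ r ∈ Ico 0 M, 0 < P₀ - 2 * F r) (hb : ‖b‖ = 1) {x : Euc n} {t₁ : ℝ} (ht₁ : 0 ≤ t₁)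
    (hseg : ∀ t ∈ Icc 0 t₁, x + t • b ∈ Ω) (huM : u (x + t₁ • b) = M) {τ : ℝ}
    (hτ : τ ∈ Ico 0 M) : τ ≤ u x ∨ profileTime F P₀ τ ≤ profileTime F P₀ (u x) + t₁ := by
  by_contra! hcon
  obtain ⟨hτu, hcon⟩ := hcon
  have hmono := strictMonoOn_profileTime h.hasDerivAt hM
  have hline : Continuous fun t : ℝ => x + t • b := by fun_prop
  have huc : ContinuousOn (fun t : ℝ => u (x + t • b)) (Icc 0 t₁) := fun t ht =>
    ContinuousAt.comp_continuousWithinAt (f := fun t : ℝ => x + t • b) (x := t)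
      (h.differentiableAt (hseg t ht)).continuousAt hline.continuousWithinAt
  set A : Set ℝ := Icc 0 t₁ ∩ (fun t : ℝ => u (x + t • b)) ⁻¹' Ici τ with hA
  have hAc : IsCompact A := isCompact_Icc.of_isClosed_subset
    (huc.preimage_isClosed_of_isClosed isClosed_Icc isClosed_Ici) inter_subset_left
  -- At the first time the height `τ` is reached, `u` has stayed below `M` all along, so
  -- `profileTime` could be differentiated; at the height `M` itself it need not be differentiable.
  obtain ⟨t, htA, ht⟩ := hAc.exists_isLeast ⟨t₁, ⟨ht₁, le_rfl⟩, by
    simp only [mem_preimage, huM, mem_Ici]; exact hτ.2.le⟩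
  have hlow : ∀ s ∈ Ico 0 t, u (x + s • b) < τ := by
    intro s hs
    by_contra! hle
    exact absurd (ht ⟨⟨hs.1, hs.2.le.trans htA.1.2⟩, hle⟩) (not_le.2 hs.2)
  have hsub : Icc 0 t ⊆ Icc 0 t₁ := Icc_subset_Icc_right htA.1.2
  have ht0 : 0 < t := by
    refine lt_of_le_of_ne htA.1.1 fun h0 => ?_
    have h1 : τ ≤ u (x + t • b) := htA.2
    rw [← h0, zero_smul, add_zero] at h1
    exact absurd hτu (not_lt.2 h1)
  have hut : u (x + t • b) = τ := by
    refine le_antisymm ?_ htA.2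
    have h1 : Tendsto (fun s : ℝ => u (x + s • b)) (𝓝[<] t) (𝓝 (u (x + t • b))) :=
      ((h.differentiableAt (hseg t htA.1)).continuousAt.tendsto.comp (hline.tendsto t)).mono_left
        nhdsWithin_le_nhds
    refine le_of_tendsto h1 ?_
    filter_upwards [Ioo_mem_nhdsLT ht0] with s hs using (hlow s ⟨hs.1.le, hs.2⟩).le
  have hval : ∀ s ∈ Icc 0 t, u (x + s • b) ∈ Ico 0 M := by
    intro s hs
    refine ⟨(h.positive _ (hseg s (hsub hs))).le, ?_⟩
    rcases eq_or_lt_of_le hs.2 with h0 | h0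
    · rw [h0, hut]; exact hτ.2
    · exact (hlow s ⟨hs.1, h0⟩).trans hτ.2
  have hder : ∀ s ∈ Icc 0 t, HasDerivAt (fun s : ℝ => profileTime F P₀ (u (x + s • b)) - s)
      ((√(P₀ - 2 * F (u (x + s • b))))⁻¹ * fderiv ℝ u (x + s • b) b - 1) s := by
    intro s hs
    have h1 := hasDerivAt_profileTime h.hasDerivAt (hval s hs).1 fun r hr =>
      hM r ⟨hr.1, hr.2.trans_lt (hval s hs).2⟩
    exact (h1.comp s (hasDerivAt_line (h.differentiableAt (hseg s (hsub hs))))).sub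
      (hasDerivAt_id s)
  have hanti : AntitoneOn (fun s : ℝ => profileTime F P₀ (u (x + s • b)) - s) (Icc 0 t) := by
    refine antitoneOn_of_deriv_nonpos (convex_Icc 0 t)
      (fun s hs => (hder s hs).continuousAt.continuousWithinAt)
      (fun s hs => (hder s (interior_subset hs)).differentiableAt.differentiableWithinAt)
      fun s hs => ?_
    have hs' := interior_subset hs
    rw [(hder s hs').deriv]
    have hg : 0 < √(P₀ - 2 * F (u (x + s • b))) := Real.sqrt_pos.2 (hM _ (hval s hs'))
    have h1 : fderiv ℝ u (x + s • b) b ≤ √(P₀ - 2 * F (u (x + s • b))) := by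
      rw [← inner_gradient_left]
      refine (real_inner_le_norm _ _).trans ?_
      rw [hb, mul_one]
      exact h.norm_gradient_le (hseg s (hsub hs'))
    have h2 : (√(P₀ - 2 * F (u (x + s • b))))⁻¹ * fderiv ℝ u (x + s • b) b ≤ 1 := by
      rw [inv_mul_le_iff₀ hg, mul_one]; exact h1
    linarith
  have h1 := hanti ⟨le_rfl, ht0.le⟩ ⟨ht0.le, le_rfl⟩ ht0.le
  simp only [hut, zero_smul, add_zero, sub_zero] at h1
  linarith [htA.1.2]

/-- The difference of `u` and its reflection solves a linear inequality. -/
theorem isSupersolution_sub_reflection (h : IsPBoundedSolution Ω f F P₀ u) {U V : Set (Euc n)}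
    (ρ : Euc n ≃ₗᵢ[ℝ] Euc n) (d : Euc n) {K : NNReal} {S : Set ℝ} (hf : LipschitzOnWith K f S)
    (hUV : U ⊆ V) (hVΩ : V ⊆ Ω) (hρ : ∀ x ∈ U, ρ x + d ∈ V) (hS : ∀ x ∈ V, u x ∈ S)
    (hle : ∀ x ∈ U, u (ρ x + d) ≤ u x) :
    IsSupersolution U K (fun x => u x - u (ρ x + d)) := by
  have hdiff : ∀ x ∈ U, DifferentiableAt ℝ (fun x => u x - u (ρ x + d)) x := by
    intro x hx
    have h1 : DifferentiableAt ℝ (fun x => ρ x + d) x :=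
      (ρ.toContinuousLinearEquiv.differentiableAt).add_const d
    exact (h.differentiableAt (hVΩ (hUV hx))).sub
      (DifferentiableAt.comp x (h.differentiableAt (hVΩ (hρ x hx))) h1)
  refine ⟨fun x hx => sub_nonneg.2 (hle x hx), hdiff, fun x hx => ?_⟩
  have hxV := hUV hx
  have hu2 : ∀ y ∈ V, ContDiffAt ℝ 2 u y := fun y hy =>
    (h.contDiffAt (hVΩ hy)).of_le (by norm_num)
  have hline : ∀ i, HasLineDerivTwo (fun x => u x - u (ρ x + d)) x (stdVec i)
      (fderiv ℝ u x (stdVec i) - fderiv ℝ u (ρ x + d) (ρ (stdVec i)))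
      (fderiv ℝ (fderiv ℝ u) x (stdVec i) (stdVec i) -
        fderiv ℝ (fderiv ℝ u) (ρ x + d) (ρ (stdVec i)) (ρ (stdVec i))) := by
    intro i
    have h1 := HasDerivTwo.congr (z := fun t : ℝ => u (ρ (x + t • stdVec i) + d))
      ((hu2 _ (hρ x hx)).hasLineDerivTwo (ρ (stdVec i)))
      (Eventually.of_forall fun t => by
        simp only [map_add, map_smul]
        congr 1
        abel)
    exact HasDerivTwo.sub ((hu2 x hxV).hasLineDerivTwo (stdVec i)) h1
  refine ⟨_, fun i => (hline i).eq_fderiv (hdiff x hx) ▸ hline i, ?_⟩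
  have e1 := laplacian_eq_sum u x (EuclideanSpace.basisFun (Fin n) ℝ)
  -- At the mirror point the Laplacian is computed in the reflected basis, so that the two sums pair
  -- direction by direction.
  have e2 := laplacian_eq_sum u (ρ x + d) ((EuclideanSpace.basisFun (Fin n) ℝ).map ρ)
  simp only [OrthonormalBasis.map_apply] at e2
  rw [Finset.sum_sub_distrib, ← e1, ← e2]
  have h1 := h.equation x (hVΩ hxV)
  have h2 := h.equation _ (hVΩ (hρ x hx))
  have h3 := hf.dist_le_mul _ (hS _ (hρ x hx)) _ (hS x hxV)
  rw [Real.dist_eq, Real.dist_eq, abs_sub_comm (u (ρ x + d)),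
    abs_of_nonneg (sub_nonneg.2 (hle x hx))] at h3
  have h4 := le_abs_self (f (u (ρ x + d)) - f (u x))
  have h5 : 0 ≤ (K : ℝ) * ‖fderiv ℝ (fun x => u x - u (ρ x + d)) x‖ := by positivity
  rw [mul_add]
  linarith

end IsPBoundedSolution

namespace IsPBoundedSolution

variable {n : ℕ} {Ω : Set (Euc n)} {f F : ℝ → ℝ} {P₀ M T : ℝ} {u : Euc n → ℝ} {e p : Euc n}

/-- Beyond the hyperplane where `u` attains its maximal height, `u` is the reflected profile. -/
theorem exists_reflected_seed (h : IsPBoundedSolution Ω f F P₀ u) (hf : LocallyLipschitz f)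
    (hM : ∀ r ∈ Ico 0 M, 0 < P₀ - 2 * F r)
    (hT : IsLUB (profileTime F P₀ '' Ico 0 M) T) (hT0 : 0 < T) (he : ‖e‖ = 1)
    (hstrip : ∀ x, ⟪e, x - p⟫ ∈ Ioo 0 T →
      x ∈ Ω ∧ u x < M ∧ profileTime F P₀ (u x) = ⟪e, x - p⟫)
    (hface : ∀ x, ⟪e, x - p⟫ = T → x ∈ Ω ∧ u x = M ∧ ∇ u x = 0) :
    ∃ x, ⟪e, x - p⟫ ∈ Ioo T (2 * T) ∧ x ∈ Ω ∧ u x < M ∧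
      ∀ᶠ y in 𝓝 x, profileTime F P₀ (u y) = 2 * T - ⟪e, y - p⟫ := by
  have hmono := strictMonoOn_profileTime h.hasDerivAt hM
  have hee : ⟪e, e⟫ = 1 := by rw [real_inner_self_eq_norm_sq, he, one_pow]
  set x₀ : Euc n := p + T • e with hx₀
  have hx₀T : ⟪e, x₀ - p⟫ = T := by
    rw [hx₀, add_sub_cancel_left, inner_smul_right, hee, mul_one]
  obtain ⟨hx₀Ω, hx₀M, hx₀g⟩ := hface x₀ hx₀T
  -- A Lipschitz constant near the height `M` is enough: the comparison takes place in a small ball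
  -- about `x₀`, where `u` is close to `M`.
  obtain ⟨K, S, hS, hK⟩ := hf M
  have hcont := (h.differentiableAt hx₀Ω).continuousAt
  obtain ⟨r, hr, hrU⟩ := Metric.eventually_nhds_iff_ball.1
    ((h.isOpen.eventually_mem hx₀Ω).and (hcont.eventually (hx₀M ▸ hS)))
  set R := min (r / 2) (T / 2) with hR
  have hRpos : 0 < R := by positivity
  have hR1 : 2 * R ≤ r := by linarith [min_le_left (r / 2) (T / 2)]
  have hR2 : 2 * R ≤ T := by linarith [min_le_right (r / 2) (T / 2)]
  set q := x₀ + R • e with hq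
  set U := Metric.ball q R with hU
  set V := Metric.ball x₀ (2 * R) with hV
  have hVr : V ⊆ Metric.ball x₀ r := Metric.ball_subset_ball hR1
  have hVΩ : V ⊆ Ω := fun x hx => (hrU x (hVr hx)).1
  have hqx₀ : ‖q - x₀‖ = R := by
    rw [hq, add_sub_cancel_left, norm_smul, he, mul_one, Real.norm_eq_abs, abs_of_pos hRpos]
  have hUV : U ⊆ V := fun x hx => by
    have h1 := dist_triangle x q x₀
    have h2 : dist x q < R := hx
    rw [dist_eq_norm q x₀, hqx₀] at h1
    rw [hV, Metric.mem_ball]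
    linarith
  have hsx : ∀ x, ⟪e, x - p⟫ = T + ⟪e, x - x₀⟫ := fun x => by
    rw [← hx₀T, ← inner_add_right]; congr 1; abel
  have hsV : ∀ x ∈ V, |⟪e, x - x₀⟫| < T := by
    intro x hx
    have h1 := abs_real_inner_le_norm e (x - x₀)
    rw [he, one_mul, ← dist_eq_norm] at h1
    have h2 : dist x x₀ < 2 * R := hx
    linarith
  have hsU : ∀ x ∈ U, 0 < ⟪e, x - x₀⟫ := by
    intro x hx
    have h1 : ⟪e, x - x₀⟫ = ⟪e, x - q⟫ + R := by
      have : x - x₀ = (x - q) + R • e := by rw [hq]; abel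
      rw [this, inner_add_right, inner_smul_right, hee, mul_one]
    have h2 := abs_real_inner_le_norm e (x - q)
    rw [he, one_mul, ← dist_eq_norm] at h2
    have h3 : dist x q < R := hx
    linarith [(abs_le.1 h2).1]
  set ρ : Euc n ≃ₗᵢ[ℝ] Euc n := (Submodule.span ℝ {e})ᗮ.reflection with hρ
  have hρa : ∀ v, ρ v = v - (2 * ⟪e, v⟫) • e := fun v => by
    rw [hρ, Submodule.reflection_orthogonal_apply, Submodule.reflection_singleton_apply]
    simp [he]
    rw [mul_smul, two_smul, two_smul]
  set d := x₀ - ρ x₀ with hd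
  have hρd : ∀ x, ρ x + d = x₀ + ρ (x - x₀) := fun x => by rw [hd, map_sub]; abel
  have hρV : ∀ x ∈ V, ρ x + d ∈ V := by
    intro x hx
    rw [hρd, hV, Metric.mem_ball, dist_eq_norm, add_sub_cancel_left, ρ.norm_map, ← dist_eq_norm]
    exact hx
  have hρs : ∀ x, ⟪e, ρ x + d - p⟫ = 2 * T - ⟪e, x - p⟫ := by
    intro x
    rw [hsx, hsx x, hρd, add_sub_cancel_left, hρa, inner_sub_right, inner_smul_right, hee]
    ring
  have hρU : ∀ x ∈ U, ρ x + d ∈ Ω ∧ u (ρ x + d) < M ∧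
      profileTime F P₀ (u (ρ x + d)) = 2 * T - ⟪e, x - p⟫ := by
    intro x hx
    have h1 := hsU x hx
    have h2 := (abs_lt.1 (hsV x (hUV hx))).2
    have := hstrip (ρ x + d) (by
      rw [hρs, hsx]; exact ⟨by linarith, by linarith⟩)
    rwa [hρs] at this
  -- Otherwise `u x < M`, and the descent bound along the perpendicular from the face gives
  -- `profileTime (u x) ≥ T - t₁`, which is the value at the mirror point.
  have hle : ∀ x ∈ U, u (ρ x + d) ≤ u x := by
    intro x hx
    by_contra! hlt
    obtain ⟨hyΩ, hyM, hyt⟩ := hρU x hx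
    set t₁ := ⟪e, x - x₀⟫ with ht₁
    have ht₁0 : 0 < t₁ := hsU x hx
    have hfoot : ⟪e, x + t₁ • -e - p⟫ = T := by
      rw [hsx]
      have : x + t₁ • -e - x₀ = (x - x₀) - t₁ • e := by rw [smul_neg]; abel
      rw [this, inner_sub_right, inner_smul_right, hee]
      linarith
    have hfootV : x + t₁ • -e ∈ V := by
      have h1 : x + t₁ • -e - x₀ = (x - x₀) - t₁ • e := by rw [smul_neg]; abel
      rw [hV, Metric.mem_ball, dist_eq_norm, h1]
      refine lt_of_le_of_lt ?_ (dist_eq_norm x x₀ ▸ hUV hx : ‖x - x₀‖ < 2 * R)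
      refine pow_le_pow_iff_left₀ (norm_nonneg _) (norm_nonneg _) two_ne_zero |>.1 ?_
      rw [norm_sub_sq_real, inner_smul_right, real_inner_comm, ← ht₁, norm_smul, he, mul_one,
        Real.norm_eq_abs, sq_abs]
      nlinarith
    have hxΩ := hVΩ (hUV hx)
    have hseg : ∀ t ∈ Icc 0 t₁, x + t • -e ∈ Ω := by
      intro t ht
      have hconv := (convex_ball x₀ (2 * R)).segment_subset (hUV hx) hfootV
      refine hVΩ (hconv ?_)
      rw [segment_eq_image']
      refine ⟨t / t₁, ⟨div_nonneg ht.1 ht₁0.le, (div_le_one ht₁0).2 ht.2⟩, ?_⟩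
      simp only [add_sub_cancel_left, smul_smul]
      rw [div_mul_cancel₀ _ ht₁0.ne']
    have huM : u x < M := hlt.trans hyM
    have hxm : u x ∈ Ico 0 M := ⟨(h.positive x hxΩ).le, huM⟩
    have key : T ≤ profileTime F P₀ (u x) + t₁ := by
      refine hT.2 ?_
      rintro _ ⟨τ, hτ, rfl⟩
      rcases h.profileTime_le_of_descent hM (by rw [norm_neg, he]) ht₁0.le hseg
        (hface _ hfoot).2.1 hτ with h1 | h1
      · have := hmono.monotoneOn hτ hxm h1
        linarith
      · exact h1
    have h2 := hmono hxm ⟨(h.positive _ hyΩ).le, hyM⟩ hlt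
    rw [hyt, hsx, ← ht₁] at h2
    linarith
  have hsup := h.isSupersolution_sub_reflection ρ d hK hUV hVΩ (fun x hx => hρV x (hUV hx))
    (fun x hx => (hrU x (hVr hx)).2) hle
  -- The ball `U` touches the face at `x₀`, where `∇u = 0`. The difference therefore has zero
  -- derivative there along `e`, and the Hopf alternative is impossible.
  have hzero : ∀ x ∈ U, u x - u (ρ x + d) = 0 := by
    refine (hsup.eq_zero_or_hopf K.2 hRpos).resolve_right ?_
    rintro ⟨c, hc, hcv⟩
    have hlp : HasDerivAt (fun t : ℝ => u (x₀ + t • e)) 0 0 := by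
      have hx : x₀ + (0 : ℝ) • e = x₀ := by simp
      have := hasDerivAt_line (v := u) (x := x₀) (e := e) (t := 0)
        (by rw [hx]; exact h.differentiableAt hx₀Ω)
      rwa [hx, ← inner_gradient_left, hx₀g, inner_zero_left] at this
    have hlm : HasDerivAt (fun t : ℝ => u (x₀ + t • -e)) 0 0 := by
      have hx : x₀ + (0 : ℝ) • -e = x₀ := by simp
      have := hasDerivAt_line (v := u) (x := x₀) (e := -e) (t := 0)
        (by rw [hx]; exact h.differentiableAt hx₀Ω)
      rwa [hx, ← inner_gradient_left, hx₀g, inner_zero_left] at this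
    have hl : HasDerivAt (fun t : ℝ => u (x₀ + t • e) - u (x₀ + t • -e)) 0 0 :=
      (hlp.sub hlm).congr_deriv (sub_zero 0)
    refine not_linear_growth hl (by simp) (k := c * R) (by positivity) hRpos fun t ht => ?_
    have hn : ‖x₀ + t • e - q‖ = R - t := by
      have : x₀ + t • e - q = (t - R) • e := by rw [hq, sub_smul]; abel
      rw [this, norm_smul, he, mul_one, Real.norm_eq_abs, abs_of_neg (by linarith [ht.2])]
      ring
    have h1 := hcv (x₀ + t • e) (by
      rw [Metric.mem_ball, dist_eq_norm, hn]; linarith [ht.1])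
    have h2 : ρ (x₀ + t • e) + d = x₀ + t • -e := by
      rw [hρd, add_sub_cancel_left, hρa, inner_smul_right, hee, smul_neg]
      module
    rw [h2, hn] at h1
    refine le_trans ?_ h1
    have h3 : 0 ≤ t * (R - t) := mul_nonneg ht.1.le (by linarith [ht.2])
    nlinarith
  have hqU : q ∈ U := Metric.mem_ball_self hRpos
  have hqs : ⟪e, q - p⟫ = T + R := by
    rw [hsx, hq, add_sub_cancel_left, inner_smul_right, hee, mul_one]
  refine ⟨q, ⟨by linarith, by linarith⟩, hVΩ (hUV hqU), ?_, ?_⟩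
  · have := hzero q hqU
    have h1 := (hρU q hqU).2.1
    linarith
  · filter_upwards [Metric.isOpen_ball.mem_nhds hqU] with y hy
    rw [sub_eq_zero.1 (hzero y hy)]
    exact (hρU y hy).2.2

/-- A locally one-dimensional solution is one-dimensional, on a half-space or a slab. -/
theorem halfSpace_or_slab (h : IsPBoundedSolution Ω f F P₀ u) (hΩ : IsPreconnected Ω)
    (hf : LocallyLipschitz f) (hM0 : 0 < M) (hM : ∀ r ∈ Ico 0 M, 0 < P₀ - 2 * F r)
    (hmax : P₀ - 2 * F M ≤ 0 ∨ ∀ x ∈ Ω, u x < M) (he : ‖e‖ = 1) {x₁ : Euc n} (hx₁ : x₁ ∈ Ω)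
    (hx₁M : u x₁ < M) (hx₁p : 0 < ⟪e, x₁ - p⟫)
    (hseed : ∀ᶠ y in 𝓝 x₁, profileTime F P₀ (u y) = ⟪e, y - p⟫) :
    (∀ x ∈ Ω, PFunction F u x = P₀) ∧ (∃ g : ℝ → ℝ, ∀ x ∈ Ω, u x = g ⟪e, x - p⟫) ∧
      (Ω = halfSpace e p ∨ ∃ L : ℝ, 0 < L ∧ Ω = slab e p L) := by
  have hmono := strictMonoOn_profileTime h.hasDerivAt hM
  have hee : ⟪e, e⟫ = 1 := by rw [real_inner_self_eq_norm_sq, he, one_pow]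
  have hl : ∀ x, ⟪e, x - p⟫ = ⟪e, x⟫ + -⟪e, p⟫ := fun x => by rw [inner_sub_right]; ring
  have hcs : Continuous fun x : Euc n => ⟪e, x - p⟫ := by fun_prop
  have hinj : ∀ {x y : Euc n}, x ∈ Ω → y ∈ Ω → u x < M → u y < M →
      profileTime F P₀ (u x) = profileTime F P₀ (u y) → u x = u y := fun hx hy hxM hyM hxy =>
    hmono.injOn ⟨(h.positive _ hx).le, hxM⟩ ⟨(h.positive _ hy).le, hyM⟩ hxy
  have hpe : ∀ t : ℝ, ⟪e, p + t • e - p⟫ = t := fun t => by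
    rw [add_sub_cancel_left, inner_smul_right, hee, mul_one]
  have hprop : ∀ L : ℝ, (∀ t ∈ Ioo 0 L, ∃ σ ∈ Ioo 0 M, profileTime F P₀ σ = t) →
      ⟪e, x₁ - p⟫ < L → ∀ x, ⟪e, x - p⟫ ∈ Ioo 0 L →
      x ∈ Ω ∧ u x < M ∧ profileTime F P₀ (u x) = ⟪e, x - p⟫ ∧ PFunction F u x = P₀ ∧
        ∇ u x = √(P₀ - 2 * F (u x)) • e := by
    intro L hL hx₁L x hx
    simp only [hl] at hx₁p hx₁L hseed hx ⊢
    exact h.strip_propagation hM hL he hx₁ hx₁M ⟨hx₁p, hx₁L⟩ hseed hx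
  -- A finite time `T` up to the height `M` leads to a slab of width `2T`, an infinite one to a
  -- half-space.
  by_cases hbdd : BddAbove (profileTime F P₀ '' Ico 0 M)
  · set T := sSup (profileTime F P₀ '' Ico 0 M) with hTdef
    have hT : IsLUB (profileTime F P₀ '' Ico 0 M) T :=
      isLUB_csSup ⟨_, mem_image_of_mem _ ⟨le_rfl, hM0⟩⟩ hbdd
    have hT0 : 0 < T := by
      have := h.profileTime_lt_of_isLUB hM hT ⟨le_rfl, hM0⟩
      rwa [profileTime_zero] at this
    have hL : ∀ t ∈ Ioo 0 T, ∃ σ ∈ Ioo 0 M, profileTime F P₀ σ = t := by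
      intro t ht
      obtain ⟨_, ⟨σ, hσ, rfl⟩, hσt⟩ := (lt_isLUB_iff hT).1 ht.2
      exact exists_profileTime_eq h.hasDerivAt hM hσ ht.1 hσt
    have hx₁T : ⟪e, x₁ - p⟫ < T := by
      rw [← hseed.self_of_nhds]
      exact h.profileTime_lt_of_isLUB hM hT ⟨(h.positive _ hx₁).le, hx₁M⟩
    have hstrip := hprop T hL hx₁T
    have hface : ∀ x, ⟪e, x - p⟫ = T → x ∈ Ω ∧ u x = M := by
      intro x hx
      simp only [hl] at hx hstrip
      exact h.eq_height_of_strip hM0 hM hT he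
        (fun y hy => ⟨(hstrip y hy).1, (hstrip y hy).2.1, (hstrip y hy).2.2.1⟩) hx
    -- The far face lies in `Ω` and `u = M` on it, so `M` is attained and the gap must close there.
    have hgapM : P₀ - 2 * F M ≤ 0 := by
      refine hmax.resolve_right fun hlt => ?_
      obtain ⟨h1, h2⟩ := hface (p + T • e) (hpe T)
      exact (hlt _ h1).ne h2
    have hface' : ∀ x, ⟪e, x - p⟫ = T → x ∈ Ω ∧ u x = M ∧ ∇ u x = 0 := by
      intro x hx
      obtain ⟨h1, h2⟩ := hface x hx
      refine ⟨h1, h2, ?_⟩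
      have h3 := h.norm_gradient_sq_le h1
      rw [h2] at h3
      exact norm_eq_zero.1 (pow_eq_zero_iff two_ne_zero |>.1
        (le_antisymm (h3.trans hgapM) (sq_nonneg _)))
    obtain ⟨x₂, hx₂s, hx₂Ω, hx₂M, hx₂seed⟩ := h.exists_reflected_seed hf hM hT hT0 he
      (fun y hy => ⟨(hstrip y hy).1, (hstrip y hy).2.1, (hstrip y hy).2.2.1⟩) hface'
    have hl' : ∀ x, 2 * T - ⟪e, x - p⟫ = ⟪-e, x⟫ + (2 * T + ⟪e, p⟫) := fun x => by
      rw [inner_sub_right, inner_neg_left]; ring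
    have hstrip' : ∀ x, 2 * T - ⟪e, x - p⟫ ∈ Ioo 0 T →
        x ∈ Ω ∧ u x < M ∧ profileTime F P₀ (u x) = 2 * T - ⟪e, x - p⟫ ∧
          PFunction F u x = P₀ ∧ ∇ u x = √(P₀ - 2 * F (u x)) • -e := by
      intro x hx
      have hx₂L : 2 * T - ⟪e, x₂ - p⟫ ∈ Ioo 0 T :=
        ⟨by linarith [hx₂s.2], by linarith [hx₂s.1]⟩
      simp only [hl'] at hx hx₂seed hx₂L ⊢
      exact h.strip_propagation hM hL (by rw [norm_neg, he]) hx₂Ω hx₂M hx₂L hx₂seed hx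
    have h0 : ∀ x, ⟪e, x - p⟫ = 0 → x ∉ Ω := by
      intro x hx
      simp only [hl] at hx hstrip
      exact h.notMem_of_strip hM0 hM hT0 he
        (fun y hy => ⟨(hstrip y hy).1, (hstrip y hy).2.1, (hstrip y hy).2.2.1⟩) hx
    have h2T : ∀ x, ⟪e, x - p⟫ = 2 * T → x ∉ Ω := by
      intro x hx
      have hx' : 2 * T - ⟪e, x - p⟫ = 0 := by linarith
      simp only [hl'] at hx' hstrip'
      exact h.notMem_of_strip hM0 hM hT0 (by rw [norm_neg, he])
        (fun y hy => ⟨(hstrip' y hy).1, (hstrip' y hy).2.1, (hstrip' y hy).2.2.1⟩) hx'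
    have hcases : ∀ x, ⟪e, x - p⟫ ∈ Ioo 0 (2 * T) → ⟪e, x - p⟫ ∈ Ioo 0 T ∨
        ⟪e, x - p⟫ = T ∨ 2 * T - ⟪e, x - p⟫ ∈ Ioo 0 T := by
      intro x hx
      rcases lt_trichotomy ⟪e, x - p⟫ T with h1 | h1 | h1
      · exact Or.inl ⟨hx.1, h1⟩
      · exact Or.inr (Or.inl h1)
      · exact Or.inr (Or.inr ⟨by linarith [hx.2], by linarith⟩)
    -- `Ω` is connected, meets the open slab at `x₁`, and misses both of its bounding hyperplanes.
    have hsub : Ω ⊆ slab e p (2 * T) := by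
      refine hΩ.subset_left_of_subset_union (v := {x | ⟪e, x - p⟫ < 0 ∨ 2 * T < ⟪e, x - p⟫})
        ((isOpen_lt continuous_const hcs).inter (isOpen_lt hcs continuous_const))
        ((isOpen_lt hcs continuous_const).union (isOpen_lt continuous_const hcs)) ?_ ?_
        ⟨x₁, hx₁, hx₁p, by linarith⟩
      · rw [Set.disjoint_left]
        rintro x ⟨h1, h2⟩ (h3 | h3) <;> linarith
      · intro x hx
        rcases lt_trichotomy ⟪e, x - p⟫ 0 with h1 | h1 | h1
        · exact Or.inr (Or.inl h1)
        · exact absurd hx (h0 x h1)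
        · rcases lt_trichotomy ⟪e, x - p⟫ (2 * T) with h2 | h2 | h2
          · exact Or.inl ⟨h1, h2⟩
          · exact absurd hx (h2T x h2)
          · exact Or.inr (Or.inr h2)
    refine ⟨fun x hx => ?_, ⟨fun t => u (p + t • e), fun x hx => ?_⟩, Or.inr ⟨2 * T, by linarith,
      Subset.antisymm hsub fun x hx => ?_⟩⟩
    · rcases hcases x (hsub hx) with h1 | h1 | h1
      · exact (hstrip x h1).2.2.2.1
      · obtain ⟨h2, h3, h4⟩ := hface' x h1
        have h5 := h.norm_gradient_sq_le h2
        rw [h4, norm_zero, h3] at h5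
        rw [PFunction, h4, norm_zero, h3]
        linarith
      · exact (hstrip' x h1).2.2.2.1
    · have hy := hpe ⟪e, x - p⟫
      rcases hcases x (hsub hx) with h1 | h1 | h1
      · have h2 := hstrip x h1
        have h3 := hstrip (p + ⟪e, x - p⟫ • e) (by rw [hy]; exact h1)
        exact hinj h2.1 h3.1 h2.2.1 h3.2.1 (by rw [h2.2.2.1, h3.2.2.1, hy])
      · exact (hface x h1).2.trans (hface (p + ⟪e, x - p⟫ • e) (by rw [hy]; exact h1)).2.symm
      · have h2 := hstrip' x h1
        have h3 := hstrip' (p + ⟪e, x - p⟫ • e) (by rw [hy]; exact h1)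
        exact hinj h2.1 h3.1 h2.2.1 h3.2.1 (by rw [h2.2.2.1, h3.2.2.1, hy])
    · rcases hcases x hx with h1 | h1 | h1
      · exact (hstrip x h1).1
      · exact (hface x h1).1
      · exact (hstrip' x h1).1
  · have hL : ∀ L : ℝ, ∀ t ∈ Ioo 0 L, ∃ σ ∈ Ioo 0 M, profileTime F P₀ σ = t := by
      intro L t ht
      obtain ⟨_, ⟨σ, hσ, rfl⟩, hσt⟩ := not_bddAbove_iff.1 hbdd t
      exact exists_profileTime_eq h.hasDerivAt hM hσ ht.1 hσt
    have hstrip : ∀ x, 0 < ⟪e, x - p⟫ → x ∈ Ω ∧ u x < M ∧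
        profileTime F P₀ (u x) = ⟪e, x - p⟫ ∧ PFunction F u x = P₀ := by
      intro x hx
      -- Every width is available here; this one contains both the seed and `x`.
      obtain ⟨h1, h2, h3, h4, -⟩ := hprop (⟪e, x₁ - p⟫ + ⟪e, x - p⟫) (hL _) (by linarith) x
        ⟨hx, by linarith⟩
      exact ⟨h1, h2, h3, h4⟩
    have h0 : ∀ x, ⟪e, x - p⟫ = 0 → x ∉ Ω := by
      intro x hx
      simp only [hl] at hx hstrip
      exact h.notMem_of_strip hM0 hM one_pos he
        (fun y hy => ⟨(hstrip y hy.1).1, (hstrip y hy.1).2.1, (hstrip y hy.1).2.2.1⟩) hx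
    have hsub : Ω ⊆ halfSpace e p := by
      refine hΩ.subset_left_of_subset_union (v := {x | ⟪e, x - p⟫ < 0})
        (isOpen_lt continuous_const hcs) (isOpen_lt hcs continuous_const) ?_ ?_ ⟨x₁, hx₁, hx₁p⟩
      · rw [Set.disjoint_left]
        intro x (h1 : 0 < ⟪e, x - p⟫) (h3 : ⟪e, x - p⟫ < 0)
        linarith
      · intro x hx
        rcases lt_trichotomy ⟪e, x - p⟫ 0 with h1 | h1 | h1
        · exact Or.inr h1
        · exact absurd hx (h0 x h1)
        · exact Or.inl h1
    refine ⟨fun x hx => (hstrip x (hsub hx)).2.2.2, ⟨fun t => u (p + t • e), fun x hx => ?_⟩,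
      Or.inl (Subset.antisymm hsub fun x hx => (hstrip x hx).1)⟩
    have hy := hpe ⟪e, x - p⟫
    have h2 := hstrip x (hsub hx)
    have h3 := hstrip (p + ⟪e, x - p⟫ • e) (by rw [hy]; exact hsub hx)
    exact hinj h2.1 h3.1 h2.2.1 h3.2.1 (by rw [h2.2.2.1, h3.2.2.1, hy])

end IsPBoundedSolution

/-! ### The two alternatives at a boundary point -/

theorem IsBoundedSolution.isPBoundedSolution {n : ℕ} {Ω : Set (Euc n)} {f F : ℝ → ℝ} {κ P₀ : ℝ}
    {u : Euc n → ℝ} (hu : IsBoundedSolution Ω f κ u) (hΩ : IsOpen Ω) (hf : Continuous f)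
    (hF : ∀ t, HasDerivAt F (f t) t) (hP : ∀ x ∈ Ω, PFunction F u x ≤ P₀) :
    IsPBoundedSolution Ω f F P₀ u :=
  ⟨hΩ, hu.contDiffOn_interior, hu.contDiffOn_closure.continuousOn, hu.equation, hu.positive,
    hu.dirichlet, hf, hF, hP⟩

theorem IsBoundedSolution.exists_isBoundaryData {n : ℕ} {Ω : Set (Euc n)} {f F : ℝ → ℝ} {κ : ℝ}
    {u : Euc n → ℝ} {p : Euc n} (hn : 2 ≤ n) (hu : IsBoundedSolution Ω f κ u)
    (hΩ : IsRegularDomain Ω) (h : IsPBoundedSolution Ω f F (κ ^ 2 + 2 * F 0) u) (hκ : κ ≠ 0)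
    (hp : p ∈ frontier Ω) : ∃ e B M, IsBoundaryData Ω f F κ u p e B M ∧
      (κ ^ 2 + 2 * F 0 - 2 * F M ≤ 0 ∨ ∀ x ∈ Ω, u x < M) := by
  obtain ⟨φ, hφ⟩ := hΩ.exists_definingFunction p hp
  have hκ0 := hu.kappa_pos hφ hp hκ
  obtain ⟨e, B, hm⟩ := hφ.exists_secondOrderModel h.isOpen hn
  obtain ⟨A, hA⟩ := hu.bounded
  -- The ceiling `|A| + 1` exceeds every value of `u`, so if the gap does not close at `M`, then `u`
  -- stays below `M`.
  obtain ⟨M, hM0, hM, hM'⟩ := exists_height (A := |A| + 1) (P₀ := κ ^ 2 + 2 * F 0) h.hasDerivAt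
    (by positivity) (by rw [add_sub_cancel_right]; positivity)
  refine ⟨e, B, M, ⟨h, hm, hκ0, hp, hM0, hM, ?_, ?_⟩, hM'.imp_right ?_⟩
  · filter_upwards [hφ.eventually_frontier h.isOpen] with x hx hxf
    exact (hu.boundary_gradient h (hx hxf) hxf hκ0).1
  · have := (hu.boundary_gradient h hφ hp hκ0).2
    rwa [hm.normal_eq, neg_neg] at this
  · rintro rfl x hx
    linarith [le_abs_self (u x), hA x hx, le_abs_self A]

namespace IsBoundaryData

variable {n : ℕ} {Ω : Set (Euc n)} {f F : ℝ → ℝ} {κ : ℝ} {u : Euc n → ℝ} {p e : Euc n}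
  {B : Euc n →L[ℝ] Euc n} {M : ℝ}

/-- With `c = 0` the slope hypothesis of `profileTime_le` is just `|∇u| ≤ √(P₀ - 2F(u))`, the bound
on `P`. -/
theorem meanCurvature_nonpos (h : IsBoundaryData Ω f F κ u p e B M) (hn : 2 ≤ n) :
    meanCurvature Ω p ≤ 0 := by
  have h1 := h.meanCurvature_add_le le_rfl fun ε hε =>
    h.profileTime_le le_rfl le_rfl (by
      filter_upwards [self_mem_nhdsWithin] with x hx
      have h2 := real_inner_le_norm (∇ u x) e
      rw [h.model.norm_eq, mul_one] at h2
      simpa using h2.trans (h.solution.norm_gradient_le hx)) hε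
  have h2 : (2 : ℝ) ≤ n := by exact_mod_cast hn
  by_contra! h3
  nlinarith

/-- An interior touching ball on which the linear estimates for `P` are uniform. -/
theorem exists_ball (h : IsBoundaryData Ω f F κ u p e B M) :
    ∃ R > 0, Metric.ball (p + R • e) R ⊆ Ω ∧ ∀ x ∈ Metric.ball (p + R • e) R,
      κ / 2 ≤ ‖∇ u x‖ ∧ |f (u x)| ≤ |f 0| + 1 ∧ u x < M := by
  obtain ⟨C, hC, hint⟩ := h.model.interior_bound
  have h0 := h.tendsto_zero.mono_left (nhdsWithin_mono p subset_closure)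
  have h1 : ∀ᶠ x in 𝓝[Ω] p, κ / 2 ≤ ‖∇ u x‖ := by
    have h2 := h.tendsto_gradient.norm
    rw [norm_smul, h.model.norm_eq, mul_one, Real.norm_eq_abs, abs_of_pos h.kappa_pos] at h2
    exact (h2.eventually_const_lt (half_lt_self h.kappa_pos)).mono fun x hx => hx.le
  have h2 : ∀ᶠ x in 𝓝[Ω] p, |f (u x)| ≤ |f 0| + 1 :=
    (((h.solution.continuous.abs.tendsto 0).comp h0).eventually_lt_const
      (lt_add_one _)).mono fun x hx => hx.le
  have h3 : ∀ᶠ x in 𝓝[Ω] p, u x < M := h0.eventually_lt_const h.M_pos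
  obtain ⟨ρ, hρ, hb⟩ := Metric.eventually_nhds_iff_ball.1
    (hint.and (eventually_nhdsWithin_iff.1 (h1.and (h2.and h3))))
  -- In the touching ball `‖x - p‖² < 2R ⟪e, x - p⟫`, so `2RC ≤ 1` yields the hypothesis of
  -- `interior_bound`.
  set R := min (ρ / 2) (1 / (2 * C)) with hR
  have hRpos : 0 < R := by positivity
  have hRρ : 2 * R ≤ ρ := by linarith [min_le_left (ρ / 2) (1 / (2 * C))]
  have hRC : 2 * R * C ≤ 1 := by
    have := min_le_right (ρ / 2) (1 / (2 * C))
    rw [← hR, le_div_iff₀ (by positivity)] at this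
    linarith
  have hball : ∀ x ∈ Metric.ball (p + R • e) R, x ∈ Metric.ball p ρ ∧ x ∈ Ω := by
    intro x hx
    rw [Metric.mem_ball, dist_eq_norm] at hx
    have hxq : x - (p + R • e) = (x - p) - R • e := by abel
    have hxρ : x ∈ Metric.ball p ρ := by
      rw [Metric.mem_ball, dist_eq_norm]
      have h4 := norm_add_le (x - (p + R • e)) (R • e)
      rw [norm_smul, h.model.norm_eq, Real.norm_eq_abs, abs_of_pos hRpos, hxq,
        sub_add_cancel] at h4
      rw [hxq] at hx
      linarith
    refine ⟨hxρ, (hb x hxρ).1 ?_⟩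
    have h5 : ‖x - (p + R • e)‖ ^ 2 < R ^ 2 := by gcongr
    rw [hxq, norm_sub_sq_real, norm_smul, h.model.norm_eq, Real.norm_eq_abs, abs_of_pos hRpos,
      inner_smul_right, real_inner_comm] at h5
    nlinarith [sq_nonneg ‖x - p‖]
  exact ⟨R, hRpos, fun x hx => (hball x hx).2, fun x hx => (hb x (hball x hx).1).2 (hball x hx).2⟩

/-- If `P` is not constant near `p`, Hopf's lemma makes the mean curvature negative. -/
theorem meanCurvature_neg_of_hopf (h : IsBoundaryData Ω f F κ u p e B M) (hn : 2 ≤ n)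
    {R c : ℝ} (hR : 0 < R) (hc : 0 < c) (hhopf : ∀ x ∈ Metric.ball (p + R • e) R,
      c * (R ^ 2 - ‖x - (p + R • e)‖ ^ 2) ≤ κ ^ 2 + 2 * F 0 - PFunction F u x) :
    meanCurvature Ω p < 0 := by
  have hκ := h.kappa_pos
  have hgap : ∀ᶠ x in 𝓝[Ω] p, √(κ ^ 2 + 2 * F 0 - 2 * F (u x)) < √2 * κ :=
    h.tendsto_sqrt_gap.eventually_lt_const (by
      nlinarith [Real.lt_sqrt_of_sq_lt (show (1 : ℝ) ^ 2 < 2 by norm_num)])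
  -- Since `R² - ‖x - (p + R e)‖² = 2R ⟪e, x - p⟫ - ‖x - p‖²`, these constants turn Hopf's lower
  -- bound into `4κ²T`. Outside the ball that bound is nonpositive, and `P ≤ P₀` is enough.
  have h1 := h.meanCurvature_add_le (c := c * R / (2 * κ ^ 2)) (by positivity) fun ε hε =>
    h.profileTime_le (C := 1 / (2 * R)) (by positivity) (by positivity) (by
      filter_upwards [self_mem_nhdsWithin, hgap,
        h.tendsto_sqrt_gap.eventually_const_lt hκ] with x hx hw hw0
      have hG := real_inner_le_norm (∇ u x) e
      rw [h.model.norm_eq, mul_one] at hG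
      refine hG.trans ?_
      have hv0 := h.solution.PFunction_le x hx
      set w := √(κ ^ 2 + 2 * F 0 - 2 * F (u x)) with hwd
      set T := c * R / (2 * κ ^ 2) * (⟪e, x - p⟫ - 1 / (2 * R) * ‖x - p‖ ^ 2) with hT
      have hwsq : w ^ 2 = κ ^ 2 + 2 * F 0 - 2 * F (u x) :=
        Real.sq_sqrt (Real.sqrt_pos.1 hw0).le
      have hw2 : w ^ 2 ≤ 2 * κ ^ 2 := by
        have : w ^ 2 ≤ (√2 * κ) ^ 2 := by gcongr
        rwa [mul_pow, Real.sq_sqrt zero_le_two] at this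
      have hv : κ ^ 2 + 2 * F 0 - PFunction F u x = w ^ 2 - ‖∇ u x‖ ^ 2 := by
        rw [hwsq, PFunction]; ring
      have hTv : 4 * κ ^ 2 * T ≤ w ^ 2 - ‖∇ u x‖ ^ 2 := by
        have hTe : 4 * κ ^ 2 * T = c * (R ^ 2 - ‖x - (p + R • e)‖ ^ 2) := by
          rw [show x - (p + R • e) = (x - p) - R • e by abel, norm_sub_sq_real, norm_smul,
            h.model.norm_eq, Real.norm_eq_abs, abs_of_pos hR, inner_smul_right, real_inner_comm,
            hT]
          field_simp
          ring
        rw [hTe]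
        by_cases hxb : x ∈ Metric.ball (p + R • e) R
        · rw [← hv]; exact hhopf x hxb
        · rw [Metric.mem_ball, dist_eq_norm, not_lt] at hxb
          have : R ^ 2 ≤ ‖x - (p + R • e)‖ ^ 2 := by gcongr
          nlinarith
      have hTw : 2 * w ^ 2 * T ≤ w ^ 2 - ‖∇ u x‖ ^ 2 := by
        rcases le_total T 0 with h2 | h2
        · nlinarith [sq_nonneg w]
        · nlinarith
      -- By `hTw` this product is at least `(w - ‖∇u‖)²`.
      have h3 : 0 ≤ 2 * w * (w * (1 - T) - ‖∇ u x‖) := by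
        nlinarith [sq_nonneg (w - ‖∇ u x‖)]
      linarith [nonneg_of_mul_nonneg_right h3 (by positivity)]) hε
  have h2 : (2 : ℝ) ≤ n := by exact_mod_cast hn
  have h3 : 0 < c * R / (2 * κ ^ 2) := by positivity
  by_contra! h4
  nlinarith

/-- If `P` is constant on a touching ball, then `u` depends only on the distance to the tangent
hyperplane there. -/
theorem profileTime_eq_of_PFunction_eq (h : IsBoundaryData Ω f F κ u p e B M) {R : ℝ} (hR : 0 < R)
    (hball : Metric.ball (p + R • e) R ⊆ Ω)
    (hP : ∀ x ∈ Metric.ball (p + R • e) R, PFunction F u x = κ ^ 2 + 2 * F 0)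
    (hne : ∀ x ∈ Metric.ball (p + R • e) R, ∇ u x ≠ 0)
    (huM : ∀ x ∈ Metric.ball (p + R • e) R, u x < M) {y : Euc n}
    (hy : y ∈ Metric.ball (p + R • e) R) :
    profileTime F (κ ^ 2 + 2 * F 0) (u y) = ⟪e, y - p⟫ := by
  have hpre := (convex_ball (p + R • e) R).isPreconnected
  have hκ := h.kappa_pos
  have hseg : ∀ᶠ t in 𝓝[>] (0 : ℝ), p + t • e ∈ Metric.ball (p + R • e) R := by
    filter_upwards [Ioo_mem_nhdsGT hR] with t ht
    rw [Metric.mem_ball, dist_eq_norm, show p + t • e - (p + R • e) = (t - R) • e by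
      rw [sub_smul]; abel, norm_smul, h.model.norm_eq, mul_one, Real.norm_eq_abs,
      abs_of_neg (by linarith [ht.2])]
    linarith [ht.1]
  have hlim : Tendsto (fun t : ℝ => p + t • e) (𝓝[>] 0) (𝓝 p) := by
    have : Tendsto (fun t : ℝ => p + t • e) (𝓝 0) (𝓝 (p + (0 : ℝ) • e)) :=
      Continuous.tendsto (by fun_prop) 0
    rw [zero_smul, add_zero] at this
    exact this.mono_left nhdsWithin_le_nhds
  have hlimΩ : Tendsto (fun t : ℝ => p + t • e) (𝓝[>] 0) (𝓝[Ω] p) :=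
    tendsto_nhdsWithin_iff.2 ⟨hlim, hseg.mono fun t ht => hball ht⟩
  have hgr := h.tendsto_gradient.comp hlimΩ
  have hnorm : ‖κ • e‖ = κ := by
    rw [norm_smul, h.model.norm_eq, mul_one, Real.norm_eq_abs, abs_of_pos hκ]
  -- The direction is constant on the ball, and its limit at `p` along the normal is that of the
  -- boundary gradient `κ e`.
  have hdir : ‖∇ u y‖⁻¹ • ∇ u y = e := by
    have h1 := (hgr.norm.inv₀ (by rw [hnorm]; exact hκ.ne')).smul hgr
    rw [hnorm, smul_smul, inv_mul_cancel₀ hκ.ne', one_smul] at h1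
    refine tendsto_nhds_unique (tendsto_const_nhds.congr' ?_) h1
    filter_upwards [hseg] with t ht
    exact h.solution.normalized_gradient_eq Metric.isOpen_ball hpre hball hP hne hy ht
  have h2 : Tendsto (fun t : ℝ => profileTime F (κ ^ 2 + 2 * F 0) (u (p + t • e))) (𝓝[>] 0)
      (𝓝 0) := by
    have h3 := (h.hasDerivAt_profileTime (left_mem_Ico.2 h.M_pos)).continuousAt.tendsto.comp
      ((h.tendsto_zero.mono_left (nhdsWithin_mono p subset_closure)).comp hlimΩ)
    rwa [profileTime_zero] at h3
  have h3 : Tendsto (fun t : ℝ => ⟪e, p + t • e - y⟫) (𝓝[>] 0) (𝓝 ⟪e, p - y⟫) :=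
    tendsto_const_nhds.inner (hlim.sub_const y)
  have h4 := tendsto_nhds_unique ((h2.sub_const (profileTime F (κ ^ 2 + 2 * F 0) (u y))).congr' ?_) h3
  · rw [← neg_sub y p, inner_neg_right] at h4
    linarith
  · filter_upwards [hseg] with t ht
    rw [h.solution.profileTime_sub_eq h.gap_pos Metric.isOpen_ball hpre hball hP hne huM hy ht,
      hdir]

end IsBoundaryData

end

theorem theorem1p3 (n : ℕ) (hn : 2 ≤ n) (Ω : Set (Euc n)) (hΩ : IsRegularDomain Ω)
    (f F : ℝ → ℝ) (hf : LocallyLipschitz f) (hF : ∀ t : ℝ, HasDerivAt F (f t) t)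
    (κ : ℝ) (hκ : κ ≠ 0) (u : Euc n → ℝ) (hu : IsBoundedSolution Ω f κ u)
    (hP : ∀ x ∈ Ω, PFunction F u x ≤ κ ^ 2 + 2 * F 0) :
    (∀ p ∈ frontier Ω, meanCurvature Ω p ≤ 0) ∧
    ((∃ p ∈ frontier Ω, meanCurvature Ω p = 0) →
      (∃ c : ℝ, ∀ x ∈ Ω, PFunction F u x = c) ∧
      ∃ (a x₀ : Euc n) (g : ℝ → ℝ), ‖a‖ = 1 ∧
        (∀ x ∈ Ω, u x = g ⟪a, x - x₀⟫) ∧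
        (Ω = halfSpace a x₀ ∨ ∃ L : ℝ, 0 < L ∧ Ω = slab a x₀ L)) := by
  have h := hu.isPBoundedSolution hΩ.isOpen hf.continuous hF hP
  refine ⟨fun p hp => ?_, ?_⟩
  · obtain ⟨e, B, M, hb, -⟩ := hu.exists_isBoundaryData hn hΩ h hκ hp
    exact hb.meanCurvature_nonpos hn
  · rintro ⟨p, hp, hH⟩
    obtain ⟨e, B, M, hb, hmax⟩ := hu.exists_isBoundaryData hn hΩ h hκ hp
    obtain ⟨R, hR, hball, hbd⟩ := hb.exists_ball
    have hκ0 := hb.kappa_pos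
    have hs := h.isSupersolution (A := |f 0| + 1) (δ := κ / 2) Metric.isOpen_ball hball
      (by positivity) (by positivity) (fun z hz => (hbd z hz).2.1) fun z hz => (hbd z hz).1
    -- If `P₀ - P` vanishes on the ball, its centre seeds the one-dimensional form; the Hopf
    -- alternative makes the curvature at `p` negative, against `hH`.
    rcases hs.eq_zero_or_hopf (by positivity) hR with hz | ⟨c, hc, hhopf⟩
    · have hq : p + R • e ∈ Metric.ball (p + R • e) R := Metric.mem_ball_self hR
      obtain ⟨h1, ⟨g, h2⟩, h3⟩ := h.halfSpace_or_slab (p := p) hΩ.isConnected.isPreconnected hf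
        hb.M_pos hb.gap_pos hmax hb.model.norm_eq (hball hq) (hbd _ hq).2.2
        (by
          rw [add_sub_cancel_left, inner_smul_right, real_inner_self_eq_norm_sq, hb.model.norm_eq]
          simpa using hR)
        (by
          filter_upwards [Metric.isOpen_ball.mem_nhds hq] with y hy
          exact hb.profileTime_eq_of_PFunction_eq hR hball
            (fun x hx => (sub_eq_zero.1 (hz x hx)).symm)
            (fun x hx => norm_pos_iff.1 ((half_pos hκ0).trans_le (hbd x hx).1))
            (fun x hx => (hbd x hx).2.2) hy)
      exact ⟨⟨_, h1⟩, e, p, g, hb.model.norm_eq, h2, h3⟩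
    · exact absurd hH (hb.meanCurvature_neg_of_hopf hn hR hc hhopf).ne
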